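/- **Setting.** Let $N=L^2$, and let $N$ fermionic modes be mapped by the Jordan–Wigner transformation to one data qubit at each site of the $L\times L$ nearest-neighbour grid $G_L$. A Jordan–Wigner order is a bijection from the sites to $\{0,\dots,N-1\}$; the *snake* order sends $(r,c)$ to $rL+c$ for even $r$ and to $rL+(L-1-c)$ for odd $r$. For $\pi\in S_N$ the fermionic permutation is the unitary $F_\pi=P_\pi V_\pi$, where $V_\pi=\prod_{i<j,\ \pi(i)>\pi(j)}\mathrm{CZ}_{i,j}$ and $P_\pi$ moves the qubit at position $j$ to position $\pi(j)$. An *LOCC protocol* on $G_L$ with $m$ ancillas, each located at some site and initially in $|0\rangle$, is a finite adaptive sequence of (a) arbitrary quantum instruments acting on the qubits of one site, whose outcomes are broadcast and may determine everything that follows, and (b) layers of two-qubit unitary gates on pairwise disjoint pairs of qubits located at adjacent sites. Its *depth* is the largest number of layers, and its *gate count* the largest number of two-qubit gates in layers, over all branches; operations of type (a) are free. It implements $F_\pi$ if for every input state $\psi$ each branch leaves the data qubits in state $F_\pi\psi$ (up to a scalar), in a product with some state of the ancillas. *The algorithm.* Write the permutation of the sites induced by $\pi$ in the snake order as $\rho_B\circ\kappa\circ\rho_A$,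 with $\rho_A,\rho_B$ permuting within rows and $\kappa$ within columns. Perform $\rho_A$ by $L$ rounds of odd–even transposition with FSWAP gates $|st\rangle\mapsto(-1)^{st}|ts\rangle$ in all rows in parallel; then the circuit for $\Gamma$; then $\kappa$ by $L$ rounds of odd–even transposition in all columns with FSWAP gates on vertical neighbours (no parity correction); then $\Gamma$ again; then $\rho_B$ like $\rho_A$. *The circuit for $\Gamma$.* All gates are nearest-neighbour CNOT, CZ or single-qubit $Z$; $(r,c)\to(r',c')$ denotes a CNOT with control $(r,c)$. A *sweep* over row $r$ with forward and undo sets of pairs (offset $\delta$, gadget $g$) fires at step $t=0,1,2,\dots$ the gate $(r,t)\to(r,t+1)$ and, for each forward pair, the gates $g(t+\delta)$; then it does the same with the undo pairs for $t=L-2,L-3,\dots$ decreasing until no gate is in range. Gates with a qubit outside the grid are dropped. The gadgets of row $r$ are: $\mathrm{skip}^{\pm}(c)$, consisting of $\mathrm{CZ}((r{+}1,c),(r{+}2,c))$, $(r,c\pm1)\to(r{+}1,c\pm1)$, $\mathrm{CZ}((r{+}1,c\pm2),(r{+}2,c\pm2))$ and $(r,c\pm3)\to(r{+}1,c\pm3)$;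 $\mathrm{cross}(c)=\mathrm{CZ}((r,c),(r{+}1,c))$; $\mathrm{same}(c)=\mathrm{CZ}((r,c{-}1),(r,c))$; and $\mathrm{z}(c)$, which is $Z$ on $(r,c)$ if $L-1-c$ is odd and nothing otherwise. The four phases are: 1. $(r{+}1,c)\to(r,c)$ in all columns $c$ in parallel, for $r=L-2,\dots,0$; 2. sweeps over all rows $r\equiv0\pmod 4$ in parallel, then over all rows $r\equiv2\pmod 4$ in parallel, with forward pairs $(-1,\mathrm{skip}^-)$ if $r+2\le L-1$ and $(-5,\mathrm{same})$ if $r\ge2$, and undo pairs $(1,\mathrm{skip}^+)$ if $r+2\le L-1$ and $(5,\mathrm{z})$ if $r\ge2$; 3. $(r{+}1,c)\to(r,c)$ in all columns $c$ in parallel, for $r=0,\dots,L-2$; 4. sweeps over all even rows $r$ in parallel, with forward pairs $(-2,\mathrm{cross})$ if $r+1\le L-1$ and $(-3,\mathrm{same})$, and undo pairs $(2,\mathrm{cross})$ if $r+1\le L-1$ and $(3,\mathrm{z})$. **Theorem.** 1. The vertex expansion $c(G)=\min_{0<|X|\le|V|/2}|\partial X|/|X|$ (with $\partial X$ the set of vertices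 outside $X$ adjacent to $X$) satisfies $c(G_L)=\Theta(1/L)$, uniformly for $L\ge2$. 2. For every $k$ there is $c>0$ such that for all $L\ge2$ and every Jordan–Wigner order there is a $\pi\in S_N$ for which every LOCC protocol with at most $kN$ ancillas that implements $F_\pi$ has depth at least $c\sqrt N$. 3. There is $c>0$ such that for all $L\ge2$ every LOCC protocol, with any number of ancillas, that implements $F_\pi$ has gate count at least $cN\sqrt N$, when $\pi$ is the reversal $j\mapsto N-1-j$ of the snake order, and also when $\pi$ is the permutation of the modes induced, under any Jordan–Wigner order, by the point reflection $(r,c)\mapsto(L-1-r,L-1-c)$ of the grid. 4. There is $C$ such that for all $L\ge1$ and $\pi\in S_N$, a decomposition $\rho_B\circ\kappa\circ\rho_A$ as above exists, and for every such decomposition the algorithm is a valid nearest-neighbour protocol without ancillas, measurements or feedforward that implements $F_\pi$ (snake order) with depth at most $C\sqrt N$ and gate count at most $CN\sqrt N$. 5. Hence the algorithm is asymptotically optimal. For every $k$ there is $C$ such that for all $L\ge2$ there is a $\pi$ for which the depth of the algorithm, on any permutation and decomposition, is at most $C$ times the depth of any LOCC protocol with at most $kN$ ancillas that implements $F_\pi$.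 Likewise there is $C$ such that for all $L\ge2$ its gate count, on any permutation and decomposition, is at most $C$ times the gate count of any LOCC protocol that implements $F_\pi$ for the reversal $\pi:j\mapsto N-1-j$ of the snake order. -/

import Mathlib

open scoped Matrix

namespace FermionicRouting

/-! ### The grid, its vertex expansion, and the Jordan-Wigner order -/

/-- Sites `(r, c)` (row, column) of the `L × L` grid. -/
abbrev Site (L : ℕ) : Type := Fin L × Fin L

/-- The `L × L` nearest-neighbour grid. -/
abbrev grid (L : ℕ) : SimpleGraph (Site L) :=
  (SimpleGraph.pathGraph L).boxProd (SimpleGraph.pathGraph L)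

/-- The vertex boundary of `X`: the vertices outside `X` with a neighbour in `X`. -/
def vertexBoundary {V : Type} (G : SimpleGraph V) (X : Finset V) : Set V :=
  {v | v ∉ X ∧ ∃ u ∈ X, G.Adj u v}

/-- The vertex expansion `c(G)`, the minimum of `|∂X| / |X|` over the nonempty sets `X` of at most
half of the vertices. -/
noncomputable def vertexExpansion {V : Type} [Fintype V] (G : SimpleGraph V) : ℝ :=
  sInf {x : ℝ | ∃ X : Finset V, X.Nonempty ∧ 2 * X.card ≤ Fintype.card V ∧
    x = ((vertexBoundary G X).ncard : ℝ) / (X.card : ℝ)}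

/-- The snake (boustrophedon) order of the sites: `(r, c) ↦ r * L + c` for even `r` and
`(r, c) ↦ r * L + (L - 1 - c)` for odd `r`. -/
def snake (L : ℕ) : Site L ≃ Fin (L * L) :=
  (Equiv.prodShear (Equiv.refl (Fin L))
    (fun r => if (r : ℕ) % 2 = 0 then Equiv.refl (Fin L) else Fin.revPerm)).trans finProdFinEquiv

/-- The point reflection `(r, c) ↦ (L - 1 - r, L - 1 - c)` of the grid. -/
def reflection (L : ℕ) : Equiv.Perm (Site L) :=
  Equiv.prodCongr Fin.revPerm Fin.revPerm

/-! ### Qubit registers and fermionic permutations -/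

/-- Computational basis states of a register of qubits `Q`. -/
abbrev Basis (Q : Type) : Type := Q → Bool

/-- Operators on a register of qubits `Q`, in the computational basis. -/
abbrev Operator (Q : Type) : Type := Matrix (Basis Q) (Basis Q) ℂ

/-- State vectors of a register of qubits `Q`. -/
abbrev StateVector (Q : Type) : Type := Basis Q → ℂ

/-- The inversion set of `π`. -/
def inversions {N : ℕ} (π : Equiv.Perm (Fin N)) : Finset (Fin N × Fin N) :=
  Finset.univ.filter fun p => p.1 < p.2 ∧ π p.2 < π p.1

/-- `P_π`, moving the qubit at position `j` to position `π j`. -/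
def qubitPerm {N : ℕ} (π : Equiv.Perm (Fin N)) : Operator (Fin N) :=
  Matrix.of fun x y => if x = (fun j => y (π.symm j)) then 1 else 0

/-- `V_π`, the product of `CZ_{i,j}` over the inversions `(i, j)` of `π`. -/
def inversionPhase {N : ℕ} (π : Equiv.Perm (Fin N)) : Operator (Fin N) :=
  Matrix.diagonal fun y => ∏ p ∈ inversions π, (if y p.1 && y p.2 then (-1 : ℂ) else 1)

/-- The fermionic permutation `F_π = P_π V_π` on `N` Jordan-Wigner ordered qubits. -/
def fermionicPerm {N : ℕ} (π : Equiv.Perm (Fin N)) : Operator (Fin N) :=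
  qubitPerm π * inversionPhase π

/-- `F_π` on qubits that sit at the elements of `V`, mode `j` at the site of Jordan-Wigner
index `j`. -/
def fermionicPermOn {V : Type} {N : ℕ} (jw : V ≃ Fin N) (π : Equiv.Perm (Fin N)) : Operator V :=
  (fermionicPerm π).submatrix (fun x j => x (jw.symm j)) (fun y j => y (jw.symm j))

/-! ### Adaptive protocols: local operations, classical communication, layers of two-qubit gates -/

/-- A two-qubit gate: two qubits and its matrix in the basis `|s_fst s_snd⟩`. -/
structure TwoQubitGate (Q : Type) where
  fst : Q
  snd : Q
  mat : Matrix (Bool × Bool) (Bool × Bool) ℂ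

/-- The gate as an operator on the whole register. -/
def TwoQubitGate.op {Q : Type} [Fintype Q] [DecidableEq Q] (g : TwoQubitGate Q) : Operator Q :=
  Matrix.of fun s t =>
    if ∀ q, q ≠ g.fst → q ≠ g.snd → s q = t q then g.mat (s g.fst, s g.snd) (t g.fst, t g.snd)
    else 0

/-- No qubit takes part in both gates. -/
def TwoQubitGate.Disjoint {Q : Type} (g h : TwoQubitGate Q) : Prop :=
  g.fst ≠ h.fst ∧ g.fst ≠ h.snd ∧ g.snd ≠ h.fst ∧ g.snd ≠ h.snd

/-- Joint action of the gates of a layer. -/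
def layerOp {Q : Type} [Fintype Q] [DecidableEq Q] (gs : List (TwoQubitGate Q)) : Operator Q :=
  (gs.map TwoQubitGate.op).prod

/-- An adaptive protocol on qubits `Q` located at sites `V`, as a decision tree.
`measure v n K next` applies to the qubits of the site `v` the local instrument with Kraus operators
`K i`; the outcome `i` is broadcast, and the rest of the protocol, `next i`, may depend on it.
A local unitary is an instrument with one outcome; a reset, or an outcome that is ignored, is an
instrument as well.
`layer gs next` applies in parallel the two-qubit gates `gs`. -/
inductive Protocol (V Q : Type) : Type where
  | done : Protocol V Q
  | measure (v : V) (n : ℕ) (K : Fin n → Operator Q) (next : Fin n → Protocol V Q) : Protocol V Q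
  | layer (gs : List (TwoQubitGate Q)) (next : Protocol V Q) : Protocol V Q

/-- `M` acts as the identity on all qubits that are not located at `v`. -/
def ActsAt {V Q : Type} [DecidableEq V] [Fintype Q] (site : Q → V) (v : V) (M : Operator Q) :
    Prop :=
  ∃ m : Operator {q : Q // site q = v}, ∀ s t : Basis Q,
    M s t = if ∀ q, site q ≠ v → s q = t q then m (fun q => s q) (fun q => t q) else 0

namespace Protocol

variable {V Q : Type}

/-- The protocol is executable on the graph `G`: every instrument acts at one site and is trace
preserving, and every layer consists of unitary gates on disjoint pairs of qubits whose sites are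
adjacent in `G`. -/
def Valid [DecidableEq V] [Fintype Q] [DecidableEq Q] (G : SimpleGraph V) (site : Q → V) :
    Protocol V Q → Prop
  | done => True
  | measure v n K next =>
      (∀ i, ActsAt site v (K i)) ∧ (∑ i : Fin n, (K i)ᴴ * K i = 1) ∧
        ∀ i, (next i).Valid G site
  | layer gs next =>
      (∀ g ∈ gs, G.Adj (site g.fst) (site g.snd) ∧
        g.mat ∈ Matrix.unitaryGroup (Bool × Bool) ℂ) ∧
      gs.Pairwise TwoQubitGate.Disjoint ∧ next.Valid G site

/-- No measurement and no feedforward: every instrument has a single outcome. -/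
def MeasurementFree : Protocol V Q → Prop
  | done => True
  | measure _ n _ next => n = 1 ∧ ∀ i, (next i).MeasurementFree
  | layer _ next => next.MeasurementFree

/-- The depth: the largest number of gate layers in a branch. Local operations and classical
communication cost no time. -/
def depth : Protocol V Q → ℕ
  | done => 0
  | measure _ n _ next => (Finset.univ : Finset (Fin n)).sup fun i => (next i).depth
  | layer _ next => next.depth + 1

/-- The gate count: the largest number of two-qubit gates between adjacent sites in a branch. -/
def gateCount : Protocol V Q → ℕ
  | done => 0
  | measure _ n _ next => (Finset.univ : Finset (Fin n)).sup fun i => (next i).gateCount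
  | layer gs next => next.gateCount + gs.length

/-- The Kraus operators of the protocol, one for each branch (record of outcomes). -/
noncomputable def kraus [Fintype Q] [DecidableEq Q] : Protocol V Q → List (Operator Q)
  | done => [1]
  | measure _ n K next => (List.finRange n).flatMap fun i => (next i).kraus.map fun M => M * K i
  | layer gs next => next.kraus.map fun M => M * layerOp gs

end Protocol

/-- The product of a state of the data qubits `V` and a state of `m` ancillas. -/
def tensor {V : Type} {m : ℕ} (φ : StateVector V) (χ : StateVector (Fin m)) :
    StateVector (V ⊕ Fin m) :=
  fun s => φ (fun v => s (Sum.inl v)) * χ (fun a => s (Sum.inr a))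

/-- All ancillas in state `|0⟩`. -/
def zeroState (m : ℕ) : StateVector (Fin m) :=
  fun a => if a = (fun _ => false) then 1 else 0

/-- One data qubit at every site, and the ancilla `a` at the site `loc a`. -/
def siteOf {V : Type} {m : ℕ} (loc : Fin m → V) : V ⊕ Fin m → V := Sum.elim id loc

/-- The protocol implements the unitary `F` on the data qubits: for every input state `ψ`, with the
ancillas initially in `|0⟩`, each branch leaves the data qubits in the state `F ψ` and the ancillas
in some (unnormalized) state `χ`. -/
def Implements {V : Type} [Fintype V] [DecidableEq V] {m : ℕ} (P : Protocol V (V ⊕ Fin m))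
    (F : Operator V) : Prop :=
  ∀ M ∈ P.kraus, ∀ ψ : StateVector V, ∃ χ : StateVector (Fin m),
    M *ᵥ tensor ψ (zeroState m) = tensor (F *ᵥ ψ) χ

/-- An LOCC protocol on `G` with `m` ancillas, located at the sites given by `loc`, for the unitary
`F`. -/
def IsLOCCProtocol {V : Type} [Fintype V] [DecidableEq V] (G : SimpleGraph V) {m : ℕ}
    (loc : Fin m → V) (P : Protocol V (V ⊕ Fin m)) (F : Operator V) : Prop :=
  P.Valid G (siteOf loc) ∧ Implements P F

/-! ### Circuits over the gates FSWAP, CNOT, CZ, Z -/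

/-- Gates on the grid; in `cnot a b` the control is `a` and the target is `b`. -/
inductive Gate (V : Type) : Type where
  | fswap (a b : V)
  | cnot (a b : V)
  | cz (a b : V)
  | z (a : V)

/-- `|s t⟩ ↦ (-1)^{s t} |t s⟩`. -/
def fswapMat : Matrix (Bool × Bool) (Bool × Bool) ℂ :=
  Matrix.of fun x y => if x = (y.2, y.1) then (if y.1 && y.2 then -1 else 1) else 0

/-- `|s t⟩ ↦ |s, s ⊕ t⟩`. -/
def cnotMat : Matrix (Bool × Bool) (Bool × Bool) ℂ :=
  Matrix.of fun x y => if x = (y.1, xor y.1 y.2) then 1 else 0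

/-- `|s t⟩ ↦ (-1)^{s t} |s t⟩`. -/
def czMat : Matrix (Bool × Bool) (Bool × Bool) ℂ :=
  Matrix.diagonal fun y => if y.1 && y.2 then -1 else 1

/-- The Pauli operator `Z` on the qubit `q`. -/
def zOp {Q : Type} [DecidableEq Q] [Fintype Q] (q : Q) : Operator Q :=
  Matrix.diagonal fun s => if s q then -1 else 1

/-- A circuit: the list of its time steps, each a list of gates to be executed in parallel. -/
abbrev Circuit (V : Type) : Type := List (List (Gate V))

/-- The two-qubit gates of a time step, on data qubits only. -/
def twoQubitGates {V : Type} (step : List (Gate V)) : List (TwoQubitGate (V ⊕ Fin 0)) :=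
  step.filterMap fun
    | .fswap a b => some ⟨Sum.inl a, Sum.inl b, fswapMat⟩
    | .cnot a b => some ⟨Sum.inl a, Sum.inl b, cnotMat⟩
    | .cz a b => some ⟨Sum.inl a, Sum.inl b, czMat⟩
    | .z _ => none

/-- The qubits of a time step on which `Z` is applied. -/
def zSites {V : Type} (step : List (Gate V)) : List V :=
  step.filterMap fun
    | .z a => some a
    | _ => none

/-- A circuit as a protocol without ancillas; every time step counts towards the depth. -/
def Circuit.toProtocol {V : Type} [Fintype V] [DecidableEq V] :
    Circuit V → Protocol V (V ⊕ Fin 0)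
  | [] => .done
  | step :: rest =>
      .layer (twoQubitGates step)
        ((zSites step).foldr (fun v P => .measure v 1 (fun _ => zOp (Sum.inl v)) (fun _ => P))
          (Circuit.toProtocol rest))

/-! ### Row and column stages: odd-even transposition -/

/-- In round `t` the tokens at positions `c`, `c + 1` of a line of length `L` are exchanged when
`c` has the parity of `t` and their destinations `d` are in the wrong order. -/
def oetSwaps (L t : ℕ) (d : ℕ → ℕ) (c : ℕ) : Bool :=
  decide (c % 2 = t % 2 ∧ c + 1 < L ∧ d (c + 1) < d c)

/-- The destinations of the tokens on a line after `t` rounds, if they are `d` initially. -/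
def oetState (L : ℕ) (d : ℕ → ℕ) : ℕ → ℕ → ℕ
  | 0, c => d c
  | t + 1, c =>
      if oetSwaps L t (oetState L d t) c then oetState L d t (c + 1)
      else if 1 ≤ c ∧ oetSwaps L t (oetState L d t) (c - 1) then oetState L d t (c - 1)
      else oetState L d t c

/-- The destination column of the token at column `c` of row `r`. -/
def rowDest {L : ℕ} (σ : Equiv.Perm (Site L)) (r : Fin L) (c : ℕ) : ℕ :=
  if h : c < L then ((σ (r, ⟨c, h⟩)).2 : ℕ) else c

/-- The destination row of the token at row `r` of column `c`. -/
def colDest {L : ℕ} (σ : Equiv.Perm (Site L)) (c : Fin L) (r : ℕ) : ℕ :=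
  if h : r < L then ((σ (⟨r, h⟩, c)).1 : ℕ) else r

/-- `L` rounds of odd-even transposition in all rows in parallel, with FSWAP gates. -/
def rowStage {L : ℕ} (σ : Equiv.Perm (Site L)) : Circuit (Site L) :=
  (List.range L).map fun t =>
    (List.finRange L).flatMap fun r : Fin L => (List.finRange L).flatMap fun c : Fin L =>
      if h : (c : ℕ) + 1 < L then
        if oetSwaps L t (oetState L (rowDest σ r) t) c then
          [Gate.fswap (r, c) (r, ⟨(c : ℕ) + 1, h⟩)] else []
      else []

/-- `L` rounds of odd-even transposition in all columns in parallel, with bare FSWAP gates on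
vertical neighbours. -/
def colStage {L : ℕ} (σ : Equiv.Perm (Site L)) : Circuit (Site L) :=
  (List.range L).map fun t =>
    (List.finRange L).flatMap fun c : Fin L => (List.finRange L).flatMap fun r : Fin L =>
      if h : (r : ℕ) + 1 < L then
        if oetSwaps L t (oetState L (colDest σ c) t) r then
          [Gate.fswap (r, c) (⟨(r : ℕ) + 1, h⟩, c)] else []
      else []

/-! ### The circuit for `Γ` -/

/-- The site `(r, c)`, if it lies in the grid. -/
def site? (L : ℕ) (r c : ℤ) : Option (Site L) :=
  if h : (0 ≤ r ∧ r < L) ∧ (0 ≤ c ∧ c < L) then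
    some (⟨r.toNat, by omega⟩, ⟨c.toNat, by omega⟩)
  else none

/-- `CNOT((r, c) → (r', c'))`, dropped if a qubit lies outside the grid. -/
def cnotAt (L : ℕ) (r c r' c' : ℤ) : List (Gate (Site L)) :=
  match site? L r c, site? L r' c' with
  | some a, some b => [.cnot a b]
  | _, _ => []

/-- `CZ((r, c), (r', c'))`, dropped if a qubit lies outside the grid. -/
def czAt (L : ℕ) (r c r' c' : ℤ) : List (Gate (Site L)) :=
  match site? L r c, site? L r' c' with
  | some a, some b => [.cz a b]
  | _, _ => []

/-- `Z` on `(r, c)`, dropped if the qubit lies outside the grid. -/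
def zAt (L : ℕ) (r c : ℤ) : List (Gate (Site L)) :=
  match site? L r c with
  | some a => [.z a]
  | none => []

/-- A gadget: a list of gates for each column. -/
abbrev Gadget (L : ℕ) : Type := ℤ → List (Gate (Site L))

/-- The skip-row gadget of row `r`, with sign `ε`. -/
def gSkip (L : ℕ) (ε r : ℤ) : Gadget L := fun c =>
  czAt L (r + 1) c (r + 2) c ++
  cnotAt L r (c + ε) (r + 1) (c + ε) ++
  czAt L (r + 1) (c + 2 * ε) (r + 2) (c + 2 * ε) ++
  cnotAt L r (c + 3 * ε) (r + 1) (c + 3 * ε)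

/-- The cross-row gadget of row `r`. -/
def gCross (L : ℕ) (r : ℤ) : Gadget L := fun c => czAt L r c (r + 1) c

/-- The same-row gadget of row `r`. -/
def gSame (L : ℕ) (r : ℤ) : Gadget L := fun c => czAt L r (c - 1) r c

/-- The `Z` correction of row `r`. -/
def gZ (L : ℕ) (r : ℤ) : Gadget L := fun c =>
  if ((L : ℤ) - 1 - c) % 2 = 1 then zAt L r c else []

/-- The gates fired at time `t` of a leg of a sweep over row `r`: the cascade gate, and each gadget
at the column given by its offset. -/
def legStep (L : ℕ) (r : ℤ) (gadgets : List (ℤ × Gadget L)) (t : ℤ) : List (Gate (Site L)) :=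
  cnotAt L r t r (t + 1) ++ gadgets.flatMap fun p => p.2 (t + p.1)

/-- Step `i` of the pipelined sweep over row `r`: the forward leg runs over `t = 0, …, L + 4`, and
the undo leg over `t = L - 2, L - 3, …, -5`; no gate is in range at other times. -/
def sweepStep (L : ℕ) (r : ℤ) (fwd undo : List (ℤ × Gadget L)) (i : ℕ) :
    List (Gate (Site L)) :=
  if i < L + 5 then legStep L r fwd i
  else legStep L r undo ((L : ℤ) - 2 - ((i : ℤ) - ((L : ℤ) + 5)))

/-- Pipelined sweeps over the given rows, in parallel. -/
def sweeps (L : ℕ) (rows : List ℕ) (fwd undo : ℕ → List (ℤ × Gadget L)) : Circuit (Site L) :=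
  (List.range (2 * L + 9)).map fun i => rows.flatMap fun r : ℕ => sweepStep L r (fwd r) (undo r) i

/-- Vertical CNOT gates from row `r + 1` into row `r`, in all columns. -/
def verticalCNOTs (L r : ℕ) : List (Gate (Site L)) :=
  (List.range L).flatMap fun c => cnotAt L ((r : ℤ) + 1) c r c

/-- Phase 1: enter the column-parity basis, `r = L - 2, …, 0`. -/
def gammaPhase1 (L : ℕ) : Circuit (Site L) := (List.range (L - 1)).reverse.map (verticalCNOTs L)

/-- One batch of phase 2: the rows `r ≡ b` modulo `4`. -/
def gammaPhase2 (L b : ℕ) : Circuit (Site L) :=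
  sweeps L ((List.range L).filter fun r => r % 4 = b)
    (fun r => (if r + 2 < L then [(-1, gSkip L (-1) r)] else []) ++
      (if 2 ≤ r then [(-5, gSame L r)] else []))
    (fun r => (if r + 2 < L then [(1, gSkip L 1 r)] else []) ++
      (if 2 ≤ r then [(5, gZ L r)] else []))

/-- Phase 3: leave the column-parity basis, `r = 0, …, L - 2`. -/
def gammaPhase3 (L : ℕ) : Circuit (Site L) := (List.range (L - 1)).map (verticalCNOTs L)

/-- Phase 4; for odd `L`, the supplementary sweep over the last row, without cross-row gadget,
runs in parallel with the others. -/
def gammaPhase4 (L : ℕ) : Circuit (Site L) :=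
  sweeps L ((List.range L).filter fun r => r % 2 = 0)
    (fun r => (if r + 1 < L then [(-2, gCross L r)] else []) ++ [(-3, gSame L r)])
    (fun r => (if r + 1 < L then [(2, gCross L r)] else []) ++ [(3, gZ L r)])

/-- The ancilla-free circuit for `Γ`. -/
def gammaCircuit (L : ℕ) : Circuit (Site L) :=
  gammaPhase1 L ++ (gammaPhase2 L 0 ++ gammaPhase2 L 2) ++ gammaPhase3 L ++ gammaPhase4 L

/-! ### The row-column-row fermionic permutation algorithm -/

/-- A three-stage plan for the permutation `ρ` of the sites: `ρ = rowB ∘ col ∘ rowA`, where `rowA`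
and `rowB` permute within rows and `col` within columns. -/
structure ThreeStagePlan {L : ℕ} (ρ : Equiv.Perm (Site L)) where
  rowA : Equiv.Perm (Site L)
  col : Equiv.Perm (Site L)
  rowB : Equiv.Perm (Site L)
  rowA_row : ∀ p, (rowA p).1 = p.1
  col_col : ∀ p, (col p).2 = p.2
  rowB_row : ∀ p, (rowB p).1 = p.1
  comp_eq : ∀ p, rowB (col (rowA p)) = ρ p

/-- The permutation of the sites that is induced by the permutation `π` of the modes. -/
def sitePerm {V : Type} {N : ℕ} (jw : V ≃ Fin N) (π : Equiv.Perm (Fin N)) : Equiv.Perm V :=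
  (jw.trans π).trans jw.symm

/-- The permutation of the modes that is induced by the permutation `ρ` of the sites. -/
def modePerm {V : Type} {N : ℕ} (jw : V ≃ Fin N) (ρ : Equiv.Perm V) : Equiv.Perm (Fin N) :=
  (jw.symm.trans ρ).trans jw

/-- The algorithm: row sort, `Γ`, bare column sort, `Γ`, row sort. -/
def algorithmCircuit {L : ℕ} {ρ : Equiv.Perm (Site L)} (plan : ThreeStagePlan ρ) :
    Circuit (Site L) :=
  rowStage plan.rowA ++ gammaCircuit L ++ colStage plan.col ++ gammaCircuit L ++
    rowStage plan.rowB

/-- The algorithm as an ancilla-free protocol. -/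
def algorithm {L : ℕ} {ρ : Equiv.Perm (Site L)} (plan : ThreeStagePlan ρ) :
    Protocol (Site L) (Site L ⊕ Fin 0) :=
  (algorithmCircuit plan).toProtocol

end FermionicRouting

open FermionicRouting

open scoped Matrix

namespace FermionicRouting

/-! ### The vertex expansion of the grid -/

/-! Expansion. A row or column that meets both a set and its complement contains a boundary vertex.
Either every row is mixed, or some row is empty or full; in the latter case every column that meets
the set, respectively its complement, contributes a boundary vertex. The first half of the rows
gives the matching upper bound.

Lower bounds. Fix one branch of nonzero amplitude. Its Kraus operator is a product of one-site
operators and gates, so its operator Schmidt rank across a bipartition of the sites is at most `4 ^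
c`, where `c` counts the crossing gates. A block of it is a nonzero multiple of `F_π`, which has
rank at least `2 ^ A.card` if all qubits of `A` change sides; hence `A.card ≤ 2 * c`
(`card_le_two_mul_crossings`). When the rows are reversed, all `i * L` qubits of the first `i ≤ L /
2` rows cross the horizontal cut beneath them. A gate on neighbours crosses at most one horizontal
cut, so summing over `i` forces order `L ^ 3` gates. A layer has at most one gate per qubit, which
turns this into a depth bound when there are `O(N)` ancillas.

Algorithm. Every gate used sends basis states to signed basis states, so correctness is an identity
between maps of bits and between signs, the latter written as exponents in `ZMod 2`. `disagreement k
k'` counts the occupied pairs that two Jordan-Wigner orders arrange differently. It is additive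
along chains of orders (`disagreement_triangle`). Hence FSWAP gates on neighbours of an order
compose to the fermionic permutation for that order (`fermionicSign_trans`), and a change of order
is conjugation by the disagreement sign (`fermionicSign_eq_of_order`). Horizontal neighbours are
consecutive in the snake order, vertical ones in the order `columnKey`, and `L` rounds of odd-even
transposition sort each line (`oetState_sorted`). It remains that `Γ` applies the sign `disagreement
(snakeKey L) (columnKey L)` (`gammaCircuit_eval`).

Write `X r` for the bits of row `r`, `S r` for the column parities from row `r` downwards, and `⟨a,
b⟩` for the sum of `a j * b c` over `j < c`. The sign is the sum of all `⟨X r, S (r + 1)⟩` and of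
`⟨X r, X r⟩` for even `r`. The first sum telescopes to the sum over even `r` of `⟨S r, S (r + 2)⟩`,
`⟨S r, S r⟩` (if `2 ≤ r`) and `⟨X r, X (r + 1)⟩` (`sum_even_rows`). Phase 2, in the column-parity
basis, produces the terms in `S`, and phase 4 those in `X`: the cascade of a sweep turns a row into
its prefix parities, so that a local CZ sees all `j` up to its column at once.

Decompositions into row, column and row stages come from edge colourings of regular bipartite
multigraphs (`exists_injOn_coloring`). -/

theorem exists_pathGraph_adj_of_mixed {L : ℕ} (p : Fin L → Prop) {i j : Fin L} (hi : p i)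
    (hj : ¬ p j) : ∃ a b, (SimpleGraph.pathGraph L).Adj a b ∧ p a ∧ ¬ p b := by
  obtain ⟨w⟩ := SimpleGraph.pathGraph_preconnected L i j
  obtain ⟨d, -, h1, h2⟩ := w.exists_boundary_dart {x | p x} hi hj
  exact ⟨d.fst, d.snd, d.adj, h1, h2⟩

theorem exists_boundary_in_row {L : ℕ} {X : Finset (Site L)} {r c c' : Fin L} (h : (r, c) ∈ X)
    (h' : (r, c') ∉ X) : ∃ v ∈ vertexBoundary (grid L) X, v.1 = r := by
  obtain ⟨a, b, hab, ha, hb⟩ := exists_pathGraph_adj_of_mixed (fun c => (r, c) ∈ X) h h'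
  exact ⟨(r, b), ⟨hb, (r, a), ha, by simp [SimpleGraph.boxProd_adj, hab]⟩, rfl⟩

theorem exists_boundary_in_column {L : ℕ} {X : Finset (Site L)} {r r' c : Fin L} (h : (r, c) ∈ X)
    (h' : (r', c) ∉ X) : ∃ v ∈ vertexBoundary (grid L) X, v.2 = c := by
  obtain ⟨a, b, hab, ha, hb⟩ := exists_pathGraph_adj_of_mixed (fun r => (r, c) ∈ X) h h'
  exact ⟨(b, c), ⟨hb, (a, c), ha, by simp [SimpleGraph.boxProd_adj, hab]⟩, rfl⟩

theorem card_le_ncard_of_forall_exists {V ι : Type} [Finite V] (B : Set V) (f : V → ι)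
    (A : Finset ι) (h : ∀ i ∈ A, ∃ v ∈ B, f v = i) : A.card ≤ B.ncard := by
  classical
  rw [Set.ncard_eq_toFinset_card B (Set.toFinite B)]
  refine (Finset.card_le_card (t := (Set.toFinite B).toFinset.image f) fun i hi => ?_).trans
    Finset.card_image_le
  simpa using h i hi

theorem card_le_mul_ncard_vertexBoundary {L : ℕ} {X : Finset (Site L)}
    (hX : 2 * X.card ≤ L * L) : X.card ≤ L * (vertexBoundary (grid L) X).ncard := by
  classical
  set b := (vertexBoundary (grid L) X).ncard
  by_cases hmix : ∀ r : Fin L, (∃ c, (r, c) ∈ X) ∧ ∃ c, (r, c) ∉ X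
  · have : L ≤ b := by
      simpa using card_le_ncard_of_forall_exists (vertexBoundary (grid L) X) Prod.fst
        (Finset.univ : Finset (Fin L)) fun r _ => by
          obtain ⟨⟨c, h⟩, c', h'⟩ := hmix r
          exact exists_boundary_in_row h h'
    nlinarith
  · simp only [not_forall, not_and_or, not_exists, not_not] at hmix
    obtain ⟨r, hempty | hfull⟩ := hmix
    · set A : Finset (Fin L) := Finset.univ.filter fun c => ∃ r, (r, c) ∈ X with hA
      have h1 : A.card ≤ b := card_le_ncard_of_forall_exists _ Prod.snd A fun c hc => by
        obtain ⟨r', h⟩ := (Finset.mem_filter.1 hc).2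
        exact exists_boundary_in_column h (hempty c)
      have h2 : X.card ≤ L * A.card := by
        have : X ⊆ (Finset.univ : Finset (Fin L)) ×ˢ A := fun v hv => by
          simp only [Finset.mem_product, Finset.mem_univ, true_and, hA, Finset.mem_filter]
          exact ⟨v.1, hv⟩
        simpa using Finset.card_le_card this
      exact h2.trans (Nat.mul_le_mul_left _ h1)
    · set A : Finset (Fin L) := Finset.univ.filter fun c => ∃ r, (r, c) ∉ X with hA
      have h1 : A.card ≤ b := card_le_ncard_of_forall_exists _ Prod.snd A fun c hc => by
        obtain ⟨r', h⟩ := (Finset.mem_filter.1 hc).2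
        exact exists_boundary_in_column (hfull c) h
      have h2 : L * Aᶜ.card ≤ X.card := by
        have : (Finset.univ : Finset (Fin L)) ×ˢ Aᶜ ⊆ X := fun v hv => by
          simp only [Finset.mem_product, Finset.mem_univ, true_and, hA, Finset.mem_compl,
            Finset.mem_filter, not_exists, not_not] at hv
          exact hv v.1
        simpa using Finset.card_le_card this
      have h3 : A.card + Aᶜ.card = L := by simp [Finset.card_add_card_compl A]
      -- `X` contains every column outside `A`, so its complement has at most `L * A.card` sites,
      -- and `X` is no larger than its complement.
      nlinarith

theorem ncard_vertexBoundary_initial_rows {L h : ℕ} :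
    (vertexBoundary (grid L) (Finset.univ.filter fun v : Site L => (v.1 : ℕ) < h)).ncard ≤ L := by
  classical
  refine (Set.ncard_le_ncard_of_injOn (fun v : Site L => v.2) (t := Set.univ)
    (fun _ _ => Set.mem_univ _) ?_).trans (by simp [Set.ncard_univ])
  have key : ∀ v ∈ vertexBoundary (grid L) (Finset.univ.filter fun v : Site L => (v.1 : ℕ) < h),
      (v.1 : ℕ) = h := by
    rintro v ⟨hv, u, hu, huv⟩
    simp only [Finset.mem_filter, Finset.mem_univ, true_and, not_lt] at hv hu
    simp only [SimpleGraph.boxProd_adj, SimpleGraph.pathGraph_adj] at huv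
    rcases huv with ⟨h1, -⟩ | ⟨-, h1⟩
    · omega
    · rw [h1] at hu; omega
  intro v hv w hw hvw
  exact Prod.ext (Fin.ext ((key v hv).trans (key w hw).symm)) hvw

theorem vertexExpansion_grid {L : ℕ} (hL : 2 ≤ L) :
    1 / (L : ℝ) ≤ vertexExpansion (grid L) ∧ vertexExpansion (grid L) ≤ 3 / (L : ℝ) := by
  classical
  have hL0 : (0 : ℝ) < L := by positivity
  set X₀ : Finset (Site L) := Finset.univ.filter fun v : Site L => (v.1 : ℕ) < L / 2 with hX₀
  have hcard : X₀.card = L / 2 * L := by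
    have : X₀ = (Finset.univ.filter fun r : Fin L => (r : ℕ) < L / 2) ×ˢ Finset.univ := by
      ext v; simp [hX₀]
    rw [this, Finset.card_product, Fin.card_filter_val_lt]
    simp [Nat.min_eq_right (Nat.div_le_self L 2)]
  have hpos : 0 < L / 2 * L := Nat.mul_pos (by omega) (by omega)
  have hmem : ((vertexBoundary (grid L) X₀).ncard : ℝ) / (X₀.card : ℝ) ∈
      {x : ℝ | ∃ X : Finset (Site L), X.Nonempty ∧ 2 * X.card ≤ Fintype.card (Site L) ∧
        x = ((vertexBoundary (grid L) X).ncard : ℝ) / (X.card : ℝ)} := by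
    refine ⟨X₀, Finset.card_pos.1 (hcard ▸ hpos), ?_, rfl⟩
    rw [hcard]
    simp only [Fintype.card_prod, Fintype.card_fin, ← mul_assoc]
    exact Nat.mul_le_mul_right _ (by omega)
  constructor
  · refine le_csInf ⟨_, hmem⟩ ?_
    rintro x ⟨X, hne, hX, rfl⟩
    have h1 := card_le_mul_ncard_vertexBoundary (X := X) (by simpa using hX)
    have h2 : (0 : ℝ) < X.card := by exact_mod_cast hne.card_pos
    rw [div_le_div_iff₀ hL0 h2, one_mul, mul_comm]
    exact_mod_cast h1
  · refine (csInf_le ⟨0, ?_⟩ hmem).trans ?_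
    · rintro x ⟨X, -, -, rfl⟩
      positivity
    · have h1 : (vertexBoundary (grid L) X₀).ncard ≤ L := ncard_vertexBoundary_initial_rows
      have h2 : (0 : ℝ) < X₀.card := by rw [hcard]; exact_mod_cast hpos
      rw [div_le_div_iff₀ h2 hL0, hcard]
      -- The worst case is `L = 3`, where `L / 2 = 1`.
      have h3 : L ≤ 3 * (L / 2) := by omega
      have : (vertexBoundary (grid L) X₀).ncard * L ≤ 3 * (L / 2 * L) := by
        nlinarith [Nat.mul_le_mul_right L h1, Nat.mul_le_mul_right L h3]
      exact_mod_cast this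

/-! ### Operator Schmidt rank across a bipartition of the qubits -/

open scoped Kronecker

set_option linter.unusedSectionVars false

section Schmidt

variable {Q : Type} [Fintype Q] [DecidableEq Q]

/-- Basis states of `Q` as pairs of basis states of the two parts of `Q` given by `S`. -/
def basisSplit (S : Q → Bool) :
    Basis Q ≃ Basis {q : Q // S q = true} × Basis {q : Q // ¬ S q = true} :=
  Equiv.piEquivPiSubtypeProd (fun q => S q = true) fun _ => Bool

/-- `M` is a sum of at most `R` products of operators on the two parts of `Q` given by `S`. -/
def SchmidtLE (S : Q → Bool) (M : Operator Q) (R : ℕ) : Prop :=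
  ∃ (ι : Type) (_ : Fintype ι) (A : ι → Operator {q : Q // S q = true})
    (B : ι → Operator {q : Q // ¬ S q = true}), Fintype.card ι ≤ R ∧
      M = (∑ i, A i ⊗ₖ B i).submatrix (basisSplit S) (basisSplit S)

theorem SchmidtLE.mul {S : Q → Bool} {M M' : Operator Q} {R R' : ℕ} (h : SchmidtLE S M R)
    (h' : SchmidtLE S M' R') : SchmidtLE S (M * M') (R * R') := by
  obtain ⟨ι, _, A, B, hc, rfl⟩ := h
  obtain ⟨ι', _, A', B', hc', rfl⟩ := h'
  refine ⟨ι × ι', inferInstance, fun p => A p.1 * A' p.2, fun p => B p.1 * B' p.2, ?_, ?_⟩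
  · rw [Fintype.card_prod]
    exact Nat.mul_le_mul hc hc'
  · rw [Matrix.submatrix_mul_equiv, Finset.sum_mul_sum, Fintype.sum_prod_type]
    simp only [Matrix.mul_kronecker_mul]

theorem schmidtLE_one (S : Q → Bool) : SchmidtLE S (1 : Operator Q) 1 :=
  ⟨Unit, inferInstance, fun _ => 1, fun _ => 1, by simp, by simp⟩

/-- `M` acts as the identity on the qubits outside `K`. -/
def LocalOn (K : Q → Prop) (M : Operator Q) : Prop :=
  (∀ s t, (∃ q, ¬ K q ∧ s q ≠ t q) → M s t = 0) ∧
    ∀ s t s' t', (∀ q, ¬ K q → s q = t q) → (∀ q, ¬ K q → s' q = t' q) →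
      (∀ q, K q → s q = s' q ∧ t q = t' q) → M s t = M s' t'

theorem LocalOn.schmidtLE_of_inside {S : Q → Bool} {K : Q → Prop} {M : Operator Q}
    (h : LocalOn K M) (hK : ∀ q, K q → S q = true) : SchmidtLE S M 1 := by
  -- The inner factor is read off with all outer bits `false`; by locality any other choice gives
  -- the same matrix.
  refine ⟨Unit, inferInstance, fun _ => Matrix.of fun s t =>
    M ((basisSplit S).symm (s, fun _ => false)) ((basisSplit S).symm (t, fun _ => false)),
    fun _ => 1, by simp, ?_⟩
  ext s t
  simp only [Finset.univ_unique, Finset.sum_const, Finset.card_singleton, one_smul,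
    Matrix.submatrix_apply, Matrix.kroneckerMap_apply, Matrix.of_apply, Matrix.one_apply,
    mul_ite, mul_one, mul_zero]
  split_ifs with hst
  · have hst' : ∀ q, ¬ S q = true → s q = t q := fun q hq => congrFun hst ⟨q, hq⟩
    by_cases hd : ∃ q, ¬ K q ∧ s q ≠ t q
    · rw [h.1 _ _ hd]
      obtain ⟨q, hq, hne⟩ := hd
      have hS : S q = true := by by_contra hS; exact hne (hst' q hS)
      exact (h.1 _ _ ⟨q, hq, by simpa [basisSplit, Equiv.piEquivPiSubtypeProd, hS] using hne⟩).symm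
    · push Not at hd
      refine h.2 _ _ _ _ hd (fun q hq => ?_) fun q hq => ?_
      · by_cases hS : S q = true <;> simp [basisSplit, Equiv.piEquivPiSubtypeProd, hS, hd q hq]
      · simp [basisSplit, Equiv.piEquivPiSubtypeProd, hK q hq]
  · refine h.1 _ _ ?_
    by_contra hd
    push Not at hd
    exact hst (funext fun q => hd q fun hq => q.2 (hK q hq))

theorem LocalOn.schmidtLE_of_outside {S : Q → Bool} {K : Q → Prop} {M : Operator Q}
    (h : LocalOn K M) (hK : ∀ q, K q → ¬ S q = true) : SchmidtLE S M 1 := by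
  refine ⟨Unit, inferInstance, fun _ => 1, fun _ => Matrix.of fun s t =>
    M ((basisSplit S).symm (fun _ => false, s)) ((basisSplit S).symm (fun _ => false, t)),
    by simp, ?_⟩
  ext s t
  simp only [Finset.univ_unique, Finset.sum_const, Finset.card_singleton, one_smul,
    Matrix.submatrix_apply, Matrix.kroneckerMap_apply, Matrix.of_apply, Matrix.one_apply,
    ite_mul, one_mul, zero_mul]
  split_ifs with hst
  · have hst' : ∀ q, S q = true → s q = t q := fun q hq => congrFun hst ⟨q, hq⟩
    by_cases hd : ∃ q, ¬ K q ∧ s q ≠ t q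
    · rw [h.1 _ _ hd]
      obtain ⟨q, hq, hne⟩ := hd
      have hS : ¬ S q = true := fun hS => hne (hst' q hS)
      exact (h.1 _ _ ⟨q, hq, by simpa [basisSplit, Equiv.piEquivPiSubtypeProd, hS] using hne⟩).symm
    · push Not at hd
      refine h.2 _ _ _ _ hd (fun q hq => ?_) fun q hq => ?_
      · by_cases hS : S q = true <;> simp [basisSplit, Equiv.piEquivPiSubtypeProd, hS, hd q hq]
      · simp [basisSplit, Equiv.piEquivPiSubtypeProd, hK q hq]
  · refine h.1 _ _ ?_
    by_contra hd
    push Not at hd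
    exact hst (funext fun q => hd q fun hq => hK q hq q.2)

/-! ### Schmidt ranks of gates, layers and branches. -/

theorem TwoQubitGate.localOn_op (g : TwoQubitGate Q) :
    LocalOn (fun q => q = g.fst ∨ q = g.snd) g.op := by
  constructor
  · rintro s t ⟨q, hq, hne⟩
    push Not at hq
    exact if_neg fun h => hne (h q hq.1 hq.2)
  · intro s t s' t' h h' hK
    simp only [TwoQubitGate.op, Matrix.of_apply]
    rw [if_pos fun q h1 h2 => h q (by tauto), if_pos fun q h1 h2 => h' q (by tauto),
      (hK _ (Or.inl rfl)).1, (hK _ (Or.inl rfl)).2, (hK _ (Or.inr rfl)).1, (hK _ (Or.inr rfl)).2]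

theorem ActsAt.localOn {V : Type} [DecidableEq V] {site : Q → V} {v : V} {M : Operator Q}
    (h : ActsAt site v M) : LocalOn (fun q => site q = v) M := by
  obtain ⟨m, hm⟩ := h
  constructor
  · rintro s t ⟨q, hq, hne⟩
    rw [hm]
    exact if_neg fun h => hne (h q hq)
  · intro s t s' t' h h' hK
    rw [hm, hm, if_pos h, if_pos h']
    congr 1 <;> funext q
    · exact (hK q q.2).1
    · exact (hK q q.2).2

/-- The gate is expanded in the four matrix units of its first qubit; `p` is the position of the
unit, and each unit contributes one product operator. -/
theorem TwoQubitGate.schmidtLE_of_fst_inside {S : Q → Bool} (g : TwoQubitGate Q)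
    (h1 : S g.fst = true) (h2 : ¬ S g.snd = true) : SchmidtLE S g.op 4 := by
  refine ⟨Bool × Bool, inferInstance,
    fun p => Matrix.of fun s t => if s ⟨g.fst, h1⟩ = p.1 ∧ t ⟨g.fst, h1⟩ = p.2 ∧
      ∀ q : {q : Q // S q = true}, (q : Q) ≠ g.fst → s q = t q then 1 else 0,
    fun p => Matrix.of fun s t => if ∀ q : {q : Q // ¬ S q = true}, (q : Q) ≠ g.snd → s q = t q
      then g.mat (p.1, s ⟨g.snd, h2⟩) (p.2, t ⟨g.snd, h2⟩) else 0, by simp, ?_⟩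
  ext s t
  simp only [TwoQubitGate.op, Matrix.of_apply, Matrix.submatrix_apply, Matrix.sum_apply,
    Matrix.kroneckerMap_apply, basisSplit, Equiv.piEquivPiSubtypeProd, Equiv.coe_fn_mk,
    ite_mul, one_mul, zero_mul]
  rw [Finset.sum_eq_single (s g.fst, t g.fst)]
  · by_cases hall : ∀ q, q ≠ g.fst → q ≠ g.snd → s q = t q
    · rw [if_pos hall, if_pos ⟨rfl, rfl, fun (q : {q : Q // S q = true}) hq => hall q hq fun hq' =>
        h2 (hq' ▸ q.2)⟩,
        if_pos fun (q : {q : Q // ¬ S q = true}) hq => hall q (fun hq' => q.2 (hq' ▸ h1)) hq]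
    · rw [if_neg hall]
      split_ifs with ha hb
      · refine absurd (fun q hq1 hq2 => ?_) hall
        by_cases hq : S q = true
        · exact ha.2.2 ⟨q, hq⟩ hq1
        · exact hb ⟨q, hq⟩ hq2
      · rfl
      · rfl
  · rintro p - hp
    exact if_neg fun h => hp (Prod.ext h.1.symm h.2.1.symm)
  · simp

/-- The gate with its two qubits exchanged. -/
def TwoQubitGate.flip (g : TwoQubitGate Q) : TwoQubitGate Q :=
  ⟨g.snd, g.fst, g.mat.submatrix Prod.swap Prod.swap⟩

theorem TwoQubitGate.op_flip (g : TwoQubitGate Q) : g.flip.op = g.op := by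
  ext s t
  simp only [TwoQubitGate.op, TwoQubitGate.flip, Matrix.of_apply, Matrix.submatrix_apply,
    Prod.swap_prod_mk]
  exact if_congr ⟨fun h q h1 h2 => h q h2 h1, fun h q h1 h2 => h q h2 h1⟩ rfl rfl

theorem TwoQubitGate.schmidtLE {S : Q → Bool} (g : TwoQubitGate Q) :
    SchmidtLE S g.op (4 ^ (if S g.fst = S g.snd then 0 else 1)) := by
  by_cases h1 : S g.fst = true <;> by_cases h2 : S g.snd = true
  · rw [if_pos (h1.trans h2.symm)]
    exact g.localOn_op.schmidtLE_of_inside (by rintro q (rfl | rfl) <;> assumption)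
  · rw [if_neg fun h : S g.fst = S g.snd => h2 (h ▸ h1)]
    exact g.schmidtLE_of_fst_inside h1 h2
  · rw [if_neg fun h : S g.fst = S g.snd => h1 (h ▸ h2), ← g.op_flip]
    exact g.flip.schmidtLE_of_fst_inside h2 h1
  · rw [if_pos (by simp_all)]
    exact g.localOn_op.schmidtLE_of_outside (by rintro q (rfl | rfl) <;> assumption)

/-- The number of gates with one qubit in either part of the bipartition `S`. -/
def crossings (S : Q → Bool) (gs : List (TwoQubitGate Q)) : ℕ :=
  (gs.map fun g => if S g.fst = S g.snd then 0 else 1).sum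

theorem schmidtLE_layerOp (S : Q → Bool) (gs : List (TwoQubitGate Q)) :
    SchmidtLE S (layerOp gs) (4 ^ crossings S gs) := by
  induction gs with
  | nil => simpa [layerOp, crossings] using schmidtLE_one S
  | cons g gs ih =>
    have := g.schmidtLE.mul ih
    simpa [layerOp, crossings, pow_add] using this

theorem length_le_card_of_pairwise_disjoint {gs : List (TwoQubitGate Q)}
    (h : gs.Pairwise TwoQubitGate.Disjoint) : gs.length ≤ Fintype.card Q := by
  have : (gs.map TwoQubitGate.fst).Nodup := List.pairwise_map.2 (h.imp fun h => h.1)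
  simpa using this.length_le_card

/-- The gate list is fixed before the bipartition `T`, so that the bounds for many cuts can be added
up. Since `T` is a function of the site, a one-site operator lies on one side of the cut and does
not raise the rank. -/
theorem Protocol.exists_gates_of_mem_kraus {V : Type} [DecidableEq V] {G : SimpleGraph V}
    {site : Q → V} (P : Protocol V Q) (hP : P.Valid G site) :
    ∀ M ∈ P.kraus, ∃ gs : List (TwoQubitGate Q), gs.length ≤ P.gateCount ∧
      gs.length ≤ P.depth * Fintype.card Q ∧ (∀ g ∈ gs, G.Adj (site g.fst) (site g.snd)) ∧
      ∀ T : V → Bool, SchmidtLE (fun q => T (site q)) M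
        (4 ^ crossings (fun q => T (site q)) gs) := by
  induction P with
  | done =>
    intro M hM
    obtain rfl : M = 1 := by simpa [Protocol.kraus] using hM
    exact ⟨[], by simp, by simp, by simp, fun T => by simpa [crossings] using schmidtLE_one _⟩
  | measure v n K next ih =>
    obtain ⟨hK, -, hnext⟩ := hP
    intro M hM
    simp only [Protocol.kraus, List.mem_flatMap, List.mem_finRange, true_and, List.mem_map] at hM
    obtain ⟨i, M', hM', rfl⟩ := hM
    obtain ⟨gs, h1, h2, h3, h4⟩ := ih i (hnext i) M' hM'
    refine ⟨gs, h1.trans ?_, h2.trans (Nat.mul_le_mul_right _ ?_), h3, fun T => ?_⟩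
    · exact Finset.le_sup (f := fun i => (next i).gateCount) (Finset.mem_univ i)
    · exact Finset.le_sup (f := fun i => (next i).depth) (Finset.mem_univ i)
    · rw [← mul_one (4 ^ _)]
      refine (h4 T).mul ?_
      by_cases hT : T v = true
      · exact (hK i).localOn.schmidtLE_of_inside fun q hq => by rw [hq, hT]
      · exact (hK i).localOn.schmidtLE_of_outside fun q hq => by rwa [hq]
  | layer gs next ih =>
    obtain ⟨hgs, hdis, hnext⟩ := hP
    intro M hM
    simp only [Protocol.kraus, List.mem_map] at hM
    obtain ⟨M', hM', rfl⟩ := hM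
    obtain ⟨gs', h1, h2, h3, h4⟩ := ih hnext M' hM'
    refine ⟨gs' ++ gs, ?_, ?_, ?_, fun T => ?_⟩
    · simpa [Protocol.gateCount] using h1
    · have := length_le_card_of_pairwise_disjoint hdis
      rw [List.length_append, Protocol.depth, add_mul, one_mul]
      omega
    · intro g hg
      rcases List.mem_append.1 hg with hg | hg
      · exact h3 g hg
      · exact (hgs g hg).1
    · have : crossings (fun q => T (site q)) (gs' ++ gs) =
          crossings (fun q => T (site q)) gs' + crossings (fun q => T (site q)) gs := by
        simp [crossings]
      rw [this, pow_add]
      exact (h4 T).mul (schmidtLE_layerOp _ gs)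

/-! ### Some branch of a protocol has a nonzero amplitude -/

theorem TwoQubitGate.op_mulVec (g : TwoQubitGate Q) (hg : g.fst ≠ g.snd) (φ : StateVector Q)
    (s : Basis Q) : (g.op *ᵥ φ) s = ∑ p : Bool × Bool, g.mat (s g.fst, s g.snd) p *
      φ (Function.update (Function.update s g.fst p.1) g.snd p.2) := by
  simp only [Matrix.mulVec, dotProduct, TwoQubitGate.op, Matrix.of_apply, ite_mul, zero_mul]
  rw [← Finset.sum_filter]
  refine Finset.sum_nbij' (fun t => (t g.fst, t g.snd))
    (fun p => Function.update (Function.update s g.fst p.1) g.snd p.2) (by simp) ?_ ?_ ?_ ?_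
  · intro p _
    simp only [Finset.mem_filter, Finset.mem_univ, true_and]
    intro q h1 h2
    simp [h1, h2]
  · intro t ht
    simp only [Finset.mem_filter, Finset.mem_univ, true_and] at ht
    funext q
    by_cases h2 : q = g.snd
    · subst h2; simp
    · by_cases h1 : q = g.fst
      · subst h1; simp [h2]
      · simp [h1, h2, ht q h1 h2]
  · rintro ⟨a, b⟩ _
    simp [hg]
  · intro t ht
    simp only [Finset.mem_filter, Finset.mem_univ, true_and] at ht
    congr 2
    funext q
    by_cases h2 : q = g.snd
    · subst h2; simp
    · by_cases h1 : q = g.fst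
      · subst h1; simp [h2]
      · simp [h1, h2, ht q h1 h2]

/-- With all other bits frozen, the gate acts on the remaining four amplitudes by the invertible
matrix `g.mat`. -/
theorem TwoQubitGate.op_mulVec_ne_zero {g : TwoQubitGate Q} (hg : g.fst ≠ g.snd)
    (hU : g.mat ∈ Matrix.unitaryGroup (Bool × Bool) ℂ) {φ : StateVector Q} (hφ : φ ≠ 0) :
    g.op *ᵥ φ ≠ 0 := by
  contrapose! hφ
  funext t
  set w : Bool × Bool → ℂ := fun p =>
    φ (Function.update (Function.update t g.fst p.1) g.snd p.2) with hw
  have h0 : g.mat *ᵥ w = 0 := by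
    funext p
    have := congrFun hφ (Function.update (Function.update t g.fst p.1) g.snd p.2)
    rw [g.op_mulVec hg] at this
    refine Eq.trans ?_ this
    change ∑ p', g.mat p p' * w p' = _
    refine Finset.sum_congr rfl fun p' _ => ?_
    simp only [hw]
    congr 2
    · simp [hg]
    · funext q
      by_cases h2 : q = g.snd
      · subst h2; simp
      · by_cases h1 : q = g.fst
        · subst h1; simp [h2]
        · simp [h1, h2]
  have hw0 : w = 0 := by
    have := congrArg (fun x => star g.mat *ᵥ x) h0
    simpa [Matrix.mulVec_mulVec, Matrix.mem_unitaryGroup_iff'.1 hU] using this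
  simpa [hw] using congrFun hw0 (t g.fst, t g.snd)

theorem layerOp_mulVec_ne_zero {gs : List (TwoQubitGate Q)}
    (h : ∀ g ∈ gs, g.fst ≠ g.snd ∧ g.mat ∈ Matrix.unitaryGroup (Bool × Bool) ℂ)
    {φ : StateVector Q} (hφ : φ ≠ 0) : layerOp gs *ᵥ φ ≠ 0 := by
  induction gs with
  | nil => simpa [layerOp] using hφ
  | cons g gs ih =>
    have := TwoQubitGate.op_mulVec_ne_zero (h g (by simp)).1 (h g (by simp)).2
      (ih fun g' hg' => h g' (by simp [hg']))
    simpa [layerOp, Matrix.mulVec_mulVec] using this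

/-- `Implements` is satisfied trivially by a branch that annihilates every input, so the lower bound
needs a branch that survives. Trace preservation provides one: Kraus operators that all kill `φ`
cannot satisfy `∑ i, (K i)ᴴ * K i = 1`. -/
theorem Protocol.exists_kraus_mulVec_ne_zero {V : Type} [DecidableEq V] {G : SimpleGraph V}
    {site : Q → V} (P : Protocol V Q) (hP : P.Valid G site) {φ : StateVector Q} (hφ : φ ≠ 0) :
    ∃ M ∈ P.kraus, M *ᵥ φ ≠ 0 := by
  induction P generalizing φ with
  | done => exact ⟨1, by simp [Protocol.kraus], by simpa using hφ⟩
  | measure v n K next ih =>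
    obtain ⟨-, hK, hnext⟩ := hP
    obtain ⟨i, hi⟩ : ∃ i, K i *ᵥ φ ≠ 0 := by
      by_contra! h
      apply hφ
      have := congrArg (fun A => A *ᵥ φ) hK
      simpa [Matrix.sum_mulVec, ← Matrix.mulVec_mulVec, h] using this.symm
    obtain ⟨M, hM, hne⟩ := ih i (hnext i) hi
    refine ⟨M * K i, ?_, by rwa [← Matrix.mulVec_mulVec]⟩
    simp only [Protocol.kraus, List.mem_flatMap, List.mem_finRange, true_and, List.mem_map]
    exact ⟨i, M, hM, rfl⟩
  | layer gs next ih =>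
    obtain ⟨hgs, -, hnext⟩ := hP
    obtain ⟨M, hM, hne⟩ := ih hnext (layerOp_mulVec_ne_zero (gs := gs) (fun g hg =>
      ⟨fun h => (hgs g hg).1.ne (congrArg site h), (hgs g hg).2⟩) hφ)
    refine ⟨M * layerOp gs, ?_, by rwa [← Matrix.mulVec_mulVec]⟩
    simp only [Protocol.kraus, List.mem_map]
    exact ⟨M, hM, rfl⟩

end Schmidt

/-! ### The number of gates across a cut that a permutation exchanges -/

section Cut

variable {V : Type} [Fintype V] [DecidableEq V]

/-- `F` maps each basis state `y` to a nonzero multiple of the basis state in which the bit at `v`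
is moved to `ρ v`. -/
def PermutesBasis (F : Operator V) (ρ : Equiv.Perm V) : Prop :=
  ∀ x y, F x y ≠ 0 ↔ x = fun v => y (ρ.symm v)

theorem tensor_add {m : ℕ} (φ φ' : StateVector V) (χ : StateVector (Fin m)) :
    tensor (φ + φ') χ = tensor φ χ + tensor φ' χ := by
  funext s
  simp [tensor, add_mul]

/-- A priori the final ancilla state depends on the input. Linearity, applied to sums of two basis
states, shows that all basis inputs leave the same ancilla state; at any `a` where it does not
vanish, `M` has `F` as a block up to the scalar `z`. -/
theorem exists_ancilla_state {F : Operator V} {ρ : Equiv.Perm V} (hF : PermutesBasis F ρ) {m : ℕ}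
    {M : Operator (V ⊕ Fin m)} (hM : ∀ ψ : StateVector V, ∃ χ : StateVector (Fin m),
      M *ᵥ tensor ψ (zeroState m) = tensor (F *ᵥ ψ) χ)
    (hne : M *ᵥ tensor (Pi.single (fun _ => false) 1) (zeroState m) ≠ 0) :
    ∃ a : Basis (Fin m), ∃ z : ℂ, z ≠ 0 ∧ ∀ x y : Basis V,
      M (Sum.elim x a) (Sum.elim y fun _ => false) = F x y * z := by
  have hsingle : ∀ (N : Operator (V ⊕ Fin m)) (y : Basis V) s,
      (N *ᵥ tensor (Pi.single y 1) (zeroState m)) s = N s (Sum.elim y fun _ => false) := by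
    intro N y s
    have : tensor (Pi.single y 1) (zeroState m) =
        Pi.single (Sum.elim y fun _ => false) (1 : ℂ) := by
      funext t
      simp only [tensor, zeroState, Pi.single_apply, mul_ite, mul_one, mul_zero]
      rw [← ite_and]
      refine if_congr ⟨fun h => ?_, ?_⟩ rfl rfl
      · funext q
        rcases q with v | a
        · exact congrFun h.2 v
        · exact congrFun h.1 a
      · rintro rfl
        exact ⟨rfl, rfl⟩
    rw [this, Matrix.mulVec_single_one]
    rfl
  choose χ hχ using hM
  have hconst : ∀ y, χ (Pi.single y 1) = χ (Pi.single (fun _ => false) 1) := by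
    have hval : ∀ (y : Basis V) (ψ : StateVector V), F (fun v => y (ρ.symm v)) y ≠ 0 ∧
        ∀ a, tensor (F *ᵥ ψ) (χ ψ) (Sum.elim (fun v => y (ρ.symm v)) a) =
          (∑ t, F (fun v => y (ρ.symm v)) t * ψ t) * χ ψ a := fun y ψ =>
      ⟨(hF _ _).2 rfl, fun a => by simp [tensor, Matrix.mulVec, dotProduct]⟩
    have hinj : ∀ y t : Basis V, F (fun v => y (ρ.symm v)) t ≠ 0 → t = y := by
      intro y t h
      have h' := (hF _ _).1 h
      funext v
      simpa using (congrFun h' (ρ v)).symm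
    have hFsum : ∀ (y : Basis V) (ψ : StateVector V),
        ∑ t, F (fun v => y (ρ.symm v)) t * ψ t = F (fun v => y (ρ.symm v)) y * ψ y := by
      intro y ψ
      refine Finset.sum_eq_single y (fun t _ ht => ?_) (by simp)
      rw [by_contra fun h => ht (hinj y t h), zero_mul]
    -- Only the `y` component contributes to the amplitude at the image of `y`, and its coefficient
    -- in `F` cancels.
    have key : ∀ y y' : Basis V, y ≠ y' →
        χ (Pi.single y 1) = χ (Pi.single y 1 + Pi.single y' 1) := by
      intro y y' hyy
      funext a
      have h := hχ (Pi.single y 1 + Pi.single y' 1)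
      rw [tensor_add, Matrix.mulVec_add, hχ, hχ] at h
      have h := congrFun h (Sum.elim (fun v => y (ρ.symm v)) a)
      rw [Pi.add_apply] at h
      have h0 : tensor (F *ᵥ Pi.single y' 1) (χ (Pi.single y' 1))
          (Sum.elim (fun v => y (ρ.symm v)) a) = 0 := by
        rw [(hval _ _).2, hFsum]
        simp [hyy]
      rw [h0, (hval _ _).2, (hval _ _).2, hFsum, hFsum] at h
      simpa [hyy, (hval y 0).1] using h
    intro y
    by_cases hy : y = fun _ => false
    · rw [hy]
    · rw [key _ _ hy, add_comm, ← key _ _ (Ne.symm hy)]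
  obtain ⟨a, ha⟩ : ∃ a, χ (Pi.single (fun _ => false) 1) a ≠ 0 := by
    by_contra! h
    apply hne
    rw [hχ]
    funext s
    simp [tensor, h]
  refine ⟨a, _, ha, fun x y => ?_⟩
  rw [← hsingle M, hχ, hconst]
  simp [tensor]

/-- Only the bits of `A` vary, and the remaining input bits are `false`. The varying bits start
inside `S` and end outside, so the outer input and the inner output are constant. Hence the block
`W`, with rows for inputs and columns for outputs, factors through the Schmidt index; yet it is
diagonal without zeros on the diagonal. -/
theorem two_pow_card_le_of_schmidtLE {F : Operator V} {ρ : Equiv.Perm V} (hF : PermutesBasis F ρ)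
    {m : ℕ} {M : Operator (V ⊕ Fin m)} {a : Basis (Fin m)} {z : ℂ} (hz : z ≠ 0)
    (hM : ∀ x y : Basis V, M (Sum.elim x a) (Sum.elim y fun _ => false) = F x y * z)
    {S : V ⊕ Fin m → Bool} {R : ℕ} (hS : SchmidtLE S M R) (A : Finset V)
    (hA : ∀ v ∈ A, S (Sum.inl v) = true ∧ ¬ S (Sum.inl (ρ v)) = true) : 2 ^ A.card ≤ R := by
  obtain ⟨ι, _, X, Y, hc, rfl⟩ := hS
  let ext : (A → Bool) → Basis V := fun y v => if h : v ∈ A then y ⟨v, h⟩ else false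
  let inp : (A → Bool) → Basis (V ⊕ Fin m) := fun y => Sum.elim (ext y) fun _ => false
  let out : (A → Bool) → Basis (V ⊕ Fin m) := fun y => Sum.elim (fun v => ext y (ρ.symm v)) a
  let z0 : A → Bool := fun _ => false
  let W : Matrix (A → Bool) (A → Bool) ℂ := Matrix.of fun y y' =>
    ((∑ i, X i ⊗ₖ Y i).submatrix (basisSplit S) (basisSplit S)) (out y') (inp y)
  have hdiag : W = Matrix.diagonal fun y => F (fun v => ext y (ρ.symm v)) (ext y) * z := by
    ext y y'
    simp only [W, Matrix.of_apply, inp, out, hM]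
    by_cases hyy : y = y'
    · subst hyy; simp
    · rw [Matrix.diagonal_apply_ne _ hyy]
      have : F (fun v => ext y' (ρ.symm v)) (ext y) = 0 := by
        by_contra h
        have h' := (hF _ _).1 h
        apply hyy
        funext v
        have := congrFun h' (ρ v)
        simpa [ext] using this.symm
      rw [this, zero_mul]
  have hrank : W.rank = 2 ^ A.card := by
    rw [hdiag, Matrix.rank_diagonal]
    have : ∀ y : A → Bool, F (fun v => ext y (ρ.symm v)) (ext y) * z ≠ 0 := fun y =>
      mul_ne_zero ((hF _ _).2 rfl) hz
    rw [Fintype.card_congr (Equiv.subtypeUnivEquiv this)]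
    simp
  have hfac : W = (Matrix.of fun y i => X i (basisSplit S (out z0)).1 (basisSplit S (inp y)).1) *
      (Matrix.of fun i y' => Y i (basisSplit S (out y')).2 (basisSplit S (inp z0)).2) := by
    ext y y'
    have h1 : (basisSplit S (out y')).1 = (basisSplit S (out z0)).1 := by
      funext ⟨q, hq⟩
      rcases q with v | j
      · have : ρ.symm v ∉ A := fun h => (hA _ h).2 (by simpa using hq)
        simp [basisSplit, Equiv.piEquivPiSubtypeProd, out, ext, this]
      · rfl
    have h2 : (basisSplit S (inp y)).2 = (basisSplit S (inp z0)).2 := by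
      funext ⟨q, hq⟩
      rcases q with v | j
      · have : v ∉ A := fun h => hq (hA _ h).1
        simp [basisSplit, Equiv.piEquivPiSubtypeProd, inp, ext, this]
      · rfl
    simp only [W, Matrix.of_apply, Matrix.submatrix_apply, Matrix.sum_apply,
      Matrix.kroneckerMap_apply, Matrix.mul_apply]
    refine Finset.sum_congr rfl fun i _ => ?_
    rw [h1, h2]
  rw [← hrank, hfac]
  exact ((Matrix.rank_mul_le_left _ _).trans (Matrix.rank_le_card_width _)).trans hc

theorem card_le_two_mul_crossings {G : SimpleGraph V} {m : ℕ} {loc : Fin m → V}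
    {P : Protocol V (V ⊕ Fin m)} {F : Operator V} {ρ : Equiv.Perm V} (hF : PermutesBasis F ρ)
    (hP : IsLOCCProtocol G loc P F) :
    ∃ gs : List (TwoQubitGate (V ⊕ Fin m)), gs.length ≤ P.gateCount ∧
      gs.length ≤ P.depth * (Fintype.card V + m) ∧
      (∀ g ∈ gs, G.Adj (siteOf loc g.fst) (siteOf loc g.snd)) ∧
      ∀ (T : V → Bool) (A : Finset V), (∀ v ∈ A, T v = true ∧ ¬ T (ρ v) = true) →
        A.card ≤ 2 * crossings (fun q => T (siteOf loc q)) gs := by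
  obtain ⟨M, hM, hne⟩ := P.exists_kraus_mulVec_ne_zero hP.1
    (φ := tensor (Pi.single (fun _ => false) 1) (zeroState m)) fun h => by
      simpa [tensor, zeroState] using congrFun h fun _ => false
  obtain ⟨a, z, hz, haz⟩ := exists_ancilla_state hF (hP.2 M hM) hne
  obtain ⟨gs, h1, h2, h3, h4⟩ := P.exists_gates_of_mem_kraus hP.1 M hM
  refine ⟨gs, h1, by simpa using h2, h3, fun T A hA => ?_⟩
  have := two_pow_card_le_of_schmidtLE hF hz haz (h4 T) A hA
  rw [show 4 = 2 ^ 2 from rfl, ← pow_mul] at this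
  exact (Nat.pow_le_pow_iff_right (by norm_num)).1 this

end Cut

/-! ### Lower bounds for the permutations that reverse the rows of the grid -/

/-- The rows of neighbouring sites differ by at most one, so at most one threshold `i` separates
them. -/
theorem sum_crossings_le_length {Q : Type} {L n : ℕ} (site : Q → Site L)
    (gs : List (TwoQubitGate Q)) (h : ∀ g ∈ gs, (grid L).Adj (site g.fst) (site g.snd)) :
    ∑ i ∈ Finset.range n, crossings (fun q => decide (((site q).1 : ℕ) < i)) gs ≤ gs.length := by
  induction gs with
  | nil => simp [crossings]
  | cons g gs ih =>
    have ih := ih fun g' hg' => h g' (by simp [hg'])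
    have hg := h g (by simp)
    have h1 : ∑ i ∈ Finset.range n, (if decide (((site g.fst).1 : ℕ) < i) =
        decide (((site g.snd).1 : ℕ) < i) then 0 else 1) ≤ 1 := by
      rw [Finset.sum_congr rfl fun i _ => (ite_not (decide (((site g.fst).1 : ℕ) < i) =
        decide (((site g.snd).1 : ℕ) < i)) 1 0).symm, Finset.sum_boole, Nat.cast_id]
      refine Finset.card_le_one.2 fun i hi j hj => ?_
      simp only [Finset.mem_filter, decide_eq_decide] at hi hj
      simp only [SimpleGraph.boxProd_adj, SimpleGraph.pathGraph_adj] at hg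
      omega
    have h2 : ∀ i, crossings (fun q => decide (((site q).1 : ℕ) < i)) (g :: gs) =
        (if decide (((site g.fst).1 : ℕ) < i) = decide (((site g.snd).1 : ℕ) < i) then 0 else 1) +
          crossings (fun q => decide (((site q).1 : ℕ) < i)) gs := fun i => by simp [crossings]
    rw [Finset.sum_congr rfl fun i _ => h2 i, Finset.sum_add_distrib, List.length_cons]
    omega

theorem lower_bound_of_reverses_rows {L : ℕ} (hL : 2 ≤ L) {m : ℕ} {loc : Fin m → Site L}
    {P : Protocol (Site L) (Site L ⊕ Fin m)} {F : Operator (Site L)} {ρ : Equiv.Perm (Site L)}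
    (hF : PermutesBasis F ρ) (hρ : ∀ v, ((ρ v).1 : ℕ) = L - 1 - v.1)
    (hP : IsLOCCProtocol (grid L) loc P F) :
    L * L * L ≤ 32 * P.gateCount ∧ L * L * L ≤ 32 * (P.depth * (L * L + m)) := by
  obtain ⟨gs, h1, h2, h3, h4⟩ := card_le_two_mul_crossings hF hP
  -- The first `i` rows go to the last `i` rows, which are different ones because `2 * i ≤ L`; so
  -- all their `i * L` qubits leave.
  have hcut : ∀ i ∈ Finset.range (L / 2 + 1),
      i * L ≤ 2 * crossings (fun q => decide (((siteOf loc q).1 : ℕ) < i)) gs := by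
    intro i hi
    have hi : i < L / 2 + 1 := Finset.mem_range.1 hi
    have := h4 (fun v => decide ((v.1 : ℕ) < i))
      ((Finset.univ.filter fun r : Fin L => (r : ℕ) < i) ×ˢ Finset.univ) (by
        rintro ⟨r, c⟩ hv
        simp only [Finset.mem_product, Finset.mem_filter, Finset.mem_univ, true_and,
          and_true] at hv
        refine ⟨by simpa using hv, ?_⟩
        simp only [hρ, decide_eq_true_eq]
        omega)
    rw [Finset.card_product, Fin.card_filter_val_lt, Finset.card_univ, Fintype.card_fin,
      Nat.min_eq_right (by omega)] at this
    exact this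
  have hsum := sum_crossings_le_length (n := L / 2 + 1) (siteOf loc) gs h3
  have hle := Finset.sum_le_sum hcut
  rw [← Finset.mul_sum, ← Finset.sum_mul] at hle
  have hgauss := Finset.sum_range_id_mul_two (L / 2 + 1)
  have hlen : L * L * L ≤ 32 * gs.length := by
    have hq : L ≤ 2 * (L / 2) + 1 := by omega
    simp only [Nat.add_sub_cancel] at hgauss
    -- With `n = L / 2 ≥ 1` one has `L * L ≤ (2 * n + 1) ^ 2 ≤ 8 * n * (n + 1)`, and the sum is `n *
    -- (n + 1) / 2`.
    have h5 : L * L ≤ 16 * ∑ i ∈ Finset.range (L / 2 + 1), i := by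
      generalize L / 2 = n at *
      have : 1 ≤ n := by omega
      nlinarith
    nlinarith [Nat.mul_le_mul_right L h5]
  simp only [Fintype.card_prod, Fintype.card_fin] at h2
  omega

/-! ### Odd-even transposition sorts in `L` rounds -/

section OddEven

/-- The number of tokens with destination at least `k` at the positions `c, …, L - 1`. -/
def tailCount (L k : ℕ) (f : ℕ → ℕ) (c : ℕ) : ℕ :=
  ∑ i ∈ Finset.Ico c L, if k ≤ f i then 1 else 0

theorem tailCount_eq_add {L k c : ℕ} (f : ℕ → ℕ) (h : c < L) :
    tailCount L k f c = (if k ≤ f c then 1 else 0) + tailCount L k f (c + 1) :=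
  Finset.sum_eq_sum_Ico_succ_bot h _

theorem tailCount_of_le {L k c : ℕ} (f : ℕ → ℕ) (h : L ≤ c) : tailCount L k f c = 0 := by
  simp [tailCount, Finset.Ico_eq_empty_of_le h]

variable {L : ℕ} (d : ℕ → ℕ) {t c : ℕ}

theorem oetState_succ_left (h : c % 2 = t % 2) (hc : c + 1 < L) :
    oetState L d (t + 1) c = min (oetState L d t c) (oetState L d t (c + 1)) := by
  have h1 : ¬ (1 ≤ c ∧ (c - 1) % 2 = t % 2) := by omega
  simp only [oetState, oetSwaps, decide_eq_true_eq, h, hc, true_and]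
  split_ifs with h2 h3
  · omega
  · exact absurd ⟨h3.1, h3.2.1⟩ h1
  · omega

theorem oetState_succ_right (h : c % 2 = t % 2) (hc : c + 1 < L) :
    oetState L d (t + 1) (c + 1) = max (oetState L d t c) (oetState L d t (c + 1)) := by
  have h1 : ¬ (c + 1) % 2 = t % 2 := by omega
  simp only [oetState, oetSwaps, decide_eq_true_eq, h1, false_and, if_false, Nat.add_sub_cancel, h,
    hc, true_and]
  split_ifs with h2 <;> omega

theorem oetState_succ_last (h : c % 2 = t % 2) (hc : c + 1 = L) :
    oetState L d (t + 1) c = oetState L d t c := by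
  have h1 : ¬ (1 ≤ c ∧ (c - 1) % 2 = t % 2) := by omega
  simp only [oetState, oetSwaps, decide_eq_true_eq, hc, lt_irrefl, false_and, and_false, if_false]
  split_ifs with h3
  · exact absurd ⟨h3.1, h3.2.1⟩ h1
  · rfl

theorem oetState_succ_zero (h : t % 2 = 1) : oetState L d (t + 1) 0 = oetState L d t 0 := by
  simp [oetState, oetSwaps, h]

/-- For `c` of the parity of `t`, no exchange of round `t` straddles the border between `c - 1` and
`c`: the tail splits into compared pairs and possibly a last single position. -/
theorem tailCount_oetState_succ_of_parity (k : ℕ) (h : c % 2 = t % 2) :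
    tailCount L k (oetState L d (t + 1)) c = tailCount L k (oetState L d t) c := by
  induction hn : L - c using Nat.strong_induction_on generalizing c with
  | _ n ih =>
    rcases Nat.lt_trichotomy (c + 1) L with hc | hc | hc
    · rw [tailCount_eq_add _ (by omega), tailCount_eq_add _ hc,
        ih (L - (c + 1 + 1)) (by omega) (by omega) rfl, tailCount_eq_add _ (by omega : c < L),
        tailCount_eq_add _ hc, oetState_succ_left d h hc, oetState_succ_right d h hc]
      split_ifs <;> omega
    · rw [tailCount_eq_add _ (by omega), tailCount_eq_add _ (by omega : c < L),
        oetState_succ_last d h hc, tailCount_of_le _ (by omega), tailCount_of_le _ (by omega)]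
    · rw [tailCount_of_le _ (by omega), tailCount_of_le _ (by omega)]

theorem tailCount_oetState_succ_zero (k : ℕ) :
    tailCount L k (oetState L d (t + 1)) 0 = tailCount L k (oetState L d t) 0 := by
  rcases Nat.mod_two_eq_zero_or_one t with ht | ht
  · exact tailCount_oetState_succ_of_parity d k (by omega)
  · rcases Nat.eq_zero_or_pos L with rfl | hL
    · rfl
    · rw [tailCount_eq_add _ hL, tailCount_eq_add _ hL, oetState_succ_zero d ht,
        tailCount_oetState_succ_of_parity d k (by omega)]

/-- If one of the two compared tokens is at least `k`, the larger lands on `c + 1` and `h2` applies.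
If neither is, the tails from `c` and from `c + 2` have equal counts and `h1` applies. -/
theorem le_tailCount_oetState_succ {j : ℕ} (k : ℕ) (h : c % 2 = t % 2) (hc : c + 1 < L)
    (h1 : j ≤ tailCount L k (oetState L d t) c)
    (h2 : j ≤ tailCount L k (oetState L d t) (c + 1 + 1) + 1) :
    j ≤ tailCount L k (oetState L d (t + 1)) (c + 1) := by
  rw [tailCount_eq_add _ (by omega), tailCount_eq_add _ hc] at h1
  rw [tailCount_eq_add _ hc, tailCount_oetState_succ_of_parity d k (by omega),
    oetState_succ_right d h hc]
  split_ifs at * <;> omega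

theorem tailCount_oetState_le_succ (k : ℕ) :
    tailCount L k (oetState L d t) c ≤ tailCount L k (oetState L d (t + 1)) c := by
  by_cases h : c % 2 = t % 2
  · exact (tailCount_oetState_succ_of_parity d k h).ge
  · rcases c with _ | c
    · exact (tailCount_oetState_succ_zero d k).ge
    · by_cases hc : c + 1 < L
      · refine le_tailCount_oetState_succ d k (by omega) hc ?_ ?_
        · rw [tailCount_eq_add _ (by omega : c < L)]
          omega
        · rw [tailCount_eq_add _ hc]
          split_ifs <;> omega
      · rw [tailCount_of_le _ (by omega)]
        exact Nat.zero_le _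

theorem tailCount_oetState_zero (k : ℕ) :
    tailCount L k (oetState L d t) 0 = tailCount L k d 0 := by
  induction t with
  | zero => rfl
  | succ t ih => rw [tailCount_oetState_succ_zero, ih]

theorem tailCount_zero_le (k : ℕ) : tailCount L k d 0 ≤ tailCount L k d c + c := by
  induction c with
  | zero => rfl
  | succ c ih =>
    by_cases hc : c < L
    · rw [tailCount_eq_add _ hc] at ih
      split_ifs at ih <;> omega
    · rw [tailCount_of_le (c := c) _ (by omega)] at ih
      omega

/-- Call a token large if its destination is at least `k`. The guaranteed position `t + a - 2 * j`
of the `j`-th large token from the right advances by one per round, up to the cap `L - j`, and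
successive guarantees are two apart. Since `a` is even, the comparator of round `t` sits at `(c - 1,
c)` exactly when the guarantee has to reach a new position `c`. At time zero at most `c` large
tokens lie to the left of `c`, and `a ≤ tailCount L k d 0 + 1` leaves enough of them. -/
theorem le_tailCount_oetState {k a : ℕ} (ha : a % 2 = 0) (ha1 : a ≤ tailCount L k d 0 + 1)
    {j : ℕ} (h1 : c + j ≤ L) (h2 : c + 2 * j ≤ t + a) (h3 : j ≤ tailCount L k d 0) :
    j ≤ tailCount L k (oetState L d t) c := by
  induction t generalizing c j with
  | zero =>
    have := tailCount_zero_le d (L := L) (c := c) k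
    change j ≤ tailCount L k d c
    omega
  | succ t ih =>
    by_cases h : c + 2 * j ≤ t + a
    · exact (ih h1 h h3).trans (tailCount_oetState_le_succ d k)
    · rcases c with _ | c
      · rwa [tailCount_oetState_zero]
      · rcases j with _ | j
        · exact Nat.zero_le _
        · exact le_tailCount_oetState_succ d k (by omega) (by omega)
            (ih (by omega) (by omega) h3)
            (Nat.succ_le_succ (ih (by omega) (by omega) (by omega)))

theorem tailCount_eq_sub {k : ℕ} (hd : ∀ i < L, d i < L)
    (hinj : ∀ i < L, ∀ j < L, d i = d j → i = j) : tailCount L k d 0 = L - k := by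
  have himg : (Finset.Ico 0 L).image d = Finset.Ico 0 L := by
    refine Finset.eq_of_subset_of_card_le (fun x hx => ?_) ?_
    · obtain ⟨i, hi, rfl⟩ := Finset.mem_image.1 hx
      exact Finset.mem_Ico.2 ⟨Nat.zero_le _, hd i (Finset.mem_Ico.1 hi).2⟩
    · rw [Finset.card_image_of_injOn]
      intro i hi j hj
      exact hinj i (Finset.mem_Ico.1 hi).2 j (Finset.mem_Ico.1 hj).2
  have h1 : tailCount L k d 0 = ∑ x ∈ (Finset.Ico 0 L).image d, if k ≤ x then 1 else 0 := by
    rw [Finset.sum_image fun i hi j hj =>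
      hinj i (Finset.mem_Ico.1 hi).2 j (Finset.mem_Ico.1 hj).2]
    rfl
  rw [h1, himg, Finset.sum_boole, Nat.cast_id]
  have : (Finset.Ico 0 L).filter (fun x => k ≤ x) = Finset.Ico k L := by
    ext x; simp only [Finset.mem_filter, Finset.mem_Ico]; omega
  rw [this, Nat.card_Ico]

theorem oetState_sorted (hd : ∀ i < L, d i < L) (hinj : ∀ i < L, ∀ j < L, d i = d j → i = j)
    (hc : c < L) : oetState L d L c = c := by
  have key : ∀ k ≤ L, L - k ≤ tailCount L k (oetState L d L) k := by
    intro k hk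
    have hm := tailCount_eq_sub (k := k) d hd hinj
    -- `a` is `L - k` rounded up to an even number, which suffices for `c = k`, `j = L - k` and `t =
    -- L`.
    obtain ⟨a, ha, ha1, ha2⟩ : ∃ a, a % 2 = 0 ∧ L - k ≤ a ∧ a ≤ L - k + 1 :=
      ⟨(L - k + 1) / 2 * 2, by omega, by omega, by omega⟩
    exact le_tailCount_oetState d ha (by omega) (by omega) (by omega) (by omega)
  refine le_antisymm ?_ ?_
  -- All tokens with destination above `c` are already to the right of `c`, so none of them can be
  -- at `c`.
  · by_contra! hlt
    have h1 := key (c + 1) hc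
    have h2 : tailCount L (c + 1) (oetState L d L) 0 = L - (c + 1) := by
      rw [tailCount_oetState_zero, tailCount_eq_sub d hd hinj]
    have h3 : tailCount L (c + 1) (oetState L d L) c ≤ tailCount L (c + 1) (oetState L d L) 0 :=
      Finset.sum_le_sum_of_subset (Finset.Ico_subset_Ico_left (Nat.zero_le c))
    rw [tailCount_eq_add _ hc, if_pos (by omega)] at h3
    omega
  -- The `L - c` tokens with destination at least `c` fill all positions from `c` on.
  · by_contra! hlt
    have h1 := key c hc.le
    rw [tailCount_eq_add _ hc, if_neg (by omega)] at h1
    have h2 : tailCount L c (oetState L d L) (c + 1) ≤ L - (c + 1) := by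
      refine (Finset.sum_le_card_nsmul _ _ 1 fun i _ => by split_ifs <;> omega).trans ?_
      simp
    omega

end OddEven

/-! ### Existence of three-stage plans -/

open Finset in
theorem card_filter_mem_eq_mul {E α : Type} [DecidableEq α] (s : E → α) {k : ℕ} {X : Finset E}
    (hs : ∀ a, #{e ∈ X | s e = a} = k) (A : Finset α) : #{e ∈ X | s e ∈ A} = k * #A := by
  have hmaps : Set.MapsTo s ({e ∈ X | s e ∈ A} : Finset E) A :=
    fun e he => (mem_filter.1 (mem_coe.1 he)).2
  rw [card_eq_sum_card_fiberwise hmaps, sum_congr rfl (g := fun _ => k), sum_const, smul_eq_mul,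
    mul_comm]
  intro a ha
  rw [← hs a, filter_filter]
  congr 1
  ext e
  simp only [mem_filter]
  constructor
  · rintro ⟨h, -, h'⟩
    exact ⟨h, h'⟩
  · rintro ⟨h, rfl⟩
    exact ⟨h, ha, rfl⟩

-- Kőnig's edge colouring of the `k`-regular bipartite multigraph with edges `X` and end maps `s`,
-- `d`. Double counting gives Hall's condition; the resulting perfect matching `m` receives a colour
-- of its own, and its removal lowers the degree by one.
open Finset in
theorem exists_injOn_coloring {E α β : Type} [DecidableEq E] [Fintype α] [DecidableEq α]
    [Fintype β] [DecidableEq β] (s : E → α) (d : E → β) (k : ℕ) (X : Finset E)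
    (hs : ∀ a, #{e ∈ X | s e = a} = k) (hd : ∀ b, #{e ∈ X | d e = b} = k) :
    ∃ χ : E → ℕ, (∀ e ∈ X, χ e < k) ∧
      ∀ e ∈ X, ∀ f ∈ X, χ e = χ f → s e = s f ∨ d e = d f → e = f := by
  induction k generalizing X with
  | zero =>
    refine ⟨fun _ => 0, fun e he => ?_, fun e he => ?_⟩ <;>
    exact absurd (mem_filter.2 ⟨he, (rfl : s e = s e)⟩)
      (eq_empty_iff_forall_notMem.1 (card_eq_zero.1 (hs (s e))) e)
  | succ k ih =>
    obtain ⟨f, hinj, hf⟩ := (all_card_le_biUnion_card_iff_exists_injective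
      fun a => ({e ∈ X | s e = a} : Finset E).image d).1 fun A => by
        set B := A.biUnion fun a => ({e ∈ X | s e = a} : Finset E).image d
        have h1 : #{e ∈ X | s e ∈ A} = (k + 1) * #A :=
          card_filter_mem_eq_mul s hs A
        have h2 : #{e ∈ X | d e ∈ B} = (k + 1) * #B :=
          card_filter_mem_eq_mul d hd B
        have h3 : #{e ∈ X | s e ∈ A} ≤ #{e ∈ X | d e ∈ B} := by
          refine card_le_card fun e he => ?_
          obtain ⟨he, hA⟩ := mem_filter.1 he
          refine mem_filter.2 ⟨he, mem_biUnion.2 ⟨s e, hA, mem_image.2 ⟨e, ?_, rfl⟩⟩⟩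
          exact mem_filter.2 ⟨he, rfl⟩
        rw [h1, h2] at h3
        exact Nat.le_of_mul_le_mul_left h3 (Nat.succ_pos k)
    have hcard : Fintype.card β ≤ Fintype.card α := by
      have h1 := card_filter_mem_eq_mul s hs univ
      have h2 := card_filter_mem_eq_mul d hd univ
      simp only [mem_univ, filter_true, card_univ] at h1 h2
      exact Nat.le_of_mul_le_mul_left (h2.symm.trans h1).le (Nat.succ_pos k)
    have hbij : Function.Bijective f :=
      (Fintype.bijective_iff_injective_and_card f).2
        ⟨hinj, le_antisymm (Fintype.card_le_of_injective f hinj) hcard⟩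
    have hex : ∀ a, ∃ e ∈ X, s e = a ∧ d e = f a := fun a => by
      obtain ⟨e, he, hde⟩ := mem_image.1 (hf a)
      exact ⟨e, (mem_filter.1 he).1, (mem_filter.1 he).2, hde⟩
    choose m hmX hms hmd using hex
    have hminj : Function.Injective m := fun a b h => by rw [← hms a, h, hms b]
    have hcut : ∀ (p : E → Prop) [DecidablePred p] (e₀ : E), e₀ ∈ univ.image m → p e₀ →
        (∀ e ∈ univ.image m, p e → e = e₀) → #{e ∈ X | p e} = k + 1 →
        #{e ∈ X \ univ.image m | p e} = k := by
      intro p _ e₀ h0 hp huniq hc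
      have : ({e ∈ X \ univ.image m | p e} : Finset E) = ({e ∈ X | p e} : Finset E).erase e₀ := by
        ext e
        simp only [mem_filter, mem_sdiff, mem_erase]
        constructor
        · rintro ⟨⟨h1, h2⟩, h3⟩
          exact ⟨fun h => h2 (h ▸ h0), h1, h3⟩
        · rintro ⟨h1, h2, h3⟩
          exact ⟨⟨h2, fun h => h1 (huniq e h h3)⟩, h3⟩
      rw [this, card_erase_of_mem, hc, Nat.add_sub_cancel]
      obtain ⟨a, -, rfl⟩ := mem_image.1 h0
      exact mem_filter.2 ⟨hmX a, hp⟩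
    obtain ⟨χ, hχ, hχ'⟩ := ih (X \ univ.image m)
      (fun a => hcut (fun e => s e = a) (m a) (mem_image_of_mem m (mem_univ a)) (hms a) (by
        intro e he h
        obtain ⟨b, -, rfl⟩ := mem_image.1 he
        rw [← h, hms]) (hs a))
      (fun b => by
        obtain ⟨a, rfl⟩ := hbij.2 b
        refine hcut (fun e => d e = f a) (m a) (mem_image_of_mem m (mem_univ a)) (hmd a) ?_ (hd _)
        intro e he h
        obtain ⟨b, -, rfl⟩ := mem_image.1 he
        rw [hmd] at h
        rw [hinj h])
    refine ⟨fun e => if e ∈ univ.image m then k else χ e, fun e he => ?_, fun e he g hg heg h => ?_⟩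
    · dsimp only
      split_ifs with hm
      · omega
      · have := hχ e (mem_sdiff.2 ⟨he, hm⟩)
        omega
    · dsimp only at heg
      split_ifs at heg with h1 h2 h2
      · obtain ⟨a, -, rfl⟩ := mem_image.1 h1
        obtain ⟨b, -, rfl⟩ := mem_image.1 h2
        rw [hms, hms, hmd, hmd] at h
        rcases h with h | h
        · rw [h]
        · rw [hinj h]
      · have := hχ g (mem_sdiff.2 ⟨hg, h2⟩)
        omega
      · have := hχ e (mem_sdiff.2 ⟨he, h1⟩)
        omega
      · exact hχ' e (mem_sdiff.2 ⟨he, h1⟩) g (mem_sdiff.2 ⟨hg, h2⟩) heg h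

theorem card_filter_fst_eq {L : ℕ} (r : Fin L) :
    (Finset.univ.filter fun v : Site L => v.1 = r).card = L := by
  have : (Finset.univ.filter fun v : Site L => v.1 = r) = {r} ×ˢ Finset.univ := by
    ext v
    rw [Finset.mem_product]
    simp
  rw [this, Finset.card_product]
  simp

/-- Every token is an edge from its row to its destination row, and its colour is the column in
which it travels. Tokens that share a row, or a destination row, have different colours, so `(v.1, χ
v)` and `((ρ v).1, χ v)` both range bijectively over the grid. -/
theorem nonempty_threeStagePlan {L : ℕ} (ρ : Equiv.Perm (Site L)) :
    Nonempty (ThreeStagePlan ρ) := by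
  classical
  obtain ⟨χ, hχ, hχ'⟩ := exists_injOn_coloring (fun v : Site L => v.1) (fun v => (ρ v).1) L
    Finset.univ card_filter_fst_eq fun r => by
      refine Eq.trans ?_ (card_filter_fst_eq r)
      exact Finset.card_bij (fun v _ => ρ v) (by simp) (fun _ _ _ _ h => ρ.injective h)
        fun v hv => ⟨ρ.symm v, by simpa using hv, by simp⟩
  have hA : Function.Bijective fun v : Site L => ((v.1, ⟨χ v, hχ v (Finset.mem_univ v)⟩) : Site L) :=
    Finite.injective_iff_bijective.1 fun v w h => by
      simp only [Prod.mk.injEq, Fin.mk.injEq] at h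
      exact hχ' v (Finset.mem_univ _) w (Finset.mem_univ _) h.2 (Or.inl h.1)
  have hB : Function.Bijective
      fun v : Site L => (((ρ v).1, ⟨χ v, hχ v (Finset.mem_univ v)⟩) : Site L) :=
    Finite.injective_iff_bijective.1 fun v w h => by
      simp only [Prod.mk.injEq, Fin.mk.injEq] at h
      exact hχ' v (Finset.mem_univ _) w (Finset.mem_univ _) h.2 (Or.inr h.1)
  let eA := Equiv.ofBijective _ hA
  let eB := Equiv.ofBijective _ hB
  refine ⟨⟨eA, eA.symm.trans eB, eB.symm.trans ρ, fun p => rfl, fun p => ?_, fun p => ?_,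
    fun p => ?_⟩⟩
  · obtain ⟨v, rfl⟩ := eA.surjective p
    simp [eA, eB]
  · obtain ⟨v, rfl⟩ := eB.surjective p
    simp only [Equiv.trans_apply, Equiv.symm_apply_apply]
    rfl
  · simp

/-! ### Pairs of sites on which two orders disagree -/

section Disagreement

variable {V : Type} [Fintype V]

/-- The parity of the number of pairs of occupied sites on which the orders given by the keys
`k` and `k'` disagree. -/
def disagreement (k k' : V → ℕ) (x : V → ZMod 2) : ZMod 2 :=
  ∑ p, ∑ q, if k p < k q ∧ k' q < k' p then x p * x q else 0

/-- Either order picks each unordered pair once, and a symmetric weight does not see the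
orientation. -/
theorem sum_pairs_eq_of_symm {k k' : V → ℕ} (hk : Function.Injective k)
    (hk' : Function.Injective k') (h : V → V → ZMod 2) (hsymm : ∀ p q, p ≠ q → h p q = h q p) :
    (∑ p, ∑ q, if k p < k q then h p q else 0) = ∑ p, ∑ q, if k' p < k' q then h p q else 0 := by
  have split : ∀ k k' : V → ℕ, Function.Injective k' →
      (∑ p, ∑ q, if k p < k q then h p q else 0) =
        (∑ p, ∑ q, if k p < k q ∧ k' p < k' q then h p q else 0) +
          ∑ p, ∑ q, if k p < k q ∧ k' q < k' p then h p q else 0 := by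
    intro k k' hk'
    rw [← Finset.sum_add_distrib]
    refine Finset.sum_congr rfl fun p _ => ?_
    rw [← Finset.sum_add_distrib]
    refine Finset.sum_congr rfl fun q _ => ?_
    by_cases h1 : k p < k q
    · have hne : p ≠ q := by rintro rfl; exact lt_irrefl _ h1
      rcases lt_or_gt_of_ne (hk'.ne hne) with h2 | h2
      · simp [h1, h2, h2.not_gt]
      · simp [h1, h2, h2.not_gt]
    · simp [h1]
  rw [split k k' hk', split k' k hk]
  congr 1
  · simp only [and_comm]
  · rw [Finset.sum_comm]
    refine Finset.sum_congr rfl fun p _ => Finset.sum_congr rfl fun q _ => ?_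
    by_cases hpq : p = q
    · subst hpq; simp
    · rw [hsymm q p (Ne.symm hpq)]
      simp only [and_comm]

theorem disagreement_eq_sum_ite (k k' : V → ℕ) (x : V → ZMod 2) :
    disagreement k k' x =
      ∑ p, ∑ q, if k p < k q then (if k' q < k' p then x p * x q else 0) else 0 := by
  simp only [disagreement, ite_and]

/-- Disagreements add up modulo two. -/
theorem disagreement_triangle {k k' k'' : V → ℕ} (hk : Function.Injective k)
    (hk' : Function.Injective k') (hk'' : Function.Injective k'') (x : V → ZMod 2) :
    disagreement k k'' x = disagreement k k' x + disagreement k' k'' x := by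
  -- Exchanging `p` and `q` negates both comparisons, which does not change the parity, so `h` is
  -- symmetric. Oriented by `k` it sums to the two disagreements with `k`; oriented by `k'` its
  -- first term drops out and `disagreement k' k''` remains.
  set h : V → V → ZMod 2 := fun p q =>
    (if k' q < k' p then x p * x q else 0) + if k'' q < k'' p then x p * x q else 0 with hh
  have hsymm : ∀ p q, p ≠ q → h p q = h q p := by
    intro p q hpq
    simp only [hh, mul_comm (x q) (x p)]
    have h2 : x p * x q + x p * x q = 0 := CharTwo.add_self_eq_zero _
    rcases lt_or_gt_of_ne (hk'.ne hpq) with h1 | h1 <;>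
      rcases lt_or_gt_of_ne (hk''.ne hpq) with h3 | h3 <;>
        simp [h1, h3, h1.not_gt, h3.not_gt, h2]
  have key := sum_pairs_eq_of_symm hk hk' h hsymm
  have h1 : (∑ p, ∑ q, if k p < k q then h p q else 0) =
      disagreement k k' x + disagreement k k'' x := by
    simp only [disagreement_eq_sum_ite, ← Finset.sum_add_distrib]
    refine Finset.sum_congr rfl fun p _ => Finset.sum_congr rfl fun q _ => ?_
    by_cases h3 : k p < k q
    · simp only [hh, if_pos h3]
    · simp only [if_neg h3, add_zero]
  have h2 : (∑ p, ∑ q, if k' p < k' q then h p q else 0) = disagreement k' k'' x := by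
    simp only [disagreement_eq_sum_ite]
    refine Finset.sum_congr rfl fun p _ => Finset.sum_congr rfl fun q _ => ?_
    by_cases h3 : k' p < k' q
    · simp [hh, h3, h3.not_gt]
    · simp [h3]
  rw [h1, h2] at key
  rw [← key, ← add_assoc, CharTwo.add_self_eq_zero, zero_add]

theorem disagreement_symm (k k' : V → ℕ) (x : V → ZMod 2) :
    disagreement k k' x = disagreement k' k x := by
  rw [disagreement, Finset.sum_comm]
  refine Finset.sum_congr rfl fun p _ => Finset.sum_congr rfl fun q _ => ?_
  simp only [mul_comm, and_comm]

theorem disagreement_self (k : V → ℕ) (x : V → ZMod 2) : disagreement k k x = 0 :=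
  Finset.sum_eq_zero fun _ _ => Finset.sum_eq_zero fun _ _ => if_neg fun h => h.1.not_gt h.2

theorem disagreement_comp (k k' : V → ℕ) (ρ : Equiv.Perm V) (x : V → ZMod 2) :
    disagreement (fun v => k (ρ v)) (fun v => k' (ρ v)) x =
      disagreement k k' fun v => x (ρ.symm v) := by
  refine Fintype.sum_equiv ρ _ _ fun p => Fintype.sum_equiv ρ _ _ fun q => ?_
  simp

/-- The sign of the fermionic permutation `ρ` for the Jordan-Wigner order with key `k`. -/
def fermionicSign (k : V → ℕ) (ρ : Equiv.Perm V) (x : V → ZMod 2) : ZMod 2 :=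
  disagreement k (fun v => k (ρ v)) x

theorem fermionicSign_refl (k : V → ℕ) (x : V → ZMod 2) :
    fermionicSign k (Equiv.refl V) x = 0 := disagreement_self k x

/-- The cocycle rule is the triangle identity for the orders `k`, `k ∘ ρ` and `k ∘ ρ' ∘ ρ`, after
relabelling the second leg by `ρ`. -/
theorem fermionicSign_trans {k : V → ℕ} (hk : Function.Injective k) (ρ ρ' : Equiv.Perm V)
    (x : V → ZMod 2) : fermionicSign k (ρ.trans ρ') x =
      fermionicSign k ρ' (fun v => x (ρ.symm v)) + fermionicSign k ρ x := by
  unfold fermionicSign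
  rw [disagreement_triangle (k' := fun v => k (ρ v)) (k'' := fun v => k ((ρ.trans ρ') v)) hk
    (hk.comp ρ.injective) (hk.comp (ρ.trans ρ').injective), add_comm, ← disagreement_comp]
  rfl

/-- Conjugation by the sign of the disagreements changes the Jordan-Wigner order. -/
theorem fermionicSign_eq_of_order {k k' : V → ℕ} (hk : Function.Injective k)
    (hk' : Function.Injective k') (ρ : Equiv.Perm V) (x : V → ZMod 2) :
    fermionicSign k ρ x = disagreement k k' (fun v => x (ρ.symm v)) + fermionicSign k' ρ x +
      disagreement k k' x := by
  unfold fermionicSign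
  rw [disagreement_triangle (k' := k') (k'' := fun v => k (ρ v)) hk hk' (hk.comp ρ.injective),
    disagreement_triangle (k' := fun v => k' (ρ v)) (k'' := fun v => k (ρ v)) hk'
      (hk'.comp ρ.injective) (hk.comp ρ.injective), disagreement_comp, disagreement_symm k' k]
  ring

/-- No key lies between the consecutive values `k a` and `k b`, so `(a, b)` is the only inverted
pair. -/
theorem fermionicSign_swap [DecidableEq V] {k : V → ℕ} (hk : Function.Injective k) {a b : V}
    (hab : k b = k a + 1) (x : V → ZMod 2) :
    fermionicSign k (Equiv.swap a b) x = x a * x b := by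
  have hne : a ≠ b := by rintro rfl; omega
  unfold fermionicSign disagreement
  rw [Finset.sum_eq_single a, Finset.sum_eq_single b]
  · simp only [Equiv.swap_apply_left, Equiv.swap_apply_right]
    exact if_pos (by omega)
  · intro q _ hq
    refine if_neg ?_
    rintro ⟨h1, h2⟩
    simp only [Equiv.swap_apply_left] at h2
    by_cases hqa : q = a
    · subst hqa; omega
    · rw [Equiv.swap_apply_of_ne_of_ne hqa hq] at h2
      omega
  · simp
  · intro p _ hp
    refine Finset.sum_eq_zero fun q _ => if_neg ?_
    rintro ⟨h1, h2⟩
    dsimp only at h2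
    by_cases hpb : p = b
    · subst hpb
      rw [Equiv.swap_apply_right] at h2
      have hqa : q ≠ a := by rintro rfl; omega
      have hqb : q ≠ p := by rintro rfl; omega
      rw [Equiv.swap_apply_of_ne_of_ne hqa hqb] at h2
      omega
    · rw [Equiv.swap_apply_of_ne_of_ne hp hpb] at h2
      by_cases hqa : q = a
      · subst hqa
        rw [Equiv.swap_apply_left] at h2
        omega
      · by_cases hqb : q = b
        · subst hqb
          rw [Equiv.swap_apply_right] at h2
          have := hk.ne hp
          omega
        · rw [Equiv.swap_apply_of_ne_of_ne hqa hqb] at h2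
          omega
  · simp

end Disagreement

/-! ### Signed maps of bit strings as operators -/

/-- A bit as an element of `ZMod 2`. -/
def bit (b : Bool) : ZMod 2 := if b then 1 else 0

theorem bit_xor : ∀ a b : Bool, bit (xor a b) = bit a + bit b := by decide

theorem bit_and : ∀ a b : Bool, bit (a && b) = bit a * bit b := by decide

theorem bit_injective : Function.Injective bit := by
  intro a b; revert a b; decide

/-- Bits as elements of `ZMod 2`. -/
def bitEquiv : Bool ≃ ZMod 2 where
  toFun := bit
  invFun a := decide (a = 1)
  left_inv := by decide
  right_inv := by decide

/-- The sign `(-1)^a`. -/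
noncomputable def sgn (a : ZMod 2) : ℂ := if a = 0 then 1 else -1

theorem sgn_zero : sgn 0 = 1 := if_pos rfl

theorem sgn_add (a b : ZMod 2) : sgn (a + b) = sgn a * sgn b := by
  have h : ∀ a : ZMod 2, a = 0 ∨ a = 1 := by decide
  have h2 : (1 + 1 : ZMod 2) = 0 := by decide
  rcases h a with rfl | rfl <;> rcases h b with rfl | rfl <;> simp [sgn, h2]

theorem sgn_sum {ι : Type} (s : Finset ι) (f : ι → ZMod 2) :
    sgn (∑ i ∈ s, f i) = ∏ i ∈ s, sgn (f i) := by
  classical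
  induction s using Finset.induction_on with
  | empty => simp [sgn_zero]
  | insert i s hi ih => rw [Finset.sum_insert hi, Finset.prod_insert hi, sgn_add, ih]

theorem sgn_bit (b : Bool) : sgn (bit b) = if b then -1 else 1 := by
  cases b <;> simp [sgn, bit]

theorem sgn_ne_zero (a : ZMod 2) : sgn a ≠ 0 := by
  unfold sgn
  split_ifs <;> simp

/-- `M` maps the basis state with bits `x` to `(-1)^{φ x}` times the one with bits `f x`. -/
def IsSignedMap {Q V : Type} [Fintype Q] [DecidableEq Q] (e : Basis Q ≃ (V → ZMod 2)) (M : Operator Q)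
    (f : (V → ZMod 2) → V → ZMod 2) (φ : (V → ZMod 2) → ZMod 2) : Prop :=
  ∀ s t, M s t = if s = e.symm (f (e t)) then sgn (φ (e t)) else 0

theorem IsSignedMap.one {Q V : Type} [Fintype Q] [DecidableEq Q] (e : Basis Q ≃ (V → ZMod 2)) :
    IsSignedMap e 1 id 0 := by
  intro s t
  simp [Matrix.one_apply, sgn_zero]

theorem IsSignedMap.mul {Q V : Type} [Fintype Q] [DecidableEq Q] {e : Basis Q ≃ (V → ZMod 2)}
    {M M' : Operator Q} {f f' : (V → ZMod 2) → V → ZMod 2} {φ φ' : (V → ZMod 2) → ZMod 2}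
    (h : IsSignedMap e M f φ) (h' : IsSignedMap e M' f' φ') :
    IsSignedMap e (M * M') (fun x => f (f' x)) fun x => φ (f' x) + φ' x := by
  intro s t
  rw [Matrix.mul_apply, Finset.sum_eq_single (e.symm (f' (e t)))]
  · rw [h, h', if_pos rfl, e.apply_symm_apply, sgn_add, ite_mul, zero_mul]
  · intro u _ hu
    rw [h' u t, if_neg hu, mul_zero]
  · simp

theorem IsSignedMap.congr {Q V : Type} [Fintype Q] [DecidableEq Q] {e : Basis Q ≃ (V → ZMod 2)}
    {M : Operator Q} {f g : (V → ZMod 2) → V → ZMod 2} {φ ψ : (V → ZMod 2) → ZMod 2}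
    (h : IsSignedMap e M f φ) (hf : ∀ x v, f x v = g x v) (hφ : ∀ x, φ x = ψ x) :
    IsSignedMap e M g ψ := by
  obtain rfl : f = g := funext fun x => funext (hf x)
  obtain rfl : φ = ψ := funext hφ
  exact h

/-- The bits of the data qubits. -/
def dataBits (V : Type) : Basis V ≃ (V → ZMod 2) := Equiv.piCongrRight fun _ => bitEquiv

theorem dataBits_apply {V : Type} (s : Basis V) (v : V) : dataBits V s v = bit (s v) := rfl

/-- The inversions of `π` are the pairs of sites on which the order `jw` and its pullback along the
site permutation disagree. -/
theorem fermionicPermOn_isSignedMap {V : Type} [Fintype V] [DecidableEq V] {N : ℕ} (jw : V ≃ Fin N)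
    (π : Equiv.Perm (Fin N)) :
    IsSignedMap (dataBits V) (fermionicPermOn jw π)
      (fun x v => x ((sitePerm jw π).symm v))
      (fermionicSign (fun v => (jw v : ℕ)) (sitePerm jw π)) := by
  intro s t
  simp only [fermionicPermOn, fermionicPerm, Matrix.submatrix_apply, inversionPhase,
    Matrix.mul_diagonal, qubitPerm, Matrix.of_apply, ite_mul, one_mul, zero_mul]
  refine if_congr ?_ ?_ rfl
  · rw [Equiv.eq_symm_apply]
    constructor
    · intro h
      funext v
      have := congrFun h (jw v)
      simp only [Equiv.symm_apply_apply] at this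
      simp [dataBits_apply, this, sitePerm]
    · intro h
      funext j
      have := congrFun h (jw.symm j)
      exact bit_injective (by simpa [dataBits_apply, sitePerm] using this)
  · have h1 : ∀ p : Fin N × Fin N, (if t (jw.symm p.1) && t (jw.symm p.2) then (-1 : ℂ) else 1) =
        sgn (dataBits V t (jw.symm p.1) * dataBits V t (jw.symm p.2)) := fun p => by
      rw [dataBits_apply, dataBits_apply, ← bit_and, sgn_bit]
    simp only [h1]
    rw [← sgn_sum]
    congr 1
    unfold fermionicSign disagreement inversions
    rw [Finset.sum_filter, Fintype.sum_prod_type]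
    refine Fintype.sum_equiv jw.symm _ _ fun i => Fintype.sum_equiv jw.symm _ _ fun j => ?_
    simp [sitePerm]

theorem IsSignedMap.permutesBasis {V : Type} [Fintype V] [DecidableEq V] {F : Operator V} {ρ : Equiv.Perm V}
    {φ : (V → ZMod 2) → ZMod 2}
    (h : IsSignedMap (dataBits V) F (fun x v => x (ρ.symm v)) φ) : PermutesBasis F ρ := by
  intro s t
  rw [h]
  have : (dataBits V).symm (fun v => dataBits V t (ρ.symm v)) = fun v => t (ρ.symm v) := by
    rw [Equiv.symm_apply_eq]
    rfl
  rw [this]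
  simp [sgn_ne_zero]

/-! ### The action of the gates FSWAP, CNOT, CZ, Z on bit strings -/

section Gates

variable {V : Type} [DecidableEq V]

/-- The change of the bits `x` under a gate. -/
def Gate.delta : Gate V → (V → ZMod 2) → V → ZMod 2
  | .fswap a b, x, v => if v = a ∨ v = b then x a + x b else 0
  | .cnot a b, x, v => if v = b then x a else 0
  | .cz _ _, _, _ => 0
  | .z _, _, _ => 0

/-- The sign of a gate on the bits `x`. -/
def Gate.sign : Gate V → (V → ZMod 2) → ZMod 2
  | .fswap a b, x => x a * x b
  | .cnot _ _, _ => 0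
  | .cz a b, x => x a * x b
  | .z a, x => x a

/-- The qubits of a gate. -/
def Gate.qubits : Gate V → List V
  | .fswap a b => [a, b]
  | .cnot a b => [a, b]
  | .cz a b => [a, b]
  | .z a => [a]

/-- The two qubits of a two-qubit gate are adjacent in `G`. -/
def Gate.IsOn (G : SimpleGraph V) : Gate V → Prop
  | .fswap a b => G.Adj a b
  | .cnot a b => G.Adj a b
  | .cz a b => G.Adj a b
  | .z _ => True

/-- The gates of a time step act on pairwise disjoint sets of qubits, and the two-qubit gates
among them along edges of `G`. -/
def StepValid (G : SimpleGraph V) (step : List (Gate V)) : Prop :=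
  (∀ g ∈ step, g.IsOn G) ∧ step.Pairwise fun g h => g.qubits.Disjoint h.qubits

omit [DecidableEq V] in
theorem StepValid.tail {G : SimpleGraph V} {g : Gate V} {step : List (Gate V)}
    (h : StepValid G (g :: step)) : StepValid G step :=
  ⟨fun g' hg' => h.1 g' (by simp [hg']), (List.pairwise_cons.1 h.2).2⟩

omit [DecidableEq V] in
theorem Gate.sign_congr (g : Gate V) {x y : V → ZMod 2} (h : ∀ v ∈ g.qubits, x v = y v) :
    g.sign x = g.sign y := by
  cases g <;> simp_all [Gate.sign, Gate.qubits]

theorem Gate.delta_congr (g : Gate V) {x y : V → ZMod 2} (h : ∀ v ∈ g.qubits, x v = y v) :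
    g.delta x = g.delta y := by
  funext v
  cases g <;> simp_all [Gate.delta, Gate.qubits]

theorem Gate.delta_eq_zero (g : Gate V) (x : V → ZMod 2) {v : V} (h : v ∉ g.qubits) :
    g.delta x v = 0 := by
  cases g <;> simp_all [Gate.delta, Gate.qubits]

/-- The total change of the bits in a time step. -/
def stepDelta (step : List (Gate V)) (x : V → ZMod 2) (v : V) : ZMod 2 :=
  (step.map fun g => g.delta x v).sum

/-- The total sign of a time step. -/
def stepSign (step : List (Gate V)) (x : V → ZMod 2) : ZMod 2 :=
  (step.map fun g => g.sign x).sum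

theorem stepDelta_append (s s' : List (Gate V)) (x : V → ZMod 2) (v : V) :
    stepDelta (s ++ s') x v = stepDelta s x v + stepDelta s' x v := by
  simp [stepDelta]

omit [DecidableEq V] in
theorem stepSign_append (s s' : List (Gate V)) (x : V → ZMod 2) :
    stepSign (s ++ s') x = stepSign s x + stepSign s' x := by
  simp [stepSign]

theorem stepDelta_flatMap {α : Type} (l : List α) (f : α → List (Gate V)) (x : V → ZMod 2)
    (v : V) : stepDelta (l.flatMap f) x v = (l.map fun a => stepDelta (f a) x v).sum := by
  induction l with
  | nil => simp [stepDelta]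
  | cons a l ih => rw [List.flatMap_cons, stepDelta_append, ih, List.map_cons, List.sum_cons]

omit [DecidableEq V] in
theorem stepSign_flatMap {α : Type} (l : List α) (f : α → List (Gate V)) (x : V → ZMod 2) :
    stepSign (l.flatMap f) x = (l.map fun a => stepSign (f a) x).sum := by
  induction l with
  | nil => simp [stepSign]
  | cons a l ih => rw [List.flatMap_cons, stepSign_append, ih, List.map_cons, List.sum_cons]

theorem stepDelta_eq_zero (step : List (Gate V)) (x : V → ZMod 2) {v : V}
    (h : ∀ g ∈ step, v ∉ g.qubits) : stepDelta step x v = 0 := by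
  refine List.sum_eq_zero fun a ha => ?_
  obtain ⟨g, hg, rfl⟩ := List.mem_map.1 ha
  exact g.delta_eq_zero x (h g hg)

/-- The bits of the data qubits of a register without ancillas. -/
def registerBits (V : Type) : Basis (V ⊕ Fin 0) ≃ (V → ZMod 2) :=
  ((Equiv.sumEmpty V (Fin 0)).arrowCongr (Equiv.refl Bool)).trans (dataBits V)

omit [DecidableEq V] in
theorem registerBits_apply (s : Basis (V ⊕ Fin 0)) (v : V) :
    registerBits V s v = bit (s (Sum.inl v)) := rfl

variable [Fintype V]

/-- A common criterion for FSWAP, CNOT and CZ: `h` is the action on the two bits and `p` the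
exponent of the sign. -/
theorem isSignedMap_op {a b : V} {mat : Matrix (Bool × Bool) (Bool × Bool) ℂ}
    {h : Bool × Bool → Bool × Bool} {p : Bool × Bool → Bool}
    (hmat : ∀ x y, mat x y = if x = h y then sgn (bit (p y)) else 0)
    {f : (V → ZMod 2) → V → ZMod 2} {φ : (V → ZMod 2) → ZMod 2}
    (hfa : ∀ t : Basis (V ⊕ Fin 0), f (registerBits V t) a =
      bit (h (t (Sum.inl a), t (Sum.inl b))).1)
    (hfb : ∀ t : Basis (V ⊕ Fin 0), f (registerBits V t) b =
      bit (h (t (Sum.inl a), t (Sum.inl b))).2)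
    (hf : ∀ (t : Basis (V ⊕ Fin 0)) v, v ≠ a → v ≠ b → f (registerBits V t) v =
      bit (t (Sum.inl v)))
    (hφ : ∀ t : Basis (V ⊕ Fin 0), φ (registerBits V t) =
      bit (p (t (Sum.inl a), t (Sum.inl b)))) :
    IsSignedMap (registerBits V) (⟨Sum.inl a, Sum.inl b, mat⟩ : TwoQubitGate (V ⊕ Fin 0)).op
      f φ := by
  intro s t
  simp only [TwoQubitGate.op, Matrix.of_apply, hmat, hφ]
  rw [← ite_and]
  refine if_congr ?_ rfl rfl
  rw [Equiv.eq_symm_apply]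
  constructor
  · rintro ⟨h1, h2⟩
    funext v
    by_cases hva : v = a
    · subst hva
      rw [hfa, ← h2]
      rfl
    · by_cases hvb : v = b
      · subst hvb
        rw [hfb, ← h2]
        rfl
      · rw [hf t v hva hvb, registerBits_apply, h1] <;> simpa
  · intro hs
    refine ⟨fun q hqa hqb => ?_, Prod.ext ?_ ?_⟩
    · rcases q with v | q
      · apply bit_injective
        rw [← hf t v (by rintro rfl; exact hqa rfl) (by rintro rfl; exact hqb rfl), ← hs]
        rfl
      · exact q.elim0
    · apply bit_injective
      rw [← hfa, ← hs]
      rfl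
    · apply bit_injective
      rw [← hfb, ← hs]
      rfl

theorem isSignedMap_fswap {a b : V} : IsSignedMap (registerBits V)
    (⟨Sum.inl a, Sum.inl b, fswapMat⟩ : TwoQubitGate (V ⊕ Fin 0)).op
    (fun x => x + (Gate.fswap a b).delta x) (Gate.fswap a b).sign := by
  have h2 : ∀ u v : ZMod 2, u + (u + v) = v ∧ v + (u + v) = u := by decide
  refine isSignedMap_op (h := fun y => (y.2, y.1)) (p := fun y => y.1 && y.2) (fun x y => ?_)
    (fun t => ?_) (fun t => ?_) (fun t v h1 h2 => ?_) fun t => ?_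
  · simp only [fswapMat, Matrix.of_apply, sgn_bit]
  · simp [Gate.delta, registerBits_apply, h2]
  · simp [Gate.delta, registerBits_apply, h2]
  · simp [Gate.delta, registerBits_apply, h1, h2]
  · simp [Gate.sign, registerBits_apply, bit_and]

theorem isSignedMap_cnot {a b : V} (hab : a ≠ b) : IsSignedMap (registerBits V)
    (⟨Sum.inl a, Sum.inl b, cnotMat⟩ : TwoQubitGate (V ⊕ Fin 0)).op
    (fun x => x + (Gate.cnot a b).delta x) (Gate.cnot a b).sign := by
  refine isSignedMap_op (h := fun y => (y.1, xor y.1 y.2)) (p := fun _ => false) (fun x y => ?_)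
    (fun t => ?_) (fun t => ?_) (fun t v h1 h2 => ?_) fun t => ?_
  · simp [cnotMat, Matrix.of_apply, sgn_bit]
  · simp [Gate.delta, registerBits_apply, hab]
  · simp [Gate.delta, registerBits_apply, bit_xor, add_comm]
  · simp [Gate.delta, registerBits_apply, h2]
  · simp [Gate.sign, bit]

theorem isSignedMap_cz {a b : V} : IsSignedMap (registerBits V)
    (⟨Sum.inl a, Sum.inl b, czMat⟩ : TwoQubitGate (V ⊕ Fin 0)).op
    (fun x => x + (Gate.cz a b).delta x) (Gate.cz a b).sign := by
  refine isSignedMap_op (h := id) (p := fun y => y.1 && y.2) (fun x y => ?_)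
    (fun t => ?_) (fun t => ?_) (fun t v h1 h2 => ?_) fun t => ?_
  · by_cases h : x = y
    · subst h
      simp [czMat, sgn_bit]
    · simp [czMat, h]
  all_goals simp [Gate.delta, Gate.sign, registerBits_apply, bit_and]

theorem isSignedMap_z (a : V) : IsSignedMap (registerBits V) (zOp (Sum.inl a)) id
    fun x => x a := by
  intro s t
  change _ = if s = (registerBits V).symm (registerBits V t) then sgn (bit (t (Sum.inl a))) else 0
  rw [Equiv.symm_apply_apply, sgn_bit]
  by_cases h : s = t
  · subst h
    simp [zOp]
  · simp [zOp, h]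

/-! ### The action of a time step -/

/-- The operator of a time step. -/
noncomputable def stepOp (step : List (Gate V)) : Operator (V ⊕ Fin 0) :=
  ((zSites step).reverse.map fun v => zOp (Sum.inl v)).prod * layerOp (twoQubitGates step)

theorem isSignedMap_zOps (vs : List V) : IsSignedMap (registerBits V)
    (vs.reverse.map fun v => zOp (Sum.inl v)).prod id fun x => (vs.map x).sum := by
  induction vs with
  | nil => exact (IsSignedMap.one (registerBits V)).congr (fun _ _ => rfl) fun _ => rfl
  | cons v vs ih =>
    rw [List.reverse_cons, List.map_append, List.prod_append, List.map_singleton,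
      List.prod_singleton]
    exact (ih.mul (isSignedMap_z v)).congr (fun _ _ => rfl) fun x => by simp [add_comm]

/-- The sign of a gate if it is a two-qubit gate. -/
def Gate.twoQubitSign : Gate V → (V → ZMod 2) → ZMod 2
  | .z _, _ => 0
  | .fswap a b, x => x a * x b
  | .cnot _ _, _ => 0
  | .cz a b, x => x a * x b

/-- The sign of the two-qubit gates of a time step. -/
def twoQubitSign (step : List (Gate V)) (x : V → ZMod 2) : ZMod 2 :=
  (step.map fun g => g.twoQubitSign x).sum

omit [DecidableEq V] [Fintype V] in
theorem stepSign_eq (step : List (Gate V)) (x : V → ZMod 2) :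
    stepSign step x = ((zSites step).map x).sum + twoQubitSign step x := by
  induction step with
  | nil => simp [stepSign, zSites, twoQubitSign]
  | cons g step ih =>
    have h1 : stepSign (g :: step) x = g.sign x + stepSign step x := by simp [stepSign]
    have h2 : twoQubitSign (g :: step) x = g.twoQubitSign x + twoQubitSign step x := by
      simp [twoQubitSign]
    have h3 : ∀ a, zSites (Gate.z a :: step) = a :: zSites step := fun _ => rfl
    have h4 : ∀ a b, zSites (Gate.fswap a b :: step) = zSites step := fun _ _ => rfl
    have h5 : ∀ a b, zSites (Gate.cnot a b :: step) = zSites step := fun _ _ => rfl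
    have h6 : ∀ a b, zSites (Gate.cz a b :: step) = zSites step := fun _ _ => rfl
    rw [h1, h2, ih]
    cases g <;> simp only [h3, h4, h5, h6, Gate.sign, Gate.twoQubitSign, List.map_cons,
      List.sum_cons] <;> ring

/-- The other gates of the step leave the qubits of `g` untouched, so `g` can be evaluated on the
bits at the start of the step, and the changes add up. -/
theorem isSignedMap_cons {g : Gate V} {step : List (Gate V)} {M M' : Operator (V ⊕ Fin 0)}
    (hdis : ∀ h ∈ step, g.qubits.Disjoint h.qubits)
    (hM : IsSignedMap (registerBits V) M (fun x => x + g.delta x) g.sign)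
    {φ : (V → ZMod 2) → ZMod 2}
    (hM' : IsSignedMap (registerBits V) M' (fun x => x + stepDelta step x) φ) :
    IsSignedMap (registerBits V) (M * M') (fun x => x + stepDelta (g :: step) x)
      fun x => g.sign x + φ x := by
  have hagree : ∀ x : V → ZMod 2, ∀ v ∈ g.qubits, (x + stepDelta step x) v = x v := by
    intro x v hv
    rw [Pi.add_apply, stepDelta_eq_zero step x fun h hh hvh => hdis h hh hv hvh, add_zero]
  refine (hM.mul hM').congr (fun x v => ?_) fun x => ?_
  · rw [g.delta_congr (hagree x)]
    simp only [stepDelta, Pi.add_apply, List.map_cons, List.sum_cons]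
    ring
  · rw [g.sign_congr (hagree x)]

theorem isSignedMap_layerOp {G : SimpleGraph V} {step : List (Gate V)} (h : StepValid G step) :
    IsSignedMap (registerBits V) (layerOp (twoQubitGates step)) (fun x => x + stepDelta step x)
      (twoQubitSign step) := by
  induction step with
  | nil =>
    refine (IsSignedMap.one (registerBits V)).congr (fun x v => ?_) fun _ => rfl
    simp [stepDelta]
  | cons g step ih =>
    have hdis := (List.pairwise_cons.1 h.2).1
    have ih := ih h.tail
    have hg := h.1 g (by simp)
    cases g with
    | fswap a b =>
      exact (isSignedMap_cons hdis isSignedMap_fswap ih).congr (fun _ _ => rfl) fun x => by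
        simp [twoQubitSign, Gate.twoQubitSign, Gate.sign]
    | cnot a b =>
      exact (isSignedMap_cons hdis (isSignedMap_cnot hg.ne) ih).congr (fun _ _ => rfl) fun x => by
        simp [twoQubitSign, Gate.twoQubitSign, Gate.sign]
    | cz a b =>
      exact (isSignedMap_cons hdis isSignedMap_cz ih).congr (fun _ _ => rfl) fun x => by
        simp [twoQubitSign, Gate.twoQubitSign, Gate.sign]
    | z a =>
      refine IsSignedMap.congr ih (fun x v => ?_) fun x => ?_
      · simp [stepDelta, Gate.delta]
      · simp [twoQubitSign, Gate.twoQubitSign]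

theorem isSignedMap_stepOp {G : SimpleGraph V} {step : List (Gate V)} (h : StepValid G step) :
    IsSignedMap (registerBits V) (stepOp step) (fun x => x + stepDelta step x)
      (stepSign step) := by
  -- A qubit with a `Z` is changed by no other gate of the step, so a `Z` applied after the layer
  -- still reads the old bit.
  have hz : ∀ x : V → ZMod 2,
      (zSites step).map (x + stepDelta step x) = (zSites step).map x := by
    intro x
    refine List.map_congr_left fun v hv => ?_
    obtain ⟨g, hg, hgv⟩ := List.mem_filterMap.1 hv
    rw [Pi.add_apply, add_eq_left]
    have hgz : g = .z v := by cases g <;> simp_all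
    subst hgz
    refine List.sum_eq_zero fun a ha => ?_
    obtain ⟨g', hg', rfl⟩ := List.mem_map.1 ha
    by_cases hgg : g' = .z v
    · subst hgg
      rfl
    · have hsymm : Std.Symm fun g h : Gate V => g.qubits.Disjoint h.qubits :=
        ⟨fun _ _ h => h.symm⟩
      have := h.2.forall hg hg' (Ne.symm hgg)
      exact g'.delta_eq_zero x fun hv' => this (by simp [Gate.qubits]) hv'
  refine ((isSignedMap_zOps (zSites step)).mul (isSignedMap_layerOp h)).congr
    (fun _ _ => rfl) fun x => ?_
  rw [stepSign_eq, hz]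

/-! ### Circuits as protocols -/

theorem kraus_toProtocol_cons (step : List (Gate V)) (C : Circuit V) :
    (Circuit.toProtocol (step :: C)).kraus =
      (Circuit.toProtocol C).kraus.map fun M => M * stepOp step := by
  have : ∀ (vs : List V) (P : Protocol V (V ⊕ Fin 0)),
      (vs.foldr (fun v P => Protocol.measure v 1 (fun _ => zOp (Sum.inl v)) fun _ => P) P).kraus =
        P.kraus.map fun M => M * (vs.reverse.map fun v => zOp (Sum.inl v)).prod := by
    intro vs P
    induction vs with
    | nil => simp
    | cons v vs ih =>
      rw [List.foldr_cons, Protocol.kraus, ih]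
      simp [List.finRange_succ]
  simp [Circuit.toProtocol, Protocol.kraus, this, stepOp, mul_assoc, List.map_map,
    Function.comp_def]

/-- The circuit `C` maps the bits `x` to `f x`, with the sign `φ x`. -/
def Computes (C : Circuit V) (f : (V → ZMod 2) → V → ZMod 2) (φ : (V → ZMod 2) → ZMod 2) :
    Prop :=
  ∃ M, (Circuit.toProtocol C).kraus = [M] ∧ IsSignedMap (registerBits V) M f φ

theorem Computes.nil : Computes ([] : Circuit V) id 0 :=
  ⟨1, rfl, IsSignedMap.one _⟩

theorem Computes.cons {step : List (Gate V)} {C : Circuit V} {f g : (V → ZMod 2) → V → ZMod 2}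
    {φ ψ : (V → ZMod 2) → ZMod 2} (hs : IsSignedMap (registerBits V) (stepOp step) f φ)
    (hC : Computes C g ψ) :
    Computes (step :: C) (fun x => g (f x)) fun x => ψ (f x) + φ x := by
  obtain ⟨M, hM, hM'⟩ := hC
  exact ⟨M * stepOp step, by rw [kraus_toProtocol_cons, hM]; rfl, hM'.mul hs⟩

theorem Computes.append {C D : Circuit V} {f g : (V → ZMod 2) → V → ZMod 2}
    {φ ψ : (V → ZMod 2) → ZMod 2} (hC : Computes C f φ) (hD : Computes D g ψ) :
    Computes (C ++ D) (fun x => g (f x)) fun x => ψ (f x) + φ x := by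
  have key : ∀ (C : Circuit V), ∃ N, (Circuit.toProtocol C).kraus = [N] ∧ ∀ M,
      (Circuit.toProtocol D).kraus = [M] → (Circuit.toProtocol (C ++ D)).kraus = [M * N] := by
    intro C
    induction C with
    | nil => exact ⟨1, rfl, fun M hM => by simpa using hM⟩
    | cons s C ih =>
      obtain ⟨N, hN, h⟩ := ih
      refine ⟨N * stepOp s, by rw [kraus_toProtocol_cons, hN]; rfl, fun M hM => ?_⟩
      rw [List.cons_append, kraus_toProtocol_cons, h M hM, List.map_singleton, mul_assoc]
  obtain ⟨N, hN, hN'⟩ := hC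
  obtain ⟨M, hM, hM'⟩ := hD
  obtain ⟨N', h1, h2⟩ := key C
  obtain rfl : N' = N := by simpa [hN] using h1.symm
  exact ⟨M * N', h2 M hM, hM'.mul hN'⟩

theorem Computes.congr {C : Circuit V} {f g : (V → ZMod 2) → V → ZMod 2}
    {φ ψ : (V → ZMod 2) → ZMod 2} (h : Computes C f φ) (hf : ∀ x, f x = g x)
    (hφ : ∀ x, φ x = ψ x) : Computes C g ψ := by
  obtain rfl : f = g := funext hf
  obtain rfl : φ = ψ := funext hφ
  exact h

theorem Computes.implements {C : Circuit V} {f : (V → ZMod 2) → V → ZMod 2}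
    {φ : (V → ZMod 2) → ZMod 2} (hC : Computes C f φ) {F : Operator V}
    (hF : IsSignedMap (dataBits V) F f φ) : Implements (Circuit.toProtocol C) F := by
  obtain ⟨M, hM, hM'⟩ := hC
  intro M₁ hM₁ ψ
  obtain rfl : M₁ = M := by simpa [hM] using hM₁
  -- The empty ancilla register has a single basis state.
  refine ⟨fun _ => 1, ?_⟩
  have hzero : ∀ a : Basis (Fin 0), zeroState 0 a = 1 := fun a =>
    if_pos (funext fun i => i.elim0)
  let e : Basis (V ⊕ Fin 0) ≃ Basis V :=
    (Equiv.sumEmpty V (Fin 0)).arrowCongr (Equiv.refl Bool)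
  funext s
  simp only [Matrix.mulVec, dotProduct, tensor, hzero, mul_one]
  refine Fintype.sum_equiv e _ _ fun t => ?_
  rw [hM' s t]
  have : F (fun v => s (Sum.inl v)) (e t) =
      if e s = (dataBits V).symm (f (dataBits V (e t))) then sgn (φ (dataBits V (e t))) else 0 :=
    hF _ _
  rw [this]
  congr 1
  refine if_congr ?_ rfl rfl
  rw [Equiv.eq_symm_apply, Equiv.eq_symm_apply]
  rfl

/-! ### Validity, depth and gate count of circuits. -/

theorem fswapMat_mem_unitaryGroup : fswapMat ∈ Matrix.unitaryGroup (Bool × Bool) ℂ := by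
  rw [Matrix.mem_unitaryGroup_iff]
  ext ⟨a, b⟩ ⟨c, d⟩
  cases a <;> cases b <;> cases c <;> cases d <;>
    simp [fswapMat, Matrix.mul_apply, Fintype.sum_prod_type, Matrix.star_apply]

theorem cnotMat_mem_unitaryGroup : cnotMat ∈ Matrix.unitaryGroup (Bool × Bool) ℂ := by
  rw [Matrix.mem_unitaryGroup_iff]
  ext ⟨a, b⟩ ⟨c, d⟩
  cases a <;> cases b <;> cases c <;> cases d <;>
    simp [cnotMat, Matrix.mul_apply, Fintype.sum_prod_type, Matrix.star_apply]

theorem czMat_mem_unitaryGroup : czMat ∈ Matrix.unitaryGroup (Bool × Bool) ℂ := by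
  rw [Matrix.mem_unitaryGroup_iff]
  ext ⟨a, b⟩ ⟨c, d⟩
  cases a <;> cases b <;> cases c <;> cases d <;>
    simp [czMat, Matrix.mul_apply, Matrix.star_apply,
      Matrix.diagonal_apply]

theorem actsAt_zOp (v : V) :
    ActsAt (siteOf (Fin.elim0 : Fin 0 → V)) v (zOp (Sum.inl v) : Operator (V ⊕ Fin 0)) := by
  refine ⟨Matrix.diagonal fun s => if s ⟨Sum.inl v, rfl⟩ then -1 else 1, fun s t => ?_⟩
  by_cases h : s = t
  · subst h
    simp [zOp]
  · rw [zOp, Matrix.diagonal_apply_ne _ h]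
    split_ifs with h1
    · rw [Matrix.diagonal_apply_ne]
      intro h2
      refine h (funext fun q => ?_)
      by_cases hq : siteOf (Fin.elim0 : Fin 0 → V) q = v
      · exact congrFun h2 ⟨q, hq⟩
      · exact h1 q hq
    · rfl

theorem zOp_conjTranspose_mul_self {Q : Type} [Fintype Q] [DecidableEq Q] (q : Q) :
    (zOp q)ᴴ * zOp q = 1 := by
  rw [zOp, Matrix.diagonal_conjTranspose, Matrix.diagonal_mul_diagonal, ← Matrix.diagonal_one]
  congr 1
  funext s
  by_cases h : s q <;> simp [h]

omit [Fintype V] in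
theorem pairwise_disjoint_twoQubitGates {G : SimpleGraph V} {step : List (Gate V)}
    (h : StepValid G step) : (twoQubitGates step).Pairwise TwoQubitGate.Disjoint := by
  refine List.Pairwise.filterMap _ (fun g g' hd a ha b hb => ?_) h.2
  have hd := hd.symm
  cases g <;> cases g' <;> simp only [Option.some.injEq, reduceCtorEq] at ha hb <;>
    subst ha hb <;> simp_all [Gate.qubits, TwoQubitGate.Disjoint]

theorem Circuit.toProtocol_valid {G : SimpleGraph V} (C : Circuit V)
    (hC : ∀ step ∈ C, StepValid G step) :
    (Circuit.toProtocol C).Valid G (siteOf (Fin.elim0 : Fin 0 → V)) := by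
  induction C with
  | nil => trivial
  | cons step C ih =>
    have hs := hC step (by simp)
    refine ⟨fun g hg => ?_, pairwise_disjoint_twoQubitGates hs, ?_⟩
    · obtain ⟨g', hg', h⟩ := List.mem_filterMap.1 hg
      have hon := hs.1 g' hg'
      cases g' <;> simp only [Option.some.injEq, reduceCtorEq] at h <;> subst h
      · exact ⟨hon, fswapMat_mem_unitaryGroup⟩
      · exact ⟨hon, cnotMat_mem_unitaryGroup⟩
      · exact ⟨hon, czMat_mem_unitaryGroup⟩
    · have ih := ih fun s hs => hC s (by simp [hs])
      induction zSites step with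
      | nil => exact ih
      | cons v vs ih' =>
        exact ⟨fun _ => actsAt_zOp v, by simp [zOp_conjTranspose_mul_self], fun _ => ih'⟩

theorem Circuit.toProtocol_measurementFree (C : Circuit V) :
    (Circuit.toProtocol C).MeasurementFree := by
  induction C with
  | nil => trivial
  | cons step C ih =>
    change Protocol.MeasurementFree (List.foldr _ _ _)
    induction zSites step with
    | nil => exact ih
    | cons v vs ih' => exact ⟨rfl, fun _ => ih'⟩

theorem Circuit.depth_toProtocol (C : Circuit V) : (Circuit.toProtocol C).depth = C.length := by
  induction C with
  | nil => rfl
  | cons step C ih =>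
    rw [List.length_cons, ← ih]
    change Protocol.depth (List.foldr _ _ _) + 1 = _
    congr 1
    induction zSites step with
    | nil => rfl
    | cons v vs ih' => simpa [Protocol.depth] using ih'

theorem Circuit.gateCount_toProtocol_le {G : SimpleGraph V} (C : Circuit V)
    (hC : ∀ step ∈ C, StepValid G step) :
    (Circuit.toProtocol C).gateCount ≤ C.length * Fintype.card V := by
  induction C with
  | nil => simp [Circuit.toProtocol, Protocol.gateCount]
  | cons step C ih =>
    have ih := ih fun s hs => hC s (by simp [hs])
    have h1 := length_le_card_of_pairwise_disjoint
      (pairwise_disjoint_twoQubitGates (hC step (by simp)))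
    rw [Fintype.card_sum, Fintype.card_fin, add_zero] at h1
    have h2 : ∀ vs : List V, (vs.foldr (fun v P => Protocol.measure v 1
        (fun _ => zOp (Sum.inl v)) fun _ => P) (Circuit.toProtocol C)).gateCount =
          (Circuit.toProtocol C).gateCount := by
      intro vs
      induction vs with
      | nil => rfl
      | cons v vs ih' => simpa [Protocol.gateCount] using ih'
    rw [Circuit.toProtocol, Protocol.gateCount, h2, List.length_cons, add_mul, one_mul]
    exact Nat.add_le_add ih h1

end Gates

/-! ### Layers of FSWAP gates on neighbours in the Jordan-Wigner order -/

section SwapLayers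

variable {V : Type} [DecidableEq V]

/-- The permutation of the qubits by a gate. -/
def Gate.perm : Gate V → Equiv.Perm V
  | .fswap a b => Equiv.swap a b
  | _ => 1

theorem Gate.perm_apply_of_notMem (g : Gate V) {v : V} (h : v ∉ g.qubits) : g.perm v = v := by
  cases g with
  | fswap a b =>
    simp only [Gate.qubits, List.mem_cons, List.not_mem_nil, or_false, not_or] at h
    exact Equiv.swap_apply_of_ne_of_ne h.1 h.2
  | _ => rfl

/-- The permutation of the qubits by a time step. -/
def stepPerm (step : List (Gate V)) : Equiv.Perm V := (step.map Gate.perm).prod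

theorem stepPerm_apply_of_notMem {step : List (Gate V)} {v : V}
    (h : ∀ g ∈ step, v ∉ g.qubits) : stepPerm step v = v := by
  induction step with
  | nil => rfl
  | cons g step ih =>
    change g.perm (stepPerm step v) = v
    rw [ih fun g' hg' => h g' (by simp [hg']), g.perm_apply_of_notMem (h g (by simp))]

theorem stepPerm_apply_of_mem {step : List (Gate V)}
    (h : step.Pairwise fun g h => g.qubits.Disjoint h.qubits) {a b : V}
    (hab : Gate.fswap a b ∈ step) : stepPerm step a = b ∧ stepPerm step b = a := by
  induction step with
  | nil => simp at hab
  | cons g step ih =>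
    obtain ⟨h1, h2⟩ := List.pairwise_cons.1 h
    change g.perm (stepPerm step a) = b ∧ g.perm (stepPerm step b) = a
    rcases List.mem_cons.1 hab with rfl | hmem
    · rw [stepPerm_apply_of_notMem fun g hg hv => h1 g hg (by simp [Gate.qubits]) hv,
        stepPerm_apply_of_notMem fun g hg hv => h1 g hg (by simp [Gate.qubits]) hv]
      exact ⟨Equiv.swap_apply_left a b, Equiv.swap_apply_right a b⟩
    · rw [(ih h2 hmem).1, (ih h2 hmem).2]
      exact ⟨g.perm_apply_of_notMem fun hv => h1 _ hmem hv (by simp [Gate.qubits]),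
        g.perm_apply_of_notMem fun hv => h1 _ hmem hv (by simp [Gate.qubits])⟩

/-- An FSWAP on neighbours in the order `k` is the fermionic transposition for `k`; the cocycle rule
composes them. -/
theorem computes_singleton_of_swaps [Fintype V] {k : V → ℕ} (hk : Function.Injective k)
    {step : List (Gate V)}
    (h : ∀ g ∈ step, ∃ a b, g = .fswap a b ∧ (k b = k a + 1 ∨ k a = k b + 1)) :
    Computes [step] (fun x v => x ((stepPerm step).symm v)) (fermionicSign k (stepPerm step)) := by
  have hz : zSites step = [] := by
    refine List.filterMap_eq_nil_iff.2 fun g hg => ?_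
    obtain ⟨a, b, rfl, -⟩ := h g hg
    rfl
  have hlayer : IsSignedMap (registerBits V) (layerOp (twoQubitGates step))
      (fun x v => x ((stepPerm step).symm v)) (fermionicSign k (stepPerm step)) := by
    clear hz
    induction step with
    | nil =>
      exact (IsSignedMap.one (registerBits V)).congr (fun _ _ => rfl)
        fun x => (fermionicSign_refl k x).symm
    | cons g step ih =>
      obtain ⟨a, b, rfl, hab⟩ := h g (by simp)
      have ih := ih fun g' hg' => h g' (by simp [hg'])
      refine (isSignedMap_fswap.mul ih).congr (fun x v => ?_) fun x => ?_
      · change x _ + (if v = a ∨ v = b then x _ + x _ else 0) =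
          x ((stepPerm step).symm ((Equiv.swap a b).symm v))
        rw [Equiv.symm_swap]
        have h2 : ∀ u v : ZMod 2, u + (u + v) = v ∧ v + (u + v) = u := by decide
        by_cases hva : v = a
        · subst hva
          rw [if_pos (Or.inl rfl), Equiv.swap_apply_left, (h2 _ _).1]
        · by_cases hvb : v = b
          · subst hvb
            rw [if_pos (Or.inr rfl), Equiv.swap_apply_right, (h2 _ _).2]
          · rw [if_neg (by tauto), Equiv.swap_apply_of_ne_of_ne hva hvb, add_zero]
      · have hperm : stepPerm (Gate.fswap a b :: step) =
            (stepPerm step).trans (Equiv.swap a b) := rfl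
        rw [hperm, fermionicSign_trans hk]
        congr 1
        rcases hab with hab | hab
        · rw [fermionicSign_swap hk hab]
          rfl
        · rw [Equiv.swap_comm, fermionicSign_swap hk hab, mul_comm]
          rfl
  refine (Computes.cons (C := []) (step := step) ?_ Computes.nil).congr (fun _ => rfl)
    fun x => zero_add _
  rw [stepOp, hz]
  simpa using hlayer

end SwapLayers

/-! ### Odd-even transposition along parallel lines of the grid -/

section Lines

variable {L : ℕ}

/-- One round of odd-even transposition along the lines given by `P`. -/
def lineStep (P : Fin L × Fin L ≃ Site L) (dest : Fin L → ℕ → ℕ) (t : ℕ) :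
    List (Gate (Site L)) :=
  (List.finRange L).flatMap fun l : Fin L => (List.finRange L).flatMap fun c : Fin L =>
    if h : (c : ℕ) + 1 < L then
      if oetSwaps L t (oetState L (dest l) t) c then
        [Gate.fswap (P (l, c)) (P (l, ⟨(c : ℕ) + 1, h⟩))] else []
    else []

theorem rowStage_eq (σ : Equiv.Perm (Site L)) :
    rowStage σ = (List.range L).map (lineStep (Equiv.refl _) (rowDest σ)) := rfl

theorem colStage_eq (σ : Equiv.Perm (Site L)) :
    colStage σ = (List.range L).map (lineStep (Equiv.prodComm _ _) (colDest σ)) := rfl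

variable {P : Fin L × Fin L ≃ Site L} {dest : Fin L → ℕ → ℕ} {t : ℕ}

theorem mem_lineStep {g : Gate (Site L)} : g ∈ lineStep P dest t ↔
    ∃ (l c : Fin L) (h : (c : ℕ) + 1 < L), oetSwaps L t (oetState L (dest l) t) c = true ∧
      g = .fswap (P (l, c)) (P (l, ⟨(c : ℕ) + 1, h⟩)) := by
  simp only [lineStep, List.mem_flatMap, List.mem_finRange, true_and]
  refine exists_congr fun l => exists_congr fun c => ?_
  split_ifs with h1 h2 <;> simp_all

theorem lineStep_valid
    (hadj : ∀ (l c : Fin L) (h : (c : ℕ) + 1 < L),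
      (grid L).Adj (P (l, c)) (P (l, ⟨(c : ℕ) + 1, h⟩))) :
    StepValid (grid L) (lineStep P dest t) := by
  refine ⟨fun g hg => ?_, ?_⟩
  · obtain ⟨l, c, h, -, rfl⟩ := mem_lineStep.1 hg
    exact hadj l c h
  · have hpar : ∀ (l c : Fin L), ∀ g ∈ (if h : (c : ℕ) + 1 < L then
        if oetSwaps L t (oetState L (dest l) t) c then
          [Gate.fswap (P (l, c)) (P (l, ⟨(c : ℕ) + 1, h⟩))] else [] else []),
        (c : ℕ) % 2 = t % 2 ∧ ∃ h, g = Gate.fswap (P (l, c)) (P (l, ⟨(c : ℕ) + 1, h⟩)) := by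
      intro l c g hg
      split_ifs at hg with h1 h2
      · simp only [oetSwaps, decide_eq_true_eq] at h2
        exact ⟨h2.1, h1, by simpa using hg⟩
      · simp at hg
      · simp at hg
    refine List.pairwise_flatMap.2 ⟨fun l _ => List.pairwise_flatMap.2 ⟨fun c _ => ?_, ?_⟩, ?_⟩
    · split_ifs <;> simp
    · refine (List.nodup_finRange L).imp fun {c c'} hne g hg g' hg' => ?_
      obtain ⟨h1, h2, rfl⟩ := hpar _ _ _ hg
      obtain ⟨h3, h4, rfl⟩ := hpar _ _ _ hg'
      have hne' : (c : ℕ) ≠ c' := fun h => hne (Fin.ext h)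
      simp only [Gate.qubits, List.disjoint_cons_left, List.mem_cons, P.injective.eq_iff,
        Prod.mk.injEq, true_and, List.not_mem_nil, or_false, Fin.ext_iff, List.disjoint_nil_left,
        and_true, not_or]
      omega
    · refine (List.nodup_finRange L).imp fun {l l'} hne g hg g' hg' => ?_
      obtain ⟨c, -, hg⟩ := List.mem_flatMap.1 hg
      obtain ⟨c', -, hg'⟩ := List.mem_flatMap.1 hg'
      obtain ⟨h1, h2, rfl⟩ := hpar _ _ _ hg
      obtain ⟨h3, h4, rfl⟩ := hpar _ _ _ hg'
      simp [Gate.qubits, hne.symm]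

/-- The destination of the token at `v` after `t` rounds. -/
def lineState (P : Fin L × Fin L ≃ Site L) (dest : Fin L → ℕ → ℕ) (t : ℕ) (v : Site L) : ℕ :=
  oetState L (dest (P.symm v).1) t (P.symm v).2

/-- Destination labels travel with the qubits: a token that is exchanged to the right, exchanged to
the left, or left alone finds its label at its new place. -/
theorem lineState_stepPerm
    (hadj : ∀ (l c : Fin L) (h : (c : ℕ) + 1 < L),
      (grid L).Adj (P (l, c)) (P (l, ⟨(c : ℕ) + 1, h⟩))) (v : Site L) :
    lineState P dest (t + 1) (stepPerm (lineStep P dest t) v) = lineState P dest t v ∧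
      (P.symm (stepPerm (lineStep P dest t) v)).1 = (P.symm v).1 := by
  obtain ⟨⟨l, c⟩, rfl⟩ := P.surjective v
  have hpw := (lineStep_valid (dest := dest) (t := t) hadj).2
  by_cases h1 : oetSwaps L t (oetState L (dest l) t) c = true
  · have h2 := h1
    simp only [oetSwaps, decide_eq_true_eq] at h2
    have := (stepPerm_apply_of_mem hpw (mem_lineStep.2 ⟨l, c, h2.2.1, h1, rfl⟩)).1
    rw [this]
    simp only [lineState, Equiv.symm_apply_apply, and_true]
    rw [oetState_succ_right _ h2.1 h2.2.1, max_eq_left h2.2.2.le]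
  · by_cases h2 : 1 ≤ (c : ℕ) ∧ oetSwaps L t (oetState L (dest l) t) ((c : ℕ) - 1) = true
    · obtain ⟨h2, h3⟩ := h2
      have h4 := h3
      simp only [oetSwaps, decide_eq_true_eq] at h4
      have := (stepPerm_apply_of_mem hpw (mem_lineStep.2
        ⟨l, ⟨(c : ℕ) - 1, by omega⟩, h4.2.1, h3, rfl⟩)).2
      have hc : (⟨(c : ℕ) - 1 + 1, h4.2.1⟩ : Fin L) = c := Fin.ext (Nat.sub_add_cancel h2)
      rw [hc] at this
      rw [this]
      simp only [lineState, Equiv.symm_apply_apply, and_true]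
      rw [oetState_succ_left _ h4.1 h4.2.1, min_eq_right h4.2.2.le, Nat.sub_add_cancel h2]
    · rw [stepPerm_apply_of_notMem]
      · simp only [lineState, Equiv.symm_apply_apply, and_true]
        rw [oetState, if_neg h1, if_neg h2]
      · intro g hg hv
        obtain ⟨l', c', h, h3, rfl⟩ := mem_lineStep.1 hg
        simp only [Gate.qubits, List.mem_cons, P.injective.eq_iff, Prod.mk.injEq,
          List.not_mem_nil, or_false] at hv
        rcases hv with ⟨rfl, rfl⟩ | ⟨rfl, rfl⟩
        · exact h1 h3
        · exact h2 ⟨by simp, by simpa using h3⟩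

/-- The labels are invariant under the accumulated permutation `ρ`, and after `L` rounds each line
is sorted, so `ρ` has carried every qubit to its destination. -/
theorem computes_lineStage {k : Site L → ℕ} (hk : Function.Injective k)
    (hadj : ∀ (l c : Fin L) (h : (c : ℕ) + 1 < L),
      (grid L).Adj (P (l, c)) (P (l, ⟨(c : ℕ) + 1, h⟩)))
    (hkey : ∀ (l c : Fin L) (h : (c : ℕ) + 1 < L),
      k (P (l, ⟨(c : ℕ) + 1, h⟩)) = k (P (l, c)) + 1 ∨
        k (P (l, c)) = k (P (l, ⟨(c : ℕ) + 1, h⟩)) + 1)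
    (σ : Equiv.Perm (Site L)) (hσ : ∀ l c, (P.symm (σ (P (l, c)))).1 = l)
    (hdest : ∀ l c : Fin L, dest l c = (P.symm (σ (P (l, c)))).2) :
    Computes ((List.range L).map (lineStep P dest)) (fun x v => x (σ.symm v))
      (fermionicSign k σ) := by
  have key : ∀ n, ∃ ρ : Equiv.Perm (Site L), (∀ v, lineState P dest n (ρ v) =
      lineState P dest 0 v ∧ (P.symm (ρ v)).1 = (P.symm v).1) ∧
      Computes ((List.range n).map (lineStep P dest)) (fun x v => x (ρ.symm v))
        (fermionicSign k ρ) := by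
    intro n
    induction n with
    | zero =>
      exact ⟨Equiv.refl _, fun _ => ⟨rfl, rfl⟩, Computes.nil.congr (fun _ => rfl)
        fun x => (fermionicSign_refl k x).symm⟩
    | succ n ih =>
      obtain ⟨ρ, h1, h2⟩ := ih
      refine ⟨ρ.trans (stepPerm (lineStep P dest n)), fun v => ?_, ?_⟩
      · obtain ⟨h3, h4⟩ := lineState_stepPerm (dest := dest) (t := n) hadj (ρ v)
        exact ⟨h3.trans (h1 v).1, h4.trans (h1 v).2⟩
      · rw [List.range_succ, List.map_append]
        refine (h2.append (computes_singleton_of_swaps hk (step := lineStep P dest n)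
          fun g hg => ?_)).congr (fun _ => rfl) fun x => (fermionicSign_trans hk _ _ _).symm
        obtain ⟨l, c, h, -, rfl⟩ := mem_lineStep.1 hg
        exact ⟨_, _, rfl, hkey l c h⟩
  obtain ⟨ρ, h1, h2⟩ := key L
  suffices ρ = σ by rwa [this] at h2
  ext1 v
  apply P.symm.injective
  obtain ⟨⟨l, c⟩, rfl⟩ := P.surjective v
  obtain ⟨h3, h4⟩ := h1 (P (l, c))
  rw [Equiv.symm_apply_apply] at h4
  refine Prod.ext (h4.trans (hσ l c).symm) (Fin.ext ?_)
  rw [← hdest]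
  rw [lineState, h4, oetState_sorted] at h3
  · simpa [lineState, oetState] using h3
  · intro i hi
    rw [hdest l ⟨i, hi⟩]
    exact Fin.is_lt _
  · intro i hi j hj hij
    rw [hdest l ⟨i, hi⟩, hdest l ⟨j, hj⟩] at hij
    have h5 : P.symm (σ (P (l, ⟨i, hi⟩))) = P.symm (σ (P (l, ⟨j, hj⟩))) :=
      Prod.ext ((hσ _ _).trans (hσ _ _).symm) (Fin.ext hij)
    simpa using h5
  · exact Fin.is_lt _

end Lines

/-! ### The snake order and the column order -/

section Orders

variable {L : ℕ}

/-- The key of the snake order. -/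
def snakeKey (L : ℕ) (v : Site L) : ℕ := (snake L v : ℕ)

theorem snakeKey_injective : Function.Injective (snakeKey L) :=
  Fin.val_injective.comp (snake L).injective

theorem snakeKey_eq (v : Site L) :
    snakeKey L v = (if (v.1 : ℕ) % 2 = 0 then (v.2 : ℕ) else L - 1 - v.2) + L * v.1 := by
  simp only [snakeKey, snake, Equiv.trans_apply, Equiv.prodShear_apply, Equiv.refl_apply,
    finProdFinEquiv_apply_val]
  split_ifs
  · rfl
  · simp [Fin.val_rev]
    omega

/-- The key of the order column by column, from the last column to the first. -/
def columnKey (L : ℕ) (v : Site L) : ℕ := v.1 + L * (L - 1 - v.2)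

theorem columnKey_injective : Function.Injective (columnKey L) := by
  intro v w h
  have h1 : finProdFinEquiv (v.2.rev, v.1) = finProdFinEquiv (w.2.rev, w.1) := by
    apply Fin.ext
    simp only [finProdFinEquiv_apply_val, Fin.val_rev]
    simp only [columnKey] at h
    rw [show L - ((v.2 : ℕ) + 1) = L - 1 - v.2 by omega,
      show L - ((w.2 : ℕ) + 1) = L - 1 - w.2 by omega]
    exact h
  simp only [EmbeddingLike.apply_eq_iff_eq, Prod.mk.injEq, Fin.rev_inj] at h1
  exact Prod.ext h1.2 h1.1

theorem computes_rowStage (σ : Equiv.Perm (Site L)) (hσ : ∀ p, (σ p).1 = p.1) :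
    Computes (rowStage σ) (fun x v => x (σ.symm v)) (fermionicSign (snakeKey L) σ) := by
  rw [rowStage_eq]
  refine computes_lineStage snakeKey_injective (fun l c h => ?_) (fun l c h => ?_) σ
    (fun l c => hσ _) fun l c => ?_
  · simp [SimpleGraph.boxProd_adj, SimpleGraph.pathGraph_adj]
  · simp only [Equiv.refl_apply, snakeKey_eq]
    split_ifs <;> omega
  · simp [rowDest]

/-- Vertical neighbours are consecutive in `columnKey`, so bare FSWAP gates are correct for that
order; the conversion to the snake order is left to `Γ`. -/
theorem computes_colStage (σ : Equiv.Perm (Site L)) (hσ : ∀ p, (σ p).2 = p.2) :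
    Computes (colStage σ) (fun x v => x (σ.symm v)) (fermionicSign (columnKey L) σ) := by
  rw [colStage_eq]
  refine computes_lineStage columnKey_injective (fun l c h => ?_) (fun l c h => ?_) σ
    (fun l c => hσ _) fun l c => ?_
  · simp [SimpleGraph.boxProd_adj, SimpleGraph.pathGraph_adj]
  · simp only [Equiv.prodComm_apply, Prod.swap_prod_mk, columnKey]
    omega
  · simp [colDest]

theorem rowStage_valid (σ : Equiv.Perm (Site L)) :
    ∀ step ∈ rowStage σ, StepValid (grid L) step := by
  rw [rowStage_eq]
  intro step h
  obtain ⟨t, -, rfl⟩ := List.mem_map.1 h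
  exact lineStep_valid fun l c h => by
    simp [SimpleGraph.boxProd_adj, SimpleGraph.pathGraph_adj]

theorem colStage_valid (σ : Equiv.Perm (Site L)) :
    ∀ step ∈ colStage σ, StepValid (grid L) step := by
  rw [colStage_eq]
  intro step h
  obtain ⟨t, -, rfl⟩ := List.mem_map.1 h
  exact lineStep_valid fun l c h => by
    simp [SimpleGraph.boxProd_adj, SimpleGraph.pathGraph_adj]

end Orders

/-! ### Evaluation of circuits on bit strings -/

section Evaluation

variable {V : Type} [DecidableEq V]

/-- The bits after a circuit. -/
def circuitBits : Circuit V → (V → ZMod 2) → V → ZMod 2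
  | [], x => x
  | step :: C, x => circuitBits C (x + stepDelta step x)

/-- The sign of a circuit. -/
def circuitSign : Circuit V → (V → ZMod 2) → ZMod 2
  | [], _ => 0
  | step :: C, x => circuitSign C (x + stepDelta step x) + stepSign step x

theorem circuitBits_append (C D : Circuit V) (x : V → ZMod 2) :
    circuitBits (C ++ D) x = circuitBits D (circuitBits C x) := by
  induction C generalizing x with
  | nil => rfl
  | cons step C ih => exact ih _

theorem circuitSign_append (C D : Circuit V) (x : V → ZMod 2) :
    circuitSign (C ++ D) x = circuitSign D (circuitBits C x) + circuitSign C x := by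
  induction C generalizing x with
  | nil => exact (add_zero _).symm
  | cons step C ih =>
    simp only [List.cons_append, circuitSign, circuitBits, ih]
    ring

theorem computes_of_valid [Fintype V] {G : SimpleGraph V} {C : Circuit V}
    (hC : ∀ step ∈ C, StepValid G step) : Computes C (circuitBits C) (circuitSign C) := by
  induction C with
  | nil => exact Computes.nil
  | cons step C ih =>
    exact Computes.cons (f := fun x => x + stepDelta step x)
      (isSignedMap_stepOp (hC step (by simp)))
      (ih fun s hs => hC s (by simp [hs]))

/-- Circuits are evaluated by proposing the bits `y i` before every step and checking single steps;
the signs add up along the trajectory. -/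
theorem circuit_range_map (f : ℕ → List (Gate V)) (y : ℕ → V → ZMod 2) (n : ℕ)
    (hy : ∀ i < n, y i + stepDelta (f i) (y i) = y (i + 1)) :
    circuitBits ((List.range n).map f) (y 0) = y n ∧
      circuitSign ((List.range n).map f) (y 0) = ∑ i ∈ Finset.range n, stepSign (f i) (y i) := by
  induction n with
  | zero => exact ⟨rfl, rfl⟩
  | succ n ih =>
    obtain ⟨h1, h2⟩ := ih fun i hi => hy i (by omega)
    rw [List.range_succ, List.map_append, circuitBits_append, circuitSign_append, h1, h2,
      Finset.sum_range_succ, add_comm (∑ i ∈ Finset.range n, _)]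
    refine ⟨?_, ?_⟩
    · exact hy n (by omega)
    · simp [circuitSign]

theorem circuit_range_reverse_map (f : ℕ → List (Gate V)) (y : ℕ → V → ZMod 2) (n : ℕ)
    (hy : ∀ i < n, y (i + 1) + stepDelta (f i) (y (i + 1)) = y i) :
    circuitBits ((List.range n).reverse.map f) (y n) = y 0 ∧
      circuitSign ((List.range n).reverse.map f) (y n) =
        ∑ i ∈ Finset.range n, stepSign (f i) (y (i + 1)) := by
  induction n with
  | zero => exact ⟨rfl, rfl⟩
  | succ n ih =>
    obtain ⟨h1, h2⟩ := ih fun i hi => hy i (by omega)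
    rw [List.range_succ, List.reverse_append, List.reverse_singleton, List.singleton_append,
      List.map_cons, circuitBits, circuitSign, hy n (by omega), h1, h2, Finset.sum_range_succ]
    exact ⟨rfl, rfl⟩

end Evaluation

/-! ### Gates at integer coordinates -/

section Coordinates

variable {L : ℕ}

/-- The bit at `(r, c)`, or zero if `(r, c)` lies outside the grid. -/
def bitAt (x : Site L → ZMod 2) (r c : ℤ) : ZMod 2 :=
  match site? L r c with
  | some v => x v
  | none => 0

theorem site?_eq_some {r c : ℤ} {v : Site L} :
    site? L r c = some v ↔ r = (v.1 : ℕ) ∧ c = (v.2 : ℕ) := by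
  unfold site?
  split_ifs with h
  · rw [Option.some.injEq, Prod.ext_iff, Fin.ext_iff, Fin.ext_iff]
    dsimp only
    omega
  · simp only [false_iff]
    rintro ⟨rfl, rfl⟩
    exact h (by have := v.1.2; have := v.2.2; omega)

theorem bitAt_site (x : Site L → ZMod 2) (v : Site L) :
    bitAt x ((v.1 : ℕ) : ℤ) ((v.2 : ℕ) : ℤ) = x v := by
  rw [bitAt, site?_eq_some.2 ⟨rfl, rfl⟩]

theorem bitAt_of_not (x : Site L → ZMod 2) {r c : ℤ} (h : ¬ ((0 ≤ r ∧ r < L) ∧ 0 ≤ c ∧ c < L)) :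
    bitAt x r c = 0 := by
  rw [bitAt, site?, dif_neg h]

theorem bitAt_restrict (Y : ℤ → ℤ → ZMod 2) (r c : ℤ) :
    bitAt (fun v : Site L => Y (v.1 : ℕ) (v.2 : ℕ)) r c =
      if (0 ≤ r ∧ r < L) ∧ 0 ≤ c ∧ c < L then Y r c else 0 := by
  unfold bitAt site?
  split_ifs with h
  · simp only [Int.toNat_of_nonneg h.1.1, Int.toNat_of_nonneg h.2.1]
  · rfl

theorem stepDelta_cnotAt (r c r' c' : ℤ) (x : Site L → ZMod 2) (v : Site L) :
    stepDelta (cnotAt L r c r' c') x v =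
      if ((v.1 : ℕ) : ℤ) = r' ∧ ((v.2 : ℕ) : ℤ) = c' then bitAt x r c else 0 := by
  unfold cnotAt bitAt
  rcases h1 : site? L r c with _ | a
  · simp [stepDelta]
  · rcases h2 : site? L r' c' with _ | b
    · rw [if_neg]
      · simp [stepDelta]
      · rintro ⟨h3, h4⟩
        simpa [h2] using site?_eq_some.2 ⟨h3.symm, h4.symm⟩
    · obtain ⟨h3, h4⟩ := site?_eq_some.1 h2
      simp only [stepDelta, List.map_cons, List.map_nil, List.sum_cons, List.sum_nil, add_zero,
        Gate.delta]
      refine if_congr ?_ rfl rfl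
      rw [Prod.ext_iff, Fin.ext_iff, Fin.ext_iff]
      omega

theorem stepSign_cnotAt (r c r' c' : ℤ) (x : Site L → ZMod 2) :
    stepSign (cnotAt L r c r' c') x = 0 := by
  unfold cnotAt
  split <;> simp [stepSign, Gate.sign]

theorem stepDelta_czAt (r c r' c' : ℤ) (x : Site L → ZMod 2) (v : Site L) :
    stepDelta (czAt L r c r' c') x v = 0 := by
  unfold czAt
  split <;> simp [stepDelta, Gate.delta]

theorem stepSign_czAt (r c r' c' : ℤ) (x : Site L → ZMod 2) :
    stepSign (czAt L r c r' c') x = bitAt x r c * bitAt x r' c' := by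
  unfold czAt bitAt
  rcases site? L r c with _ | a <;> rcases site? L r' c' with _ | b <;>
    simp [stepSign, Gate.sign]

theorem stepDelta_zAt (r c : ℤ) (x : Site L → ZMod 2) (v : Site L) :
    stepDelta (zAt L r c) x v = 0 := by
  unfold zAt
  split <;> simp [stepDelta, Gate.delta]

theorem stepSign_zAt (r c : ℤ) (x : Site L → ZMod 2) :
    stepSign (zAt L r c) x = bitAt x r c := by
  unfold zAt bitAt
  rcases site? L r c with _ | a <;> simp [stepSign, Gate.sign]

/-- `A` is a valid time step on sites with coordinates in `cells`. -/
def Occupies (A : List (Gate (Site L))) (cells : List (ℤ × ℤ)) : Prop :=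
  StepValid (grid L) A ∧ ∀ g ∈ A, ∀ v ∈ g.qubits, (((v.1 : ℕ) : ℤ), ((v.2 : ℕ) : ℤ)) ∈ cells

theorem Occupies.nil (cells : List (ℤ × ℤ)) : Occupies ([] : List (Gate (Site L))) cells :=
  ⟨⟨by simp, List.Pairwise.nil⟩, by simp⟩

theorem Occupies.append {A B : List (Gate (Site L))} {a b : List (ℤ × ℤ)} (hA : Occupies A a)
    (hB : Occupies B b) (hab : a.Disjoint b) : Occupies (A ++ B) (a ++ b) := by
  refine ⟨⟨fun g hg => ?_, List.pairwise_append.2 ⟨hA.1.2, hB.1.2, fun g hg h hh v hv hv' => ?_⟩⟩,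
    fun g hg v hv => ?_⟩
  · rcases List.mem_append.1 hg with hg | hg
    · exact hA.1.1 g hg
    · exact hB.1.1 g hg
  · exact hab (hA.2 g hg v hv) (hB.2 h hh v hv')
  · rcases List.mem_append.1 hg with hg | hg
    · exact List.mem_append_left _ (hA.2 g hg v hv)
    · exact List.mem_append_right _ (hB.2 g hg v hv)

theorem Occupies.ite {A : List (Gate (Site L))} {a : List (ℤ × ℤ)} (p : Prop) [Decidable p]
    (hA : Occupies A a) : Occupies (if p then A else []) a := by
  split_ifs
  · exact hA
  · exact Occupies.nil a

theorem Occupies.singleton {g : Gate (Site L)} {a : List (ℤ × ℤ)} (hg : g.IsOn (grid L))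
    (h : ∀ v ∈ g.qubits, (((v.1 : ℕ) : ℤ), ((v.2 : ℕ) : ℤ)) ∈ a) : Occupies [g] a :=
  ⟨⟨by simpa using hg, List.pairwise_singleton _ _⟩, by simpa using h⟩

theorem grid_adj_of_coordinates {a b : Site L}
    (h : ((a.1 : ℕ) = b.1 ∧ ((a.2 : ℕ) + 1 = b.2 ∨ (b.2 : ℕ) + 1 = a.2)) ∨
      ((a.2 : ℕ) = b.2 ∧ ((a.1 : ℕ) + 1 = b.1 ∨ (b.1 : ℕ) + 1 = a.1))) : (grid L).Adj a b := by
  simp only [SimpleGraph.boxProd_adj, SimpleGraph.pathGraph_adj, Fin.ext_iff]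
  omega

theorem occupies_cnotAt {r c r' c' : ℤ}
    (h : (r = r' ∧ (c + 1 = c' ∨ c' + 1 = c)) ∨ (c = c' ∧ (r + 1 = r' ∨ r' + 1 = r))) :
    Occupies (cnotAt L r c r' c') [(r, c), (r', c')] := by
  unfold cnotAt
  rcases h1 : site? L r c with _ | a
  · exact Occupies.nil _
  · rcases h2 : site? L r' c' with _ | b
    · exact Occupies.nil _
    · obtain ⟨rfl, rfl⟩ := site?_eq_some.1 h1
      obtain ⟨rfl, rfl⟩ := site?_eq_some.1 h2
      refine Occupies.singleton (grid_adj_of_coordinates (by omega)) fun v hv => ?_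
      simp only [Gate.qubits, List.mem_cons, List.not_mem_nil, or_false] at hv
      rcases hv with rfl | rfl <;> simp

theorem occupies_czAt {r c r' c' : ℤ}
    (h : (r = r' ∧ (c + 1 = c' ∨ c' + 1 = c)) ∨ (c = c' ∧ (r + 1 = r' ∨ r' + 1 = r))) :
    Occupies (czAt L r c r' c') [(r, c), (r', c')] := by
  unfold czAt
  rcases h1 : site? L r c with _ | a
  · exact Occupies.nil _
  · rcases h2 : site? L r' c' with _ | b
    · exact Occupies.nil _
    · obtain ⟨rfl, rfl⟩ := site?_eq_some.1 h1
      obtain ⟨rfl, rfl⟩ := site?_eq_some.1 h2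
      refine Occupies.singleton (grid_adj_of_coordinates (by omega)) fun v hv => ?_
      simp only [Gate.qubits, List.mem_cons, List.not_mem_nil, or_false] at hv
      rcases hv with rfl | rfl <;> simp

theorem occupies_zAt (r c : ℤ) : Occupies (zAt L r c) [(r, c)] := by
  unfold zAt
  rcases h1 : site? L r c with _ | a
  · exact Occupies.nil _
  · obtain ⟨rfl, rfl⟩ := site?_eq_some.1 h1
    refine Occupies.singleton trivial fun v hv => ?_
    simp only [Gate.qubits, List.mem_cons, List.not_mem_nil, or_false] at hv
    subst hv
    simp

/-- Steps on pairwise disjoint sets of cells can be executed in parallel. -/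
theorem stepValid_flatMap {α : Type} {l : List α} (hl : l.Nodup) {f : α → List (Gate (Site L))}
    {cells : α → List (ℤ × ℤ)} (h : ∀ a ∈ l, Occupies (f a) (cells a))
    (hdis : ∀ a ∈ l, ∀ b ∈ l, a ≠ b → (cells a).Disjoint (cells b)) :
    StepValid (grid L) (l.flatMap f) := by
  refine ⟨fun g hg => ?_, List.pairwise_flatMap.2 ⟨fun a ha => (h a ha).1.2, ?_⟩⟩
  · obtain ⟨a, ha, hg⟩ := List.mem_flatMap.1 hg
    exact (h a ha).1.1 g hg
  · refine hl.imp_of_mem fun {a b} ha hb hab g hg g' hg' v hv hv' => ?_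
    exact hdis a ha b hb hab ((h a ha).2 g hg v hv) ((h b hb).2 g' hg' v hv')

theorem sum_map_eq_ite {l : List ℕ} (hl : l.Nodup) {f : ℕ → ZMod 2} (a : ℕ)
    (h : ∀ b ∈ l, b ≠ a → f b = 0) : (l.map f).sum = if a ∈ l then f a else 0 := by
  induction l with
  | nil => simp
  | cons b l ih =>
    obtain ⟨h1, h2⟩ := List.nodup_cons.1 hl
    rw [List.map_cons, List.sum_cons, ih h2 fun b hb => h b (by simp [hb])]
    by_cases hab : b = a
    · subst hab
      simp [h1]
    · rw [h b (by simp) hab, zero_add]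
      simp [Ne.symm hab]

end Coordinates

/-! ### The column-parity basis -/

section ColumnParity

variable {L : ℕ}

theorem verticalCNOTs_eq (r : ℕ) : verticalCNOTs L r =
    (List.range L).flatMap fun c : ℕ => cnotAt L ((r : ℤ) + 1) c r c := by
  simp [verticalCNOTs, List.flatMap_assoc]

theorem verticalCNOTs_valid (r : ℕ) : StepValid (grid L) (verticalCNOTs L r) := by
  rw [verticalCNOTs_eq]
  refine stepValid_flatMap List.nodup_range (cells := fun c => [((r : ℤ) + 1, (c : ℤ)),
    ((r : ℤ), (c : ℤ))]) (fun c _ => occupies_cnotAt (by omega)) fun c _ c' _ hne => ?_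
  rintro ⟨i, j⟩ h h'
  simp only [List.mem_cons, Prod.mk.injEq, List.not_mem_nil, or_false] at h h'
  omega

theorem stepDelta_verticalCNOTs (r : ℕ) (x : Site L → ZMod 2) (v : Site L) :
    stepDelta (verticalCNOTs L r) x v =
      if (v.1 : ℕ) = r then bitAt x ((r : ℤ) + 1) (v.2 : ℕ) else 0 := by
  rw [verticalCNOTs_eq, stepDelta_flatMap, sum_map_eq_ite List.nodup_range (v.2 : ℕ)]
  · rw [if_pos (by simp), stepDelta_cnotAt]
    simp
  · intro c _ hc
    rw [stepDelta_cnotAt, if_neg]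
    rintro ⟨-, h⟩
    omega

theorem stepSign_verticalCNOTs (r : ℕ) (x : Site L → ZMod 2) :
    stepSign (verticalCNOTs L r) x = 0 := by
  rw [verticalCNOTs_eq, stepSign_flatMap]
  exact List.sum_eq_zero fun a ha => by
    obtain ⟨c, -, rfl⟩ := List.mem_map.1 ha
    exact stepSign_cnotAt _ _ _ _ _

/-- The parity of the bits in column `c` from row `r` downwards. -/
def suffixParity (x : Site L → ZMod 2) (r : ℕ) (c : ℤ) : ZMod 2 :=
  ∑ i ∈ Finset.Ico r L, bitAt x (i : ℤ) c

theorem suffixParity_eq_add (x : Site L → ZMod 2) {r : ℕ} (hr : r < L) (c : ℤ) :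
    suffixParity x r c = bitAt x r c + suffixParity x (r + 1) c :=
  Finset.sum_eq_sum_Ico_succ_bot hr _

theorem suffixParity_of_le (x : Site L → ZMod 2) {r : ℕ} (hr : L ≤ r) (c : ℤ) :
    suffixParity x r c = 0 := by
  simp [suffixParity, Finset.Ico_eq_empty_of_le hr]

/-- The bits in the column-parity basis. -/
def columnParities (x : Site L → ZMod 2) (v : Site L) : ZMod 2 :=
  suffixParity x v.1 (v.2 : ℕ)

theorem bitAt_columnParities (x : Site L → ZMod 2) (r c : ℕ) :
    bitAt (columnParities x) r c = suffixParity x r c := by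
  by_cases h : r < L ∧ c < L
  · exact bitAt_site (columnParities x) (⟨r, h.1⟩, ⟨c, h.2⟩)
  · rw [bitAt_of_not _ (by omega)]
    refine (Finset.sum_eq_zero fun i hi => bitAt_of_not _ ?_).symm
    have := Finset.mem_Ico.1 hi
    omega

/-- The bits when the rows from `i` downwards are in the column-parity basis. -/
def partialParities (x : Site L → ZMod 2) (i : ℕ) (v : Site L) : ZMod 2 :=
  if i ≤ v.1 then columnParities x v else x v

theorem bitAt_partialParities (x : Site L → ZMod 2) {i r : ℕ} (h : i ≤ r) (v : Site L) :
    bitAt (partialParities x i) r (v.2 : ℕ) = suffixParity x r (v.2 : ℕ) := by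
  by_cases hr : r < L
  · rw [← bitAt_columnParities]
    have h1 := bitAt_site (partialParities x i) (⟨r, hr⟩, v.2)
    have h2 := bitAt_site (columnParities x) (⟨r, hr⟩, v.2)
    dsimp only at h1 h2
    rw [h1, h2, partialParities, if_pos h]
  · rw [bitAt_of_not _ (by omega), suffixParity_of_le _ (by omega)]

theorem partialParities_last (x : Site L → ZMod 2) : partialParities x (L - 1) = x := by
  funext v
  unfold partialParities
  split_ifs with h
  · rw [columnParities, suffixParity_eq_add _ v.1.2, suffixParity_of_le _ (by omega), add_zero,
      bitAt_site]
  · rfl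

/-- Working upwards, row `i + 1` already holds its suffix parity when it is added to row `i`. -/
theorem gammaPhase1_eval (x : Site L → ZMod 2) :
    circuitBits (gammaPhase1 L) x = columnParities x ∧ circuitSign (gammaPhase1 L) x = 0 := by
  have key := circuit_range_reverse_map (verticalCNOTs L) (partialParities x) (L - 1) (by
    intro i hi
    funext v
    rw [Pi.add_apply, stepDelta_verticalCNOTs]
    by_cases hv : (v.1 : ℕ) = i
    · have h1 := bitAt_partialParities x (le_refl (i + 1)) v
      push_cast at h1
      rw [if_pos hv, h1, partialParities, partialParities, if_neg (by omega), if_pos hv.ge,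
        columnParities, suffixParity_eq_add _ v.1.2, bitAt_site, hv]
    · rw [if_neg hv, add_zero]
      unfold partialParities
      exact if_congr (by omega) rfl rfl)
  rw [partialParities_last] at key
  refine ⟨key.1.trans ?_, key.2.trans (Finset.sum_eq_zero fun i _ => stepSign_verticalCNOTs _ _)⟩
  funext v
  exact if_pos (Nat.zero_le _)

/-- Working downwards, row `i + 1` still holds its suffix parity, and adding it to that of row `i`
leaves the original bit. -/
theorem gammaPhase3_eval (x : Site L → ZMod 2) :
    circuitBits (gammaPhase3 L) (columnParities x) = x ∧
      circuitSign (gammaPhase3 L) (columnParities x) = 0 := by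
  have key := circuit_range_map (verticalCNOTs L) (partialParities x) (L - 1) (by
    intro i hi
    funext v
    rw [Pi.add_apply, stepDelta_verticalCNOTs]
    by_cases hv : (v.1 : ℕ) = i
    · have h1 := bitAt_partialParities x (Nat.le_succ i) v
      push_cast at h1
      rw [if_pos hv, h1, partialParities, partialParities, if_pos hv.ge, if_neg (by omega),
        columnParities, suffixParity_eq_add _ v.1.2, bitAt_site, hv, add_assoc,
        CharTwo.add_self_eq_zero, add_zero]
    · rw [if_neg hv, add_zero]
      unfold partialParities
      exact if_congr (by omega) rfl rfl)
  have h0 : partialParities x 0 = columnParities x := funext fun v => if_pos (Nat.zero_le _)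
  rw [partialParities_last, h0] at key
  exact ⟨key.1, key.2.trans (Finset.sum_eq_zero fun i _ => stepSign_verticalCNOTs _ _)⟩

end ColumnParity

/-! ### The bits during a sweep -/

section Sweeps

variable {L : ℕ}

/-- The parity of the bits of row `r` from column `0` to column `c`. -/
def prefixParity (s : Site L → ZMod 2) (r c : ℤ) : ZMod 2 :=
  ∑ j ∈ Finset.range (c + 1).toNat, bitAt s r (j : ℤ)

theorem prefixParity_eq_add (s : Site L → ZMod 2) (r : ℤ) {c : ℤ} (hc : 0 ≤ c) :
    prefixParity s r c = prefixParity s r (c - 1) + bitAt s r c := by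
  obtain ⟨n, rfl⟩ := Int.eq_ofNat_of_zero_le hc
  rw [prefixParity, prefixParity, show ((n : ℤ) + 1).toNat = n + 1 by omega,
    show ((n : ℤ) - 1 + 1).toNat = n by omega, Finset.sum_range_succ]

theorem prefixParity_neg (s : Site L → ZMod 2) (r : ℤ) {c : ℤ} (hc : c < 0) :
    prefixParity s r c = 0 := by
  rw [prefixParity, show (c + 1).toNat = 0 by omega, Finset.range_zero, Finset.sum_empty]

variable (R K : ℤ → Prop) [DecidablePred R] [DecidablePred K]

/-- The bit at `(r, c)` before time `i` of the forward legs of the sweeps over the rows in `R`;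
the gadgets of the rows in `K` involve the row below. -/
def forwardState (s : Site L → ZMod 2) (i r c : ℤ) : ZMod 2 :=
  if R r then (if c ≤ i then prefixParity s r c else bitAt s r c)
  else bitAt s r c + if K (r - 1) ∧ c + 3 ≤ i ∧ i ≤ c + 4 then prefixParity s (r - 1) c else 0

/-- The bit at `(r, c)` before time `t` of the undo legs. -/
def undoState (s : Site L → ZMod 2) (t r c : ℤ) : ZMod 2 :=
  if R r then (if t + 2 ≤ c then bitAt s r c else prefixParity s r c)
  else bitAt s r c + if K (r - 1) ∧ c - 4 ≤ t ∧ t ≤ c - 3 then bitAt s (r - 1) c else 0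

/-- The restriction to the grid. -/
def onGrid (L : ℕ) (Y : ℤ → ℤ → ZMod 2) (v : Site L) : ZMod 2 := Y (v.1 : ℕ) (v.2 : ℕ)

theorem bitAt_onGrid (Y : ℤ → ℤ → ZMod 2) (r c : ℤ) :
    bitAt (onGrid L Y) r c = if (0 ≤ r ∧ r < L) ∧ 0 ≤ c ∧ c < L then Y r c else 0 :=
  bitAt_restrict Y r c

/-- The cascade gate of a leg at time `t`, and CNOT gates into the row below at two columns. -/
def LegDelta (r : ℕ) (A : List (Gate (Site L))) (t c₁ c₂ : ℤ) : Prop :=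
  ∀ (y : Site L → ZMod 2) (v : Site L), stepDelta A y v =
    (if ((v.1 : ℕ) : ℤ) = r ∧ ((v.2 : ℕ) : ℤ) = t + 1 then bitAt y r t else 0) +
      if K r then
        (if ((v.1 : ℕ) : ℤ) = r + 1 ∧ ((v.2 : ℕ) : ℤ) = c₁ then bitAt y r c₁ else 0) +
          (if ((v.1 : ℕ) : ℤ) = r + 1 ∧ ((v.2 : ℕ) : ℤ) = c₂ then bitAt y r c₂ else 0)
      else 0

variable {R K} {rows : List ℕ}

/-- Swept rows are never adjacent, so a site can be changed only by the sweep of its own row, if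
there is one, and otherwise by that of the row above. -/
theorem sum_legDelta (hR : ∀ r, R r → ¬ R (r + 1)) (hnd : rows.Nodup)
    (hrows : ∀ r : ℕ, r ∈ rows ↔ r < L ∧ R r) (hK : ∀ r, K r → 0 ≤ r ∧ r + 2 < L ∧ R r)
    {A : ℕ → List (Gate (Site L))} {t c₁ c₂ : ℤ}
    (hA : ∀ r ∈ rows, LegDelta K r (A r) t c₁ c₂) (y : Site L → ZMod 2) (v : Site L) :
    stepDelta (rows.flatMap A) y v =
      if R ((v.1 : ℕ) : ℤ) then
        (if ((v.2 : ℕ) : ℤ) = t + 1 then bitAt y ((v.1 : ℕ) : ℤ) t else 0)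
      else if K (((v.1 : ℕ) : ℤ) - 1) then
        (if ((v.2 : ℕ) : ℤ) = c₁ then bitAt y (((v.1 : ℕ) : ℤ) - 1) c₁ else 0) +
          (if ((v.2 : ℕ) : ℤ) = c₂ then bitAt y (((v.1 : ℕ) : ℤ) - 1) c₂ else 0)
      else 0 := by
  rw [stepDelta_flatMap]
  by_cases hv : R ((v.1 : ℕ) : ℤ)
  · rw [sum_map_eq_ite hnd (v.1 : ℕ), if_pos ((hrows _).2 ⟨v.1.2, hv⟩), if_pos hv,
      hA _ ((hrows _).2 ⟨v.1.2, hv⟩)]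
    · simp
    · intro b hb hne
      have h1 : ¬ ((v.1 : ℕ) : ℤ) = b := by omega
      have h2 : ¬ ((v.1 : ℕ) : ℤ) = b + 1 := fun h => hR b ((hrows b).1 hb).2 (h ▸ hv)
      rw [hA b hb]
      simp [h1, h2]
  · rw [sum_map_eq_ite hnd ((v.1 : ℕ) - 1), if_neg hv]
    · by_cases hk : K (((v.1 : ℕ) : ℤ) - 1)
      · have h0 := hK _ hk
        have h1 : (((v.1 : ℕ) - 1 : ℕ) : ℤ) = ((v.1 : ℕ) : ℤ) - 1 := by omega
        have hmem : (v.1 : ℕ) - 1 ∈ rows :=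
          (hrows _).2 ⟨by have := v.1.2; omega, by rw [h1]; exact h0.2.2⟩
        rw [if_pos hmem, if_pos hk, hA _ hmem, h1, if_pos hk, if_neg (by omega), zero_add,
          sub_add_cancel]
        simp
      · rw [if_neg hk]
        split_ifs with hmem
        · rw [hA _ hmem]
          have h3 : ¬ ((v.1 : ℕ) : ℤ) = (((v.1 : ℕ) - 1 : ℕ) : ℤ) :=
            fun h => hv (h ▸ ((hrows _).1 hmem).2)
          have h1 : (((v.1 : ℕ) - 1 : ℕ) : ℤ) = ((v.1 : ℕ) : ℤ) - 1 := by omega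
          rw [h1] at h3 ⊢
          rw [if_neg hk, if_neg fun h => h3 h.1, add_zero]
        · rfl
    · intro b hb hne
      have h1 : ¬ ((v.1 : ℕ) : ℤ) = b := fun h => hv (h ▸ ((hrows b).1 hb).2)
      have h2 : ¬ ((v.1 : ℕ) : ℤ) = b + 1 := by omega
      rw [hA b hb]
      simp [h1, h2]

/-- The cascade gate extends the prefix parities by one column. In the row below, column `i - 2`
receives the prefix parity above it, and column `i - 4` is rid of the one it received two steps
before. -/
theorem forwardState_step (hR : ∀ r, R r → ¬ R (r + 1)) (hnd : rows.Nodup)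
    (hrows : ∀ r : ℕ, r ∈ rows ↔ r < L ∧ R r) (hK : ∀ r, K r → 0 ≤ r ∧ r + 2 < L ∧ R r)
    {A : ℕ → List (Gate (Site L))} {i : ℤ} (hi : 0 ≤ i)
    (hA : ∀ r ∈ rows, LegDelta K r (A r) i (i - 2) (i - 4)) (s : Site L → ZMod 2) :
    onGrid L (forwardState R K s i) +
        stepDelta (rows.flatMap A) (onGrid L (forwardState R K s i)) =
      onGrid L (forwardState R K s (i + 1)) := by
  funext v
  have hv1 := v.1.2
  have hv2 := v.2.2
  rw [Pi.add_apply, sum_legDelta hR hnd hrows hK hA]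
  simp only [bitAt_onGrid]
  by_cases hv : R ((v.1 : ℕ) : ℤ)
  · simp only [onGrid, forwardState, if_pos hv]
    by_cases hc : ((v.2 : ℕ) : ℤ) = i + 1
    · rw [if_pos hc, if_neg (by omega), if_pos (by omega), if_pos (le_refl i), if_pos (by omega),
        hc, prefixParity_eq_add s _ (c := i + 1) (by omega), add_sub_cancel_right, add_comm]
    · rw [if_neg hc, add_zero]
      exact if_congr (by omega) rfl rfl
  · simp only [onGrid, forwardState, if_neg hv]
    by_cases hk : K (((v.1 : ℕ) : ℤ) - 1)
    · have h0 := hK _ hk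
      simp only [hk, if_true, true_and, if_pos h0.2.2]
      by_cases h1 : ((v.2 : ℕ) : ℤ) = i - 2
      · have h2 : ¬ ((v.2 : ℕ) : ℤ) = i - 4 := by omega
        rw [if_neg (c := _ ∧ _ ≤ _) (by omega), if_pos h1, if_neg h2, ← h1,
          if_pos (c := _ ∧ 0 ≤ _ ∧ _) (by omega), if_pos (c := _ ≤ i) (by omega),
          if_pos (c := _ ∧ _ ≤ _) (by omega)]
        ring
      · by_cases h2 : ((v.2 : ℕ) : ℤ) = i - 4
        · rw [if_pos (by omega), if_neg h1, if_pos h2, if_pos (by omega), if_pos (by omega),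
            if_neg (by omega), ← h2, zero_add, add_assoc, CharTwo.add_self_eq_zero]
        · rw [if_neg h1, if_neg h2, add_zero, add_zero]
          congr 1
          exact if_congr (by omega) rfl rfl
    · simp [hk]

/-- The cascade is undone from the right: column `t` still holds its prefix parity when it is added
to column `t + 1`. The columns from `t + 2` on are restored, so the row below now receives plain
bits instead of prefix parities. -/
theorem undoState_step (hR : ∀ r, R r → ¬ R (r + 1)) (hnd : rows.Nodup)
    (hrows : ∀ r : ℕ, r ∈ rows ↔ r < L ∧ R r) (hK : ∀ r, K r → 0 ≤ r ∧ r + 2 < L ∧ R r)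
    {A : ℕ → List (Gate (Site L))} {t : ℤ}
    (hA : ∀ r ∈ rows, LegDelta K r (A r) t (t + 2) (t + 4)) (s : Site L → ZMod 2) :
    onGrid L (undoState R K s t) + stepDelta (rows.flatMap A) (onGrid L (undoState R K s t)) =
      onGrid L (undoState R K s (t - 1)) := by
  funext v
  have hv1 := v.1.2
  have hv2 := v.2.2
  rw [Pi.add_apply, sum_legDelta hR hnd hrows hK hA]
  simp only [bitAt_onGrid]
  by_cases hv : R ((v.1 : ℕ) : ℤ)
  · simp only [onGrid, undoState, if_pos hv]
    by_cases hc : ((v.2 : ℕ) : ℤ) = t + 1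
    · rw [if_pos hc, if_neg (by omega), if_pos (c := t - 1 + 2 ≤ _) (by omega),
        prefixParity_eq_add s _ (by omega)]
      by_cases ht : 0 ≤ t
      · rw [if_pos (by omega), if_neg (by omega), hc, add_sub_cancel_right, add_right_comm,
          CharTwo.add_self_eq_zero, zero_add]
      -- Here `t = -1` and the cascade gate is dropped; in column `0` the prefix parity is the bit
      -- itself.
      · rw [if_neg (by omega), add_zero, prefixParity_neg s _ (by omega), zero_add]
    · rw [if_neg hc, add_zero]
      exact if_congr (by omega) rfl rfl
  · simp only [onGrid, undoState, if_neg hv]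
    by_cases hk : K (((v.1 : ℕ) : ℤ) - 1)
    · have h0 := hK _ hk
      simp only [hk, if_true, true_and, if_pos h0.2.2]
      by_cases h1 : ((v.2 : ℕ) : ℤ) = t + 2
      · have h2 : ¬ ((v.2 : ℕ) : ℤ) = t + 4 := by omega
        rw [if_neg (c := _ ∧ t ≤ _) (by omega), if_pos h1, if_neg h2, ← h1,
          if_pos (c := _ ∧ 0 ≤ _ ∧ _) (by omega), if_pos (c := ((v.2 : ℕ) : ℤ) ≤ ((v.2 : ℕ) : ℤ)) le_rfl,
          if_pos (c := _ ∧ t - 1 ≤ _) (by omega)]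
        ring
      · by_cases h2 : ((v.2 : ℕ) : ℤ) = t + 4
        · rw [if_pos (by omega), if_neg h1, if_pos h2, if_pos (by omega), if_pos (by omega),
            if_neg (by omega), ← h2, zero_add, add_assoc, CharTwo.add_self_eq_zero]
        · rw [if_neg h1, if_neg h2, add_zero, add_zero]
          congr 1
          exact if_congr (by omega) rfl rfl
    · simp [hk]

theorem forwardState_zero (s : Site L → ZMod 2) : onGrid L (forwardState R K s 0) = s := by
  funext v
  rw [onGrid, forwardState, bitAt_site, if_neg (c := K _ ∧ _) (by omega), add_zero]
  split_ifs with h1 h2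
  · rw [prefixParity_eq_add s _ (by omega), prefixParity_neg s _ (by omega), zero_add, bitAt_site]
  · rfl
  · rfl

/-- The last CNOT into the row below, in column `L - 1`, fires at time `L + 3`; at time `L + 5` only
the prefix parities remain. -/
theorem forwardState_last (s : Site L → ZMod 2) :
    onGrid L (forwardState R K s ((L + 5 : ℕ) : ℤ)) = onGrid L (undoState R K s ((L : ℤ) - 2)) := by
  funext v
  have := v.2.2
  rw [onGrid, onGrid, forwardState, undoState, if_pos (c := _ ≤ _) (by omega),
    if_neg (c := (L : ℤ) - 2 + 2 ≤ _) (by omega), if_neg (c := K _ ∧ _) (by omega),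
    if_neg (c := K _ ∧ _) (by omega)]

theorem undoState_last (s : Site L → ZMod 2) : onGrid L (undoState R K s (-6)) = s := by
  funext v
  rw [onGrid, undoState, bitAt_site, if_pos (c := _ ≤ _) (by omega),
    if_neg (c := K _ ∧ _) (by omega), add_zero, ite_self]

theorem sum_list_sum (n : ℕ) (l : List ℕ) (f : ℕ → ℕ → ZMod 2) :
    ∑ i ∈ Finset.range n, (l.map (f i)).sum =
      (l.map fun r => ∑ i ∈ Finset.range n, f i r).sum := by
  induction l with
  | nil => simp
  | cons r l ih => simp [Finset.sum_add_distrib, ih]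

theorem sweeps_eval (hR : ∀ r, R r → ¬ R (r + 1)) (hnd : rows.Nodup)
    (hrows : ∀ r : ℕ, r ∈ rows ↔ r < L ∧ R r) (hK : ∀ r, K r → 0 ≤ r ∧ r + 2 < L ∧ R r)
    {fwd undo : ℕ → List (ℤ × Gadget L)}
    (hf : ∀ r ∈ rows, ∀ t, LegDelta K r (legStep L r (fwd r) t) t (t - 2) (t - 4))
    (hu : ∀ r ∈ rows, ∀ t, LegDelta K r (legStep L r (undo r) t) t (t + 2) (t + 4))
    (s : Site L → ZMod 2) :
    circuitBits (sweeps L rows fwd undo) s = s ∧ circuitSign (sweeps L rows fwd undo) s =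
      (rows.map fun r : ℕ =>
        ∑ i ∈ Finset.range (L + 5), stepSign (legStep L r (fwd r) (i : ℤ))
          (onGrid L (forwardState R K s (i : ℤ))) +
        ∑ j ∈ Finset.range (L + 4), stepSign (legStep L r (undo r) ((L : ℤ) - 2 - (j : ℤ)))
          (onGrid L (undoState R K s ((L : ℤ) - 2 - (j : ℤ))))).sum := by
  -- The two legs are glued at time `L + 5`, where `forwardState_last` identifies their states.
  set y : ℕ → Site L → ZMod 2 := fun i => if i < L + 5 then onGrid L (forwardState R K s (i : ℤ))
    else onGrid L (undoState R K s ((L : ℤ) - 2 - ((i : ℤ) - ((L : ℤ) + 5)))) with hy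
  have hy1 : ∀ i < L + 5, y i = onGrid L (forwardState R K s (i : ℤ)) := fun i hi => if_pos hi
  have hy2 : ∀ j, y (L + 5 + j) = onGrid L (undoState R K s ((L : ℤ) - 2 - (j : ℤ))) := by
    intro j
    simp only [hy]
    rw [if_neg (by omega)]
    congr 2
    push_cast
    ring
  have hy3 : ∀ i ≤ L + 5, y i = onGrid L (forwardState R K s (i : ℤ)) := by
    intro i hi
    rcases hi.lt_or_eq with hi | rfl
    · exact hy1 i hi
    · rw [forwardState_last]
      simpa using hy2 0
  have hstep1 : ∀ i < L + 5, (rows.flatMap fun r : ℕ => sweepStep L r (fwd r) (undo r) i) =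
      rows.flatMap fun r : ℕ => legStep L r (fwd r) (i : ℤ) := fun i hi => by
    simp only [sweepStep, if_pos hi]
  have hstep2 : ∀ j, (rows.flatMap fun r : ℕ => sweepStep L r (fwd r) (undo r) (L + 5 + j)) =
      rows.flatMap fun r : ℕ => legStep L r (undo r) ((L : ℤ) - 2 - (j : ℤ)) := fun j => by
    have h : (L : ℤ) - 2 - (((L + 5 + j : ℕ) : ℤ) - ((L : ℤ) + 5)) = (L : ℤ) - 2 - j := by
      push_cast
      ring
    simp only [sweepStep, if_neg (show ¬ L + 5 + j < L + 5 by omega), h]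
  have key := circuit_range_map (fun i => rows.flatMap fun r : ℕ =>
    sweepStep L r (fwd r) (undo r) i) y (2 * L + 9) (by
      intro i _
      rcases lt_or_ge i (L + 5) with hi | hi
      · rw [hstep1 i hi, hy1 i hi, hy3 (i + 1) hi,
          forwardState_step hR hnd hrows hK (Int.natCast_nonneg i) fun r hr => hf r hr _]
        push_cast
        rfl
      · obtain ⟨j, rfl⟩ := Nat.exists_eq_add_of_le hi
        rw [hstep2, hy2, add_assoc, hy2,
          undoState_step hR hnd hrows hK fun r hr => hu r hr _]
        congr 2
        push_cast
        ring)
  have h0 : y 0 = s := by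
    rw [hy1 0 (by omega)]
    exact forwardState_zero s
  have hlast : y (2 * L + 9) = s := by
    rw [show 2 * L + 9 = L + 5 + (L + 4) by ring, hy2,
      show (L : ℤ) - 2 - ((L + 4 : ℕ) : ℤ) = -6 by push_cast; ring, undoState_last]
  rw [h0, hlast] at key
  refine ⟨key.1, key.2.trans ?_⟩
  rw [show 2 * L + 9 = L + 5 + (L + 4) by ring, Finset.sum_range_add, List.sum_map_add,
    ← sum_list_sum, ← sum_list_sum]
  congr 1
  · refine Finset.sum_congr rfl fun i hi => ?_
    have hi := Finset.mem_range.1 hi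
    rw [hstep1 i hi, hy1 i hi, stepSign_flatMap]
  · refine Finset.sum_congr rfl fun j _ => ?_
    rw [hstep2, hy2, stepSign_flatMap]

/-- A sweep over row `r` touches only the rows `r, …, r + w`, so sweeps over rows more than `w`
apart do not collide. -/
theorem sweeps_valid (hnd : rows.Nodup) {fwd undo : ℕ → List (ℤ × Gadget L)}
    {cf cu : ℕ → ℤ → List (ℤ × ℤ)} {w : ℤ}
    (hf : ∀ r ∈ rows, ∀ t, Occupies (legStep L r (fwd r) t) (cf r t))
    (hu : ∀ r ∈ rows, ∀ t, Occupies (legStep L r (undo r) t) (cu r t))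
    (hcf : ∀ r t, ∀ p ∈ cf r t, (r : ℤ) ≤ p.1 ∧ p.1 ≤ r + w)
    (hcu : ∀ r t, ∀ p ∈ cu r t, (r : ℤ) ≤ p.1 ∧ p.1 ≤ r + w)
    (hrows : ∀ r ∈ rows, ∀ r' ∈ rows, r < r' → (r : ℤ) + w < r') :
    ∀ step ∈ sweeps L rows fwd undo, StepValid (grid L) step := by
  have hdis : ∀ c : ℕ → List (ℤ × ℤ), (∀ r, ∀ p ∈ c r, (r : ℤ) ≤ p.1 ∧ p.1 ≤ r + w) →
      ∀ r ∈ rows, ∀ r' ∈ rows, r ≠ r' → (c r).Disjoint (c r') := by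
    intro c hc r hr r' hr' hne p hp hp'
    have h1 := hc r p hp
    have h2 := hc r' p hp'
    rcases lt_or_gt_of_ne hne with h | h
    · have := hrows r hr r' hr' h
      omega
    · have := hrows r' hr' r hr h
      omega
  intro step hstep
  obtain ⟨i, -, rfl⟩ := List.mem_map.1 hstep
  by_cases hi : i < L + 5
  · refine stepValid_flatMap hnd (cells := fun r => cf r i) (fun r hr => ?_)
      (hdis _ fun r p hp => hcf r i p hp)
    rw [sweepStep, if_pos hi]
    exact hf r hr _
  · refine stepValid_flatMap hnd (cells := fun r => cu r ((L : ℤ) - 2 - ((i : ℤ) - ((L : ℤ) + 5))))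
      (fun r hr => ?_) (hdis _ fun r p hp => hcu r _ p hp)
    rw [sweepStep, if_neg hi]
    exact hu r hr _

end Sweeps

/-! ### The legs of the sweeps -/

section Legs

variable {L : ℕ}

theorem stepDelta_legStep (r : ℤ) (l : List (ℤ × Gadget L)) (t : ℤ) (y : Site L → ZMod 2)
    (v : Site L) : stepDelta (legStep L r l t) y v =
      (if ((v.1 : ℕ) : ℤ) = r ∧ ((v.2 : ℕ) : ℤ) = t + 1 then bitAt y r t else 0) +
        (l.map fun p => stepDelta (p.2 (t + p.1)) y v).sum := by
  rw [legStep, stepDelta_append, stepDelta_flatMap, stepDelta_cnotAt]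

theorem stepSign_legStep (r : ℤ) (l : List (ℤ × Gadget L)) (t : ℤ) (y : Site L → ZMod 2) :
    stepSign (legStep L r l t) y = (l.map fun p => stepSign (p.2 (t + p.1)) y).sum := by
  rw [legStep, stepSign_append, stepSign_flatMap, stepSign_cnotAt, zero_add]

theorem stepDelta_gSkip (ε r c : ℤ) (y : Site L → ZMod 2) (v : Site L) :
    stepDelta (gSkip L ε r c) y v =
      (if ((v.1 : ℕ) : ℤ) = r + 1 ∧ ((v.2 : ℕ) : ℤ) = c + ε then bitAt y r (c + ε) else 0) +
        (if ((v.1 : ℕ) : ℤ) = r + 1 ∧ ((v.2 : ℕ) : ℤ) = c + 3 * ε then bitAt y r (c + 3 * ε)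
          else 0) := by
  simp only [gSkip, stepDelta_append, stepDelta_czAt, stepDelta_cnotAt]
  ring

theorem stepSign_gSkip (ε r c : ℤ) (y : Site L → ZMod 2) :
    stepSign (gSkip L ε r c) y = bitAt y (r + 1) c * bitAt y (r + 2) c +
      bitAt y (r + 1) (c + 2 * ε) * bitAt y (r + 2) (c + 2 * ε) := by
  simp only [gSkip, stepSign_append, stepSign_czAt, stepSign_cnotAt]
  ring

theorem stepDelta_gZ (r c : ℤ) (y : Site L → ZMod 2) (v : Site L) :
    stepDelta (gZ L r c) y v = 0 := by
  rw [gZ]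
  split_ifs
  · exact stepDelta_zAt _ _ _ _
  · rfl

theorem stepSign_gZ (r c : ℤ) (y : Site L → ZMod 2) :
    stepSign (gZ L r c) y = if ((L : ℤ) - 1 - c) % 2 = 1 then bitAt y r c else 0 := by
  rw [gZ]
  split_ifs
  · exact stepSign_zAt _ _ _
  · rfl

variable (L) in
/-- The rows from which a skip-row gadget of phase 2 starts, in the batch `b`. -/
def skipRow (b : ℕ) (r : ℤ) : Prop := r % 4 = b ∧ 0 ≤ r ∧ r + 2 < L

instance (b : ℕ) : DecidablePred (skipRow L b) := fun r => by unfold skipRow; infer_instance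

theorem legDelta_phase2_forward {b r : ℕ} (hr : r % 4 = b) (t : ℤ) :
    LegDelta (skipRow L b) r (legStep L r ((if r + 2 < L then [(-1, gSkip L (-1) r)] else []) ++
      (if 2 ≤ r then [(-5, gSame L r)] else [])) t) t (t - 2) (t - 4) := by
  intro y v
  have hk : skipRow L b r ↔ r + 2 < L := by unfold skipRow; omega
  rw [stepDelta_legStep]
  congr 1
  rw [if_congr hk rfl rfl]
  have h2 : t + -1 + -1 = t - 2 := by ring
  have h4 : t + -1 + -3 = t - 4 := by ring
  by_cases h : r + 2 < L <;> by_cases h' : 2 ≤ r <;>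
    simp [h, h', stepDelta_gSkip, gSame, stepDelta_czAt, h2, h4]

theorem legDelta_phase2_undo {b r : ℕ} (hr : r % 4 = b) (t : ℤ) :
    LegDelta (skipRow L b) r (legStep L r ((if r + 2 < L then [(1, gSkip L 1 r)] else []) ++
      (if 2 ≤ r then [(5, gZ L r)] else [])) t) t (t + 2) (t + 4) := by
  intro y v
  have hk : skipRow L b r ↔ r + 2 < L := by unfold skipRow; omega
  rw [stepDelta_legStep]
  congr 1
  rw [if_congr hk rfl rfl]
  have h2 : t + 1 + 1 = t + 2 := by ring
  have h4 : t + 1 + 3 = t + 4 := by ring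
  by_cases h : r + 2 < L <;> by_cases h' : 2 ≤ r <;>
    simp [h, h', stepDelta_gSkip, stepDelta_gZ, h2, h4]

theorem legDelta_phase4_forward (r : ℕ) (t : ℤ) :
    LegDelta (fun _ => False) r (legStep L r
      ((if r + 1 < L then [(-2, gCross L r)] else []) ++ [(-3, gSame L r)]) t)
      t (t - 2) (t - 4) := by
  intro y v
  rw [stepDelta_legStep]
  by_cases h : r + 1 < L <;> simp [h, gSame, gCross, stepDelta_czAt]

theorem legDelta_phase4_undo (r : ℕ) (t : ℤ) :
    LegDelta (fun _ => False) r (legStep L r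
      ((if r + 1 < L then [(2, gCross L r)] else []) ++ [(3, gZ L r)]) t)
      t (t + 2) (t + 4) := by
  intro y v
  rw [stepDelta_legStep]
  by_cases h : r + 1 < L <;> simp [h, gCross, stepDelta_czAt, stepDelta_gZ]

theorem occupies_gSkip {ε r c : ℤ} (hε : ε = 1 ∨ ε = -1) :
    Occupies (gSkip L ε r c) ([(r + 1, c), (r + 2, c)] ++ [(r, c + ε), (r + 1, c + ε)] ++
      [(r + 1, c + 2 * ε), (r + 2, c + 2 * ε)] ++ [(r, c + 3 * ε), (r + 1, c + 3 * ε)]) := by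
  refine Occupies.append (Occupies.append (Occupies.append (occupies_czAt (by omega))
    (occupies_cnotAt (by omega)) ?_) (occupies_czAt (by omega)) ?_) (occupies_cnotAt (by omega)) ?_
  all_goals
    rintro ⟨i, j⟩ h h'
    simp only [List.mem_append, List.mem_cons, Prod.mk.injEq, List.not_mem_nil, or_false] at h h'
    omega

theorem occupies_gZ (r c : ℤ) : Occupies (gZ L r c) [(r, c)] := by
  rw [gZ]
  exact (occupies_zAt r c).ite _

theorem occupies_legStep {r t : ℤ} {l : List (ℤ × Gadget L)} {a : List (ℤ × ℤ)}
    (hl : Occupies (l.flatMap fun p => p.2 (t + p.1)) a)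
    (h : [(r, t), (r, t + 1)].Disjoint a) :
    Occupies (legStep L r l t) ([(r, t), (r, t + 1)] ++ a) :=
  (occupies_cnotAt (by omega)).append hl h

theorem flatMap_ite_append (p q : Prop) [Decidable p] [Decidable q] (a b : ℤ) (g h : Gadget L)
    (t : ℤ) : (((if p then [(a, g)] else []) ++ (if q then [(b, h)] else [])).flatMap
      fun x : ℤ × Gadget L => x.2 (t + x.1)) =
        (if p then g (t + a) else []) ++ (if q then h (t + b) else []) := by
  split_ifs <;> simp

theorem occupies_phase2_forward (r t : ℤ) (p q : Prop) [Decidable p] [Decidable q] :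
    Occupies (legStep L r ((if p then [(-1, gSkip L (-1) r)] else []) ++
      (if q then [(-5, gSame L r)] else [])) t) ([(r, t), (r, t + 1)] ++
        (([(r + 1, t + -1), (r + 2, t + -1)] ++ [(r, t + -1 + -1), (r + 1, t + -1 + -1)] ++
      [(r + 1, t + -1 + 2 * -1), (r + 2, t + -1 + 2 * -1)] ++
      [(r, t + -1 + 3 * -1), (r + 1, t + -1 + 3 * -1)]) ++
      [(r, t + -5 - 1), (r, t + -5)])) := by
  refine occupies_legStep ?_ ?_
  · rw [flatMap_ite_append]
    refine Occupies.append ((occupies_gSkip (Or.inr rfl)).ite _)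
      (Occupies.ite _ (occupies_czAt (by omega))) ?_
    rintro ⟨i, j⟩ h h'
    simp only [List.mem_append, List.mem_cons, Prod.mk.injEq, List.not_mem_nil, or_false] at h h'
    omega
  · rintro ⟨i, j⟩ h h'
    simp only [List.mem_append, List.mem_cons, Prod.mk.injEq, List.not_mem_nil, or_false] at h h'
    omega

theorem occupies_phase2_undo (r t : ℤ) (p q : Prop) [Decidable p] [Decidable q] :
    Occupies (legStep L r ((if p then [(1, gSkip L 1 r)] else []) ++
      (if q then [(5, gZ L r)] else [])) t) ([(r, t), (r, t + 1)] ++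
        (([(r + 1, t + 1), (r + 2, t + 1)] ++ [(r, t + 1 + 1), (r + 1, t + 1 + 1)] ++
      [(r + 1, t + 1 + 2 * 1), (r + 2, t + 1 + 2 * 1)] ++
      [(r, t + 1 + 3 * 1), (r + 1, t + 1 + 3 * 1)]) ++ [(r, t + 5)])) := by
  refine occupies_legStep ?_ ?_
  · rw [flatMap_ite_append]
    refine Occupies.append ((occupies_gSkip (Or.inl rfl)).ite _) ((occupies_gZ _ _).ite _) ?_
    rintro ⟨i, j⟩ h h'
    simp only [List.mem_append, List.mem_cons, Prod.mk.injEq, List.not_mem_nil, or_false] at h h'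
    omega
  · rintro ⟨i, j⟩ h h'
    simp only [List.mem_append, List.mem_cons, Prod.mk.injEq, List.not_mem_nil, or_false] at h h'
    omega

theorem occupies_phase4_forward (r t : ℤ) (p : Prop) [Decidable p] :
    Occupies (legStep L r ((if p then [(-2, gCross L r)] else []) ++ [(-3, gSame L r)]) t)
      ([(r, t), (r, t + 1)] ++ ([(r, t + -2), (r + 1, t + -2)] ++
        [(r, t + -3 - 1), (r, t + -3)])) := by
  refine occupies_legStep ?_ ?_
  · refine (congrArg (Occupies · _) (flatMap_ite_append p True (-2) (-3) (gCross L r)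
      (gSame L r) t)).mpr ?_
    refine Occupies.append (Occupies.ite _ (occupies_czAt (by omega)))
      (Occupies.ite _ (occupies_czAt (by omega))) ?_
    rintro ⟨i, j⟩ h h'
    simp only [List.mem_cons, Prod.mk.injEq, List.not_mem_nil, or_false] at h h'
    omega
  · rintro ⟨i, j⟩ h h'
    simp only [List.mem_append, List.mem_cons, Prod.mk.injEq, List.not_mem_nil, or_false] at h h'
    omega

theorem occupies_phase4_undo (r t : ℤ) (p : Prop) [Decidable p] :
    Occupies (legStep L r ((if p then [(2, gCross L r)] else []) ++ [(3, gZ L r)]) t)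
      ([(r, t), (r, t + 1)] ++ ([(r, t + 2), (r + 1, t + 2)] ++ [(r, t + 3)])) := by
  refine occupies_legStep ?_ ?_
  · refine (congrArg (Occupies · _) (flatMap_ite_append p True 2 3 (gCross L r)
      (gZ L r) t)).mpr ?_
    refine Occupies.append (Occupies.ite _ (occupies_czAt (by omega)))
      ((occupies_gZ _ _).ite _) ?_
    rintro ⟨i, j⟩ h h'
    simp only [List.mem_cons, Prod.mk.injEq, List.not_mem_nil, or_false] at h h'
    omega
  · rintro ⟨i, j⟩ h h'
    simp only [List.mem_append, List.mem_cons, Prod.mk.injEq, List.not_mem_nil, or_false] at h h'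
    omega

/-! ### Validity of the circuit for `Γ`. -/

theorem gammaPhase2_valid (b : ℕ) : ∀ step ∈ gammaPhase2 L b, StepValid (grid L) step := by
  refine sweeps_valid (w := 2) (List.nodup_range.filter _)
    (fun r _ t => occupies_phase2_forward r t _ _) (fun r _ t => occupies_phase2_undo r t _ _)
    ?_ ?_ ?_
  · rintro r t ⟨i, j⟩ h
    simp only [List.mem_append, List.mem_cons, Prod.mk.injEq, List.not_mem_nil, or_false] at h
    omega
  · rintro r t ⟨i, j⟩ h
    simp only [List.mem_append, List.mem_cons, Prod.mk.injEq, List.not_mem_nil, or_false] at h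
    omega
  · intro r hr r' hr' h
    simp only [List.mem_filter, decide_eq_true_eq] at hr hr'
    omega

theorem gammaPhase4_valid : ∀ step ∈ gammaPhase4 L, StepValid (grid L) step := by
  refine sweeps_valid (w := 1) (List.nodup_range.filter _)
    (fun r _ t => occupies_phase4_forward r t _) (fun r _ t => occupies_phase4_undo r t _) ?_ ?_ ?_
  · rintro r t ⟨i, j⟩ h
    simp only [List.mem_append, List.mem_cons, Prod.mk.injEq, List.not_mem_nil, or_false] at h
    omega
  · rintro r t ⟨i, j⟩ h
    simp only [List.mem_append, List.mem_cons, Prod.mk.injEq, List.not_mem_nil, or_false] at h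
    omega
  · intro r hr r' hr' h
    simp only [List.mem_filter, decide_eq_true_eq] at hr hr'
    omega

theorem gammaCircuit_valid : ∀ step ∈ gammaCircuit L, StepValid (grid L) step := by
  intro step h
  simp only [gammaCircuit, List.mem_append] at h
  rcases h with ((h | h | h) | h) | h
  · obtain ⟨r, -, rfl⟩ := List.mem_map.1 h
    exact verticalCNOTs_valid r
  · exact gammaPhase2_valid 0 step h
  · exact gammaPhase2_valid 2 step h
  · obtain ⟨r, -, rfl⟩ := List.mem_map.1 h
    exact verticalCNOTs_valid r
  · exact gammaPhase4_valid step h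

end Legs

/-! ### The signs of the sweeps -/

section SweepSigns

variable {L : ℕ}

/-- A gadget with offset `-k` visits column `i - k` at time `i`; the times `0, …, L + 4` reach each
column of the grid exactly once. -/
theorem sum_forward_times {g : ℤ → ZMod 2} (hg : ∀ c, ¬ (0 ≤ c ∧ c < (L : ℤ)) → g c = 0) {k : ℤ}
    (hk : 0 ≤ k ∧ k ≤ 5) :
    ∑ i ∈ Finset.range (L + 5), g ((i : ℤ) - k) = ∑ c ∈ Finset.range L, g (c : ℤ) := by
  symm
  refine Finset.sum_of_injOn (fun c => c + k.toNat) (by simp) ?_ ?_ ?_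
  · intro c hc
    simp only [Finset.coe_range, Set.mem_Iio] at hc ⊢
    omega
  · intro i _ hi
    refine hg _ fun h => hi ⟨((i : ℤ) - k).toNat, ?_, ?_⟩
    · simp only [Finset.coe_range, Set.mem_Iio]
      omega
    · dsimp only
      omega
  · intro c _
    congr 1
    omega

/-- The times run from `L - 2` down to `-5`: `1 ≤ k` is needed to reach column `L - 1`, and `k ≤ 5`
to reach column `0`. -/
theorem sum_undo_times {g : ℤ → ZMod 2} (hg : ∀ c, ¬ (0 ≤ c ∧ c < (L : ℤ)) → g c = 0) {k : ℤ}
    (hk : 1 ≤ k ∧ k ≤ 5) :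
    ∑ j ∈ Finset.range (L + 4), g ((L : ℤ) - 2 - (j : ℤ) + k) =
      ∑ c ∈ Finset.range L, g (c : ℤ) := by
  symm
  refine Finset.sum_of_injOn (fun c => ((L : ℤ) - 2 - c + k).toNat) ?_ ?_ ?_ ?_
  · intro c hc d hd h
    simp only [Finset.coe_range, Set.mem_Iio] at hc hd
    dsimp only at h
    omega
  · intro c hc
    simp only [Finset.coe_range, Set.mem_Iio] at hc ⊢
    omega
  · intro j _ hj
    refine hg _ fun h => hj ⟨((L : ℤ) - 2 - (j : ℤ) + k).toNat, ?_, ?_⟩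
    · simp only [Finset.coe_range, Set.mem_Iio]
      omega
    · dsimp only
      omega
  · intro c hc
    have := Finset.mem_range.1 hc
    congr 1
    omega

/-- The parity of the pairs of occupied sites `(r, j)`, `(r', c)` with `j < c`. -/
def rowPairs (s : Site L → ZMod 2) (r r' : ℤ) : ZMod 2 :=
  ∑ c ∈ Finset.range L, prefixParity s r ((c : ℤ) - 1) * bitAt s r' c

/-- The value at `c` is counted once for each larger index, that is `n - 1 - c` times. -/
theorem sum_range_prefix (a : ℕ → ZMod 2) (n : ℕ) :
    ∑ c ∈ Finset.range n, ∑ j ∈ Finset.range c, a j =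
      ∑ c ∈ Finset.range n, if ((n : ℤ) - 1 - c) % 2 = 1 then a c else 0 := by
  induction n with
  | zero => rfl
  | succ n ih =>
    rw [Finset.sum_range_succ, ih, ← Finset.sum_add_distrib, Finset.sum_range_succ, if_neg
      (by push_cast; omega), add_zero]
    refine Finset.sum_congr rfl fun c _ => ?_
    by_cases h : ((n : ℤ) - 1 - c) % 2 = 1
    · rw [if_pos h, if_neg (by push_cast; omega), CharTwo.add_self_eq_zero]
    · rw [if_neg h, if_pos (by push_cast; omega), zero_add]

/-- Since `p * p = p` in `ZMod 2`, the product of consecutive prefix parities is the desired term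
plus a bare prefix parity. By `sum_range_prefix` the `Z` corrections cancel precisely these linear
terms. -/
theorem rowPairs_self (s : Site L → ZMod 2) (r : ℤ) :
    ∑ c ∈ Finset.range L, prefixParity s r ((c : ℤ) - 1) * prefixParity s r c +
      (∑ c ∈ Finset.range L, if ((L : ℤ) - 1 - c) % 2 = 1 then bitAt s r c else 0) =
    rowPairs s r r := by
  rw [← sum_range_prefix fun c => bitAt s r c, rowPairs, ← Finset.sum_add_distrib]
  refine Finset.sum_congr rfl fun c _ => ?_
  have h : prefixParity s r ((c : ℤ) - 1) = ∑ j ∈ Finset.range c, bitAt s r j := by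
    rw [prefixParity, sub_add_cancel, Int.toNat_natCast]
  have hsq : ∀ p : ZMod 2, p * p = p := by decide
  rw [prefixParity_eq_add s r (Int.natCast_nonneg c), ← h, mul_add, hsq, add_right_comm,
    CharTwo.add_self_eq_zero, zero_add]

variable {R K : ℤ → Prop} [DecidablePred R] [DecidablePred K]

theorem bitAt_forwardState_row (s : Site L → ZMod 2) {r c i : ℤ} (hr : R r)
    (hL : 0 ≤ r ∧ r < L) (hc : c ≤ i) : bitAt (onGrid L (forwardState R K s i)) r c =
      if 0 ≤ c ∧ c < L then prefixParity s r c else 0 := by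
  rw [bitAt_onGrid, forwardState, if_pos hr, if_pos hc]
  exact if_congr (by tauto) rfl rfl

theorem bitAt_undoState_row (s : Site L → ZMod 2) {r c t : ℤ} (hr : R r) (hc : t + 2 ≤ c) :
    bitAt (onGrid L (undoState R K s t)) r c = bitAt s r c := by
  rw [bitAt_onGrid, undoState, if_pos hr, if_pos hc]
  split_ifs with h
  · rfl
  · rw [bitAt_of_not _ h]

theorem bitAt_forwardState_below (s : Site L → ZMod 2) {r c i : ℤ} (hr : ¬ R r)
    (hc : ¬ (K (r - 1) ∧ c + 3 ≤ i ∧ i ≤ c + 4)) :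
    bitAt (onGrid L (forwardState R K s i)) r c = bitAt s r c := by
  rw [bitAt_onGrid, forwardState, if_neg hr, if_neg hc, add_zero]
  split_ifs with h
  · rfl
  · rw [bitAt_of_not _ h]

theorem bitAt_undoState_below (s : Site L → ZMod 2) {r c t : ℤ} (hr : ¬ R r)
    (hc : ¬ (K (r - 1) ∧ c - 4 ≤ t ∧ t ≤ c - 3)) :
    bitAt (onGrid L (undoState R K s t)) r c = bitAt s r c := by
  rw [bitAt_onGrid, undoState, if_neg hr, if_neg hc, add_zero]
  split_ifs with h
  · rfl
  · rw [bitAt_of_not _ h]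

/-- The two CZ gates meet row `r + 1` in different states: in column `i - 1` before the prefix
parity of row `r` has been added, and in column `i - 3` while it is present. -/
theorem stepSign_gSkip_forward (hR : ∀ r, R r → ¬ R (r + 1))
    (hK : ∀ r, K r → 0 ≤ r ∧ r + 2 < L ∧ R r) (hK' : ∀ r, K r → ¬ R (r + 2))
    (s : Site L → ZMod 2) {r : ℤ} (hr : K r) (i : ℤ) :
    stepSign (gSkip L (-1) r (i + -1)) (onGrid L (forwardState R K s i)) =
      bitAt s (r + 1) (i - 1) * bitAt s (r + 2) (i - 1) +
        (bitAt s (r + 1) (i - 3) + prefixParity s r (i - 3)) * bitAt s (r + 2) (i - 3) := by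
  have h0 := hK r hr
  have h1 := hR r h0.2.2
  have h2 := hK' r hr
  have h3 : ¬ K (r + 2 - 1) := fun h => h1 (by
    have := (hK _ h).2.2
    rwa [show r + 2 - 1 = r + 1 by ring] at this)
  rw [stepSign_gSkip, show i + -1 + 2 * -1 = i - 3 by ring, show i + -1 = i - 1 by ring,
    bitAt_forwardState_below s h1 (by omega), bitAt_forwardState_below s h2 fun h => h3 h.1,
    bitAt_forwardState_below s h2 fun h => h3 h.1]
  congr 1
  rw [bitAt_onGrid]
  split_ifs with h
  · rw [forwardState, if_neg h1, add_sub_cancel_right, if_pos ⟨hr, by omega⟩]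
  -- Beyond the last column `prefixParity` need not vanish, but the bit of row `r + 2` does.
  · rw [bitAt_of_not s (r := r + 2) (by omega), mul_zero, mul_zero]

theorem stepSign_gSkip_undo (hR : ∀ r, R r → ¬ R (r + 1))
    (hK : ∀ r, K r → 0 ≤ r ∧ r + 2 < L ∧ R r) (hK' : ∀ r, K r → ¬ R (r + 2))
    (s : Site L → ZMod 2) {r : ℤ} (hr : K r) (t : ℤ) :
    stepSign (gSkip L 1 r (t + 1)) (onGrid L (undoState R K s t)) =
      bitAt s (r + 1) (t + 1) * bitAt s (r + 2) (t + 1) +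
        (bitAt s (r + 1) (t + 3) + bitAt s r (t + 3)) * bitAt s (r + 2) (t + 3) := by
  have h0 := hK r hr
  have h1 := hR r h0.2.2
  have h2 := hK' r hr
  have h3 : ¬ K (r + 2 - 1) := fun h => h1 (by
    have := (hK _ h).2.2
    rwa [show r + 2 - 1 = r + 1 by ring] at this)
  rw [stepSign_gSkip, show t + 1 + 2 * 1 = t + 3 by ring,
    bitAt_undoState_below s h1 (by omega), bitAt_undoState_below s h2 fun h => h3 h.1,
    bitAt_undoState_below s h2 fun h => h3 h.1]
  congr 1
  rw [bitAt_onGrid]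
  split_ifs with h
  · rw [undoState, if_neg h1, add_sub_cancel_right, if_pos ⟨hr, by omega⟩]
  · rw [bitAt_of_not s (r := r + 2) (by omega), mul_zero, mul_zero]

theorem bitAt_column_of_not (s : Site L → ZMod 2) (r : ℤ) {c : ℤ} (h : ¬ (0 ≤ c ∧ c < (L : ℤ))) :
    bitAt s r c = 0 :=
  bitAt_of_not s fun h' => h h'.2

/-- A strict prefix parity is the inclusive one plus the bit. The forward leg of a sweep produces
the first sum and the undo leg the second. -/
theorem rowPairs_eq (s : Site L → ZMod 2) (r r' : ℤ) : rowPairs s r r' =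
    ∑ c ∈ Finset.range L, prefixParity s r c * bitAt s r' c +
      ∑ c ∈ Finset.range L, bitAt s r c * bitAt s r' c := by
  rw [rowPairs, ← Finset.sum_add_distrib]
  refine Finset.sum_congr rfl fun c _ => ?_
  rw [prefixParity_eq_add s r (Int.natCast_nonneg c), ← add_mul, add_assoc,
    CharTwo.add_self_eq_zero, add_zero]

/-- Products of bits of rows `r + 1` and `r + 2` occur twice in each leg and cancel, so row `r`
interacts with row `r + 2` through nearest-neighbour gates only. -/
theorem sum_gSkip (hR : ∀ r, R r → ¬ R (r + 1))
    (hK : ∀ r, K r → 0 ≤ r ∧ r + 2 < L ∧ R r) (hK' : ∀ r, K r → ¬ R (r + 2))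
    (s : Site L → ZMod 2) {r : ℤ} (hr : K r) :
    ∑ i ∈ Finset.range (L + 5),
        stepSign (gSkip L (-1) r ((i : ℤ) + -1)) (onGrid L (forwardState R K s i)) +
      ∑ j ∈ Finset.range (L + 4), stepSign (gSkip L 1 r ((L : ℤ) - 2 - (j : ℤ) + 1))
        (onGrid L (undoState R K s ((L : ℤ) - 2 - (j : ℤ)))) = rowPairs s r (r + 2) := by
  have h1 : ∀ c, ¬ (0 ≤ c ∧ c < (L : ℤ)) → bitAt s (r + 1) c * bitAt s (r + 2) c = 0 :=
    fun c hc => by rw [bitAt_column_of_not s (r + 2) hc, mul_zero]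
  have h2 : ∀ c, ¬ (0 ≤ c ∧ c < (L : ℤ)) →
      (bitAt s (r + 1) c + prefixParity s r c) * bitAt s (r + 2) c = 0 :=
    fun c hc => by rw [bitAt_column_of_not s (r + 2) hc, mul_zero]
  have h3 : ∀ c, ¬ (0 ≤ c ∧ c < (L : ℤ)) →
      (bitAt s (r + 1) c + bitAt s r c) * bitAt s (r + 2) c = 0 :=
    fun c hc => by rw [bitAt_column_of_not s (r + 2) hc, mul_zero]
  simp only [stepSign_gSkip_forward hR hK hK' s hr, stepSign_gSkip_undo hR hK hK' s hr,
    Finset.sum_add_distrib]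
  rw [sum_forward_times h1 (k := 1) (by norm_num), sum_forward_times h2 (k := 3) (by norm_num),
    sum_undo_times h1 (k := 1) (by norm_num), sum_undo_times h3 (k := 3) (by norm_num),
    add_add_add_comm, CharTwo.add_self_eq_zero, zero_add, rowPairs_eq]
  simp only [add_mul, Finset.sum_add_distrib]
  rw [add_add_add_comm, CharTwo.add_self_eq_zero, zero_add]

/-- The bound `2 ≤ k` lets the `Z` corrections act on restored columns only. Phase 2 uses `k = 5`,
behind the skip gadget, and phase 4 uses `k = 3`. -/
theorem sum_gSame_gZ (s : Site L → ZMod 2) {r : ℤ} (hr : R r) (hL : 0 ≤ r ∧ r < L) {k : ℤ}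
    (hk : 2 ≤ k ∧ k ≤ 5) :
    ∑ i ∈ Finset.range (L + 5),
        stepSign (gSame L r ((i : ℤ) + -k)) (onGrid L (forwardState R K s i)) +
      ∑ j ∈ Finset.range (L + 4), stepSign (gZ L r ((L : ℤ) - 2 - (j : ℤ) + k))
        (onGrid L (undoState R K s ((L : ℤ) - 2 - (j : ℤ)))) = rowPairs s r r := by
  have h1 : ∀ c, ¬ (0 ≤ c ∧ c < (L : ℤ)) → (if 0 ≤ c ∧ c < (L : ℤ) then
      prefixParity s r (c - 1) * prefixParity s r c else 0) = 0 := fun c hc => if_neg hc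
  have h2 : ∀ c, ¬ (0 ≤ c ∧ c < (L : ℤ)) →
      (if ((L : ℤ) - 1 - c) % 2 = 1 then bitAt s r c else 0) = 0 := fun c hc => by
    rw [bitAt_column_of_not s r hc, ite_self]
  have h3 : ∀ i : ℤ, stepSign (gSame L r (i + -k)) (onGrid L (forwardState R K s i)) =
      if 0 ≤ i - k ∧ i - k < (L : ℤ) then
        prefixParity s r (i - k - 1) * prefixParity s r (i - k) else 0 := by
    intro i
    rw [gSame, stepSign_czAt, ← sub_eq_add_neg, bitAt_forwardState_row s hr hL (by omega),
      bitAt_forwardState_row s hr hL (by omega)]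
    by_cases h : 0 ≤ i - k ∧ i - k < (L : ℤ)
    · rw [if_pos h, if_pos h]
      by_cases h' : 0 ≤ i - k - 1
      · rw [if_pos (by omega)]
      · rw [prefixParity_neg s r (c := i - k - 1) (by omega), ite_self]
    · rw [if_neg h, if_neg h, mul_zero]
  have h4 : ∀ t : ℤ, stepSign (gZ L r (t + k)) (onGrid L (undoState R K s t)) =
      if ((L : ℤ) - 1 - (t + k)) % 2 = 1 then bitAt s r (t + k) else 0 := by
    intro t
    rw [stepSign_gZ, bitAt_undoState_row s hr (by omega)]
  simp only [h3, h4]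
  rw [sum_forward_times h1 (by omega), sum_undo_times h2 (by omega), ← rowPairs_self]
  congr 1
  refine Finset.sum_congr rfl fun c hc => if_pos ?_
  have := Finset.mem_range.1 hc
  omega

theorem sum_gCross (hR : ∀ r, R r → ¬ R (r + 1)) (hK : ∀ r, ¬ K r)
    (s : Site L → ZMod 2) {r : ℤ} (hr : R r) (hL : 0 ≤ r ∧ r < L) :
    ∑ i ∈ Finset.range (L + 5),
        stepSign (gCross L r ((i : ℤ) + -2)) (onGrid L (forwardState R K s i)) +
      ∑ j ∈ Finset.range (L + 4), stepSign (gCross L r ((L : ℤ) - 2 - (j : ℤ) + 2))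
        (onGrid L (undoState R K s ((L : ℤ) - 2 - (j : ℤ)))) = rowPairs s r (r + 1) := by
  have h1 : ∀ c, ¬ (0 ≤ c ∧ c < (L : ℤ)) → prefixParity s r c * bitAt s (r + 1) c = 0 :=
    fun c hc => by rw [bitAt_column_of_not s (r + 1) hc, mul_zero]
  have h2 : ∀ c, ¬ (0 ≤ c ∧ c < (L : ℤ)) → bitAt s r c * bitAt s (r + 1) c = 0 :=
    fun c hc => by rw [bitAt_column_of_not s (r + 1) hc, mul_zero]
  have h3 : ∀ i : ℤ, stepSign (gCross L r (i + -2)) (onGrid L (forwardState R K s i)) =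
      prefixParity s r (i - 2) * bitAt s (r + 1) (i - 2) := by
    intro i
    rw [gCross, stepSign_czAt, ← sub_eq_add_neg, bitAt_forwardState_row s hr hL (by omega),
      bitAt_forwardState_below s (hR r hr) fun h => hK _ h.1]
    split_ifs with h
    · rfl
    · rw [bitAt_column_of_not s (r + 1) h, mul_zero, mul_zero]
  have h4 : ∀ t : ℤ, stepSign (gCross L r (t + 2)) (onGrid L (undoState R K s t)) =
      bitAt s r (t + 2) * bitAt s (r + 1) (t + 2) := by
    intro t
    rw [gCross, stepSign_czAt, bitAt_undoState_row s hr (by omega),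
      bitAt_undoState_below s (hR r hr) fun h => hK _ h.1]
  simp only [h3, h4]
  rw [sum_forward_times h1 (by omega), sum_undo_times h2 (by omega), rowPairs_eq]

/-! ### Signs of phases 2 and 4. -/

theorem gammaPhase2_eval (b : ℕ) (s : Site L → ZMod 2) :
    circuitBits (gammaPhase2 L b) s = s ∧ circuitSign (gammaPhase2 L b) s =
      (((List.range L).filter fun r => r % 4 = b).map fun r : ℕ =>
        (if r + 2 < L then rowPairs s r (r + 2) else 0) +
          if 2 ≤ r then rowPairs s r r else 0).sum := by
  have hR : ∀ r : ℤ, r % 4 = b → ¬ (r + 1) % 4 = b := fun r h => by omega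
  have hK : ∀ r, skipRow L b r → 0 ≤ r ∧ r + 2 < L ∧ r % 4 = b := fun r h => ⟨h.2.1, h.2.2, h.1⟩
  have hK' : ∀ r, skipRow L b r → ¬ (r + 2) % 4 = b := fun r h => by have := h.1; omega
  have hmem : ∀ r : ℕ, r ∈ (List.range L).filter (fun r => r % 4 = b) ↔
      r < L ∧ (r : ℤ) % 4 = b := fun r => by
    simp only [List.mem_filter, List.mem_range, decide_eq_true_eq]
    omega
  obtain ⟨h1, h2⟩ := sweeps_eval (R := fun r => r % 4 = b) (K := skipRow L b) hR
    (List.nodup_range.filter _) hmem hK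
    (fun r hr t => legDelta_phase2_forward (by have := ((hmem r).1 hr).2; omega) t)
    (fun r hr t => legDelta_phase2_undo (by have := ((hmem r).1 hr).2; omega) t) s
  refine ⟨h1, h2.trans (congrArg List.sum (List.map_congr_left fun r hr => ?_))⟩
  obtain ⟨h3, h4⟩ := (hmem r).1 hr
  have hk : r + 2 < L → skipRow L b r := fun h => ⟨h4, by omega, by omega⟩
  have hsame := sum_gSame_gZ (K := skipRow L b) (R := fun r => r % 4 = b) s h4
    (by omega) (k := 5) (by norm_num)
  simp only [stepSign_legStep]
  by_cases h : r + 2 < L <;> by_cases h' : 2 ≤ r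
  · have hskip := sum_gSkip (R := fun r => r % 4 = b) hR hK hK' s (hk h)
    simp only [if_pos h, if_pos h', List.singleton_append, List.map_cons, List.map_nil,
      List.sum_cons, List.sum_nil, add_zero, Finset.sum_add_distrib]
    rw [add_add_add_comm, hskip, hsame]
  · have hskip := sum_gSkip (R := fun r => r % 4 = b) hR hK hK' s (hk h)
    simpa [h, h'] using hskip
  · simpa [h, h'] using hsame
  · simp [h, h']

theorem gammaPhase4_eval (s : Site L → ZMod 2) :
    circuitBits (gammaPhase4 L) s = s ∧ circuitSign (gammaPhase4 L) s =
      (((List.range L).filter fun r => r % 2 = 0).map fun r : ℕ =>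
        (if r + 1 < L then rowPairs s r (r + 1) else 0) + rowPairs s r r).sum := by
  have hR : ∀ r : ℤ, r % 2 = 0 → ¬ (r + 1) % 2 = 0 := fun r h => by omega
  have hmem : ∀ r : ℕ, r ∈ (List.range L).filter (fun r => r % 2 = 0) ↔
      r < L ∧ (r : ℤ) % 2 = 0 := fun r => by
    simp only [List.mem_filter, List.mem_range, decide_eq_true_eq]
    omega
  obtain ⟨h1, h2⟩ := sweeps_eval (R := fun r => r % 2 = 0) (K := fun _ => False) hR
    (List.nodup_range.filter _) hmem (fun _ h => h.elim)
    (fun r _ t => legDelta_phase4_forward r t) (fun r _ t => legDelta_phase4_undo r t) s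
  refine ⟨h1, h2.trans (congrArg List.sum (List.map_congr_left fun r hr => ?_))⟩
  obtain ⟨h3, h4⟩ := (hmem r).1 hr
  have hsame := sum_gSame_gZ (K := fun _ => False) (R := fun r => r % 2 = 0) s h4
    (by omega) (k := 3) (by norm_num)
  have hcross := sum_gCross (R := fun r => r % 2 = 0) (K := fun _ => False) hR (fun _ => id) s h4
    (by omega)
  simp only [stepSign_legStep]
  by_cases h : r + 1 < L
  · simp only [if_pos h, List.singleton_append, List.map_cons, List.map_nil,
      List.sum_cons, List.sum_nil, add_zero, Finset.sum_add_distrib]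
    rw [add_add_add_comm, hcross, hsame]
  · simpa [h] using hsame

end SweepSigns

/-! ### The sign of the circuit for `Γ` -/

section GammaSign

/-- The parity of the pairs `j < c` below `n`, weighted by `a` and `b`. -/
def orderedPairs (n : ℕ) (a b : ℕ → ZMod 2) : ZMod 2 :=
  ∑ c ∈ Finset.range n, (∑ j ∈ Finset.range c, a j) * b c

theorem orderedPairs_add_left (n : ℕ) (a a' b : ℕ → ZMod 2) :
    orderedPairs n (a + a') b = orderedPairs n a b + orderedPairs n a' b := by
  simp [orderedPairs, Finset.sum_add_distrib, add_mul]

theorem orderedPairs_add_right (n : ℕ) (a b b' : ℕ → ZMod 2) :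
    orderedPairs n a (b + b') = orderedPairs n a b + orderedPairs n a b' := by
  simp [orderedPairs, Finset.sum_add_distrib, mul_add]

theorem orderedPairs_zero_right (n : ℕ) (a : ℕ → ZMod 2) : orderedPairs n a 0 = 0 := by
  simp [orderedPairs]

theorem orderedPairs_eq_sum_ite (n : ℕ) (a b : ℕ → ZMod 2) : orderedPairs n a b =
    ∑ j ∈ Finset.range n, ∑ c ∈ Finset.range n, if j < c then a j * b c else 0 := by
  rw [orderedPairs, Finset.sum_comm]
  refine Finset.sum_congr rfl fun c hc => ?_
  have := Finset.mem_range.1 hc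
  rw [Finset.sum_mul, ← Finset.sum_filter]
  refine Finset.sum_congr ?_ fun _ _ => rfl
  ext j
  simp only [Finset.mem_range, Finset.mem_filter]
  omega

/-- The telescoping identity behind the two sweep phases. -/
theorem sum_even_rows {n : ℕ} {X S : ℕ → ℕ → ZMod 2} (hS : ∀ r, S r = X r + S (r + 1)) (m : ℕ) :
    (∑ r ∈ Finset.range m, if r % 2 = 0 then orderedPairs n (S r) (S (r + 2)) +
        (if 2 ≤ r then orderedPairs n (S r) (S r) else 0) +
        orderedPairs n (X r) (X (r + 1)) else 0) =
      ∑ r ∈ Finset.range m, orderedPairs n (X r) (S (r + 1)) +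
        if m % 2 = 0 then (if 1 ≤ m then orderedPairs n (S m) (S m) else 0)
        else orderedPairs n (S m) (S (m + 1)) := by
  -- The boundary term is the excess of the left side after `m` rows. An even row turns `⟨S m, S m⟩`
  -- into `⟨S (m + 1), S (m + 2)⟩`, and an odd row turns `⟨S m, S (m + 1)⟩` into `⟨S (m + 1), S (m +
  -- 1)⟩`; past the last row `S` is zero.
  induction m with
  | zero => simp
  | succ m ih =>
    rw [Finset.sum_range_succ, Finset.sum_range_succ, ih]
    by_cases hm : m % 2 = 0
    · rw [if_pos hm, if_pos hm, if_neg (show ¬ (m + 1) % 2 = 0 by omega)]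
      have h1 : (if 2 ≤ m then orderedPairs n (S m) (S m) else 0) =
          if 1 ≤ m then orderedPairs n (S m) (S m) else 0 := if_congr (by omega) rfl rfl
      have h2 : orderedPairs n (S m) (S (m + 2)) + orderedPairs n (X m) (X (m + 1)) =
          orderedPairs n (X m) (S (m + 1)) + orderedPairs n (S (m + 1)) (S (m + 2)) := by
        rw [hS m, hS (m + 1), orderedPairs_add_left, orderedPairs_add_right n (X m)]
        simp only [orderedPairs_add_left]
        ring
      rw [h1]
      linear_combination h2 + CharTwo.add_self_eq_zero
        (if 1 ≤ m then orderedPairs n (S m) (S m) else 0)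
    · rw [if_neg hm, if_neg hm, if_pos (show (m + 1) % 2 = 0 by omega),
        if_pos (show 1 ≤ m + 1 by omega), add_zero]
      have h2 : orderedPairs n (S m) (S (m + 1)) =
          orderedPairs n (X m) (S (m + 1)) + orderedPairs n (S (m + 1)) (S (m + 1)) := by
        rw [← orderedPairs_add_left, ← hS m]
      rw [h2, add_assoc]

theorem sum_map_filter_range (n : ℕ) (p : ℕ → Prop) [DecidablePred p] (f : ℕ → ZMod 2) :
    (((List.range n).filter p).map f).sum = ∑ r ∈ Finset.range n, if p r then f r else 0 := by
  induction n with
  | zero => rfl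
  | succ n ih =>
    rw [List.range_succ, List.filter_append, List.map_append, List.sum_append, ih,
      Finset.sum_range_succ]
    by_cases h : p n <;> simp [h]

variable {L : ℕ}

theorem rowPairs_eq_orderedPairs (s : Site L → ZMod 2) (r r' : ℤ) :
    rowPairs s r r' = orderedPairs L (fun c => bitAt s r c) (fun c => bitAt s r' c) := by
  refine Finset.sum_congr rfl fun c _ => ?_
  rw [prefixParity, sub_add_cancel, Int.toNat_natCast]

/-! ### The disagreement of the snake and column orders, row by row. -/

theorem sum_site (f : ℕ → ℕ → ZMod 2) : ∑ v : Site L, f v.1 v.2 =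
    ∑ r ∈ Finset.range L, ∑ c ∈ Finset.range L, f r c := by
  rw [Fintype.sum_prod_type, ← Fin.sum_univ_eq_sum_range fun r => ∑ c ∈ Finset.range L, f r c]
  exact Finset.sum_congr rfl fun r _ => Fin.sum_univ_eq_sum_range (f r) L

/-- `columnKey` runs from the last column to the first, as the snake does in odd rows; so within a
row the orders disagree only if the row is even. -/
theorem snakeKey_lt_columnKey_lt_iff (p q : Site L) :
    snakeKey L p < snakeKey L q ∧ columnKey L q < columnKey L p ↔
      (p.2 : ℕ) < q.2 ∧ ((p.1 : ℕ) < q.1 ∨ (p.1 : ℕ) = q.1 ∧ (p.1 : ℕ) % 2 = 0) := by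
  have hp1 := p.1.2
  have hp2 := p.2.2
  have hq1 := q.1.2
  have hq2 := q.2.2
  have key : ∀ a b c d : ℕ, a < L → c < L → (a + L * b < c + L * d ↔ b < d ∨ b = d ∧ a < c) := by
    intro a b c d ha hc
    rcases lt_trichotomy b d with h | rfl | h
    · have := Nat.mul_le_mul_left L (Nat.succ_le_of_lt h)
      rw [Nat.mul_succ] at this
      omega
    · omega
    · have := Nat.mul_le_mul_left L (Nat.succ_le_of_lt h)
      rw [Nat.mul_succ] at this
      omega
  rw [snakeKey_eq, snakeKey_eq, columnKey, columnKey, key _ _ _ _ (by split_ifs <;> omega)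
    (by split_ifs <;> omega), key _ _ _ _ hq1 hp1]
  split_ifs <;> omega

/-- For a fixed site `(r, j)` and a fixed column `c > j`, the partners in all rows below `r` add up
to the suffix parity of row `r + 1`. -/
theorem disagreement_snakeKey_columnKey (x : Site L → ZMod 2) :
    disagreement (snakeKey L) (columnKey L) x =
      ∑ r ∈ Finset.range L, (orderedPairs L (fun c => bitAt x r c)
        (fun c => suffixParity x (r + 1) c) +
          if r % 2 = 0 then orderedPairs L (fun c => bitAt x r c) (fun c => bitAt x r c) else 0) := by
  have h : disagreement (snakeKey L) (columnKey L) x =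
      ∑ r ∈ Finset.range L, ∑ j ∈ Finset.range L, ∑ r' ∈ Finset.range L, ∑ c ∈ Finset.range L,
        if j < c ∧ (r < r' ∨ r = r' ∧ r % 2 = 0) then bitAt x r j * bitAt x r' c else 0 := by
    rw [disagreement, ← sum_site fun r j => ∑ r' ∈ Finset.range L, ∑ c ∈ Finset.range L,
        if j < c ∧ (r < r' ∨ r = r' ∧ r % 2 = 0) then bitAt x r j * bitAt x r' c else 0]
    refine Finset.sum_congr rfl fun p _ => ?_
    rw [← sum_site fun r' c => if (p.2 : ℕ) < c ∧ ((p.1 : ℕ) < r' ∨ (p.1 : ℕ) = r' ∧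
      (p.1 : ℕ) % 2 = 0) then bitAt x (p.1 : ℕ) (p.2 : ℕ) * bitAt x r' c else 0]
    refine Finset.sum_congr rfl fun q _ => ?_
    rw [bitAt_site, bitAt_site]
    exact if_congr (snakeKey_lt_columnKey_lt_iff p q) rfl rfl
  rw [h]
  refine Finset.sum_congr rfl fun r hr => ?_
  have hr := Finset.mem_range.1 hr
  rw [orderedPairs_eq_sum_ite, orderedPairs_eq_sum_ite]
  have h0 : ∀ f : ℕ → ℕ → ZMod 2, (if r % 2 = 0 then
      ∑ j ∈ Finset.range L, ∑ c ∈ Finset.range L, f j c else 0) =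
        ∑ j ∈ Finset.range L, ∑ c ∈ Finset.range L, if r % 2 = 0 then f j c else 0 := fun f => by
    split_ifs <;> simp
  rw [h0, ← Finset.sum_add_distrib]
  refine Finset.sum_congr rfl fun j _ => ?_
  rw [Finset.sum_comm, ← Finset.sum_add_distrib]
  refine Finset.sum_congr rfl fun c _ => ?_
  by_cases hc : j < c
  · simp only [hc, true_and, if_true]
    have h1 : ∀ r', (if r < r' ∨ r = r' ∧ r % 2 = 0 then bitAt x r j * bitAt x r' c else 0) =
        (if r + 1 ≤ r' then bitAt x r j * bitAt x r' c else 0) +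
          if r = r' then (if r % 2 = 0 then bitAt x r j * bitAt x r c else 0) else 0 := by
      intro r'
      rcases lt_trichotomy r r' with h | rfl | h
      · rw [if_pos (Or.inl h), if_pos (by omega), if_neg (by omega), add_zero]
      · simp
      · rw [if_neg (by omega), if_neg (by omega), if_neg (by omega), add_zero]
    rw [Finset.sum_congr rfl fun r' _ => h1 r', Finset.sum_add_distrib, Finset.sum_ite_eq,
      if_pos (Finset.mem_range.2 hr), suffixParity, Finset.mul_sum, ← Finset.sum_filter]
    congr 1
    refine Finset.sum_congr ?_ fun _ _ => rfl
    ext r'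
    simp only [Finset.mem_range, Finset.mem_filter, Finset.mem_Ico]
    omega
  · simp [hc]

/-- Phase 2 acts on `columnParities x` and phase 4 on `x`, while phases 1 and 3 carry no sign. The
two batches of phase 2 together cover the even rows, and where a gadget is absent at the lower edge
its term vanishes because `X` and `S` are zero there. -/
theorem gammaCircuit_eval (x : Site L → ZMod 2) : circuitBits (gammaCircuit L) x = x ∧
    circuitSign (gammaCircuit L) x = disagreement (snakeKey L) (columnKey L) x := by
  obtain ⟨b1, s1⟩ := gammaPhase1_eval x
  obtain ⟨b2, s2⟩ := gammaPhase2_eval 0 (columnParities x)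
  obtain ⟨b2', s2'⟩ := gammaPhase2_eval 2 (columnParities x)
  obtain ⟨b3, s3⟩ := gammaPhase3_eval x
  obtain ⟨b4, s4⟩ := gammaPhase4_eval x
  simp only [gammaCircuit, circuitBits_append, circuitSign_append, b1, b2, b2', b3, b4, s1, s3,
    add_zero, zero_add, true_and]
  rw [s4, s2, s2', sum_map_filter_range, sum_map_filter_range, sum_map_filter_range,
    disagreement_snakeKey_columnKey]
  set X : ℕ → ℕ → ZMod 2 := fun r c => bitAt x r c with hX
  set S : ℕ → ℕ → ZMod 2 := fun r c => suffixParity x r c with hS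
  have hSL : ∀ r, L ≤ r → S r = 0 := fun r hr => funext fun c => suffixParity_of_le x hr c
  have hXL : ∀ r, L ≤ r → X r = 0 := fun r hr => funext fun c => bitAt_of_not x (by omega)
  have hSX : ∀ r, S r = X r + S (r + 1) := fun r => by
    rcases lt_or_ge r L with hr | hr
    · exact funext fun c => suffixParity_eq_add x hr c
    · rw [hSL r hr, hXL r hr, hSL (r + 1) (by omega), add_zero]
  have hXX : ∀ r r' : ℕ, rowPairs x r r' = orderedPairs L (X r) (X r') := fun r r' =>
    rowPairs_eq_orderedPairs x r r'
  have hSS : ∀ r r' : ℕ, rowPairs (columnParities x) r r' = orderedPairs L (S r) (S r') :=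
    fun r r' => by
      rw [rowPairs_eq_orderedPairs]
      simp only [bitAt_columnParities, hS]
  have key := sum_even_rows (n := L) hSX L
  rw [hSL L le_rfl, hSL (L + 1) (by omega), orderedPairs_zero_right, ite_self, ite_self,
    add_zero] at key
  rw [Finset.sum_add_distrib, ← key, ← Finset.sum_add_distrib, ← Finset.sum_add_distrib,
    ← Finset.sum_add_distrib]
  refine Finset.sum_congr rfl fun r _ => ?_
  have e1 : (if r + 1 < L then rowPairs x r ((r : ℤ) + 1) else 0) =
      orderedPairs L (X r) (X (r + 1)) := by
    split_ifs with h
    · exact_mod_cast hXX r (r + 1)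
    · rw [hXL (r + 1) (by omega), orderedPairs_zero_right]
  have e2 : (if r + 2 < L then rowPairs (columnParities x) r ((r : ℤ) + 2) else 0) =
      orderedPairs L (S r) (S (r + 2)) := by
    split_ifs with h
    · exact_mod_cast hSS r (r + 2)
    · rw [hSL (r + 2) (by omega), orderedPairs_zero_right]
  rw [e1, e2, hXX, hSS]
  by_cases h2 : r % 2 = 0
  · by_cases h4 : r % 4 = 0
    · rw [if_pos h2, if_neg (by omega), if_pos h4, if_pos h2, if_pos h2]
      ring
    · rw [if_pos h2, if_pos (by omega), if_neg h4, if_pos h2, if_pos h2]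
      ring
  · rw [if_neg h2, if_neg (by omega), if_neg (by omega), if_neg h2, if_neg h2]
    ring

end GammaSign

/-! ### The algorithm -/

section Algorithm

variable {L : ℕ} {ρ : Equiv.Perm (Site L)}

theorem computes_gammaCircuit :
    Computes (gammaCircuit L) id (disagreement (snakeKey L) (columnKey L)) :=
  (computes_of_valid gammaCircuit_valid).congr (fun x => (gammaCircuit_eval x).1)
    fun x => (gammaCircuit_eval x).2

/-- The two copies of `Γ`, one before and one after the column stage, convert it from `columnKey` to
the snake order; the three stages then compose by the cocycle rule. -/
theorem computes_algorithmCircuit (plan : ThreeStagePlan ρ) :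
    Computes (algorithmCircuit plan) (fun x v => x (ρ.symm v)) (fermionicSign (snakeKey L) ρ) := by
  obtain ⟨A, κ, B, hA, hκ, hB, hρ⟩ := plan
  obtain rfl : (A.trans κ).trans B = ρ := Equiv.ext hρ
  refine ((((computes_rowStage A hA).append computes_gammaCircuit).append
    (computes_colStage κ hκ)).append computes_gammaCircuit).append
      (computes_rowStage B hB) |>.congr (fun _ => rfl) fun x => ?_
  rw [fermionicSign_trans snakeKey_injective, fermionicSign_trans snakeKey_injective,
    fermionicSign_eq_of_order snakeKey_injective columnKey_injective κ]
  simp only [id, Equiv.symm_trans_apply]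
  ring

theorem algorithmCircuit_valid (plan : ThreeStagePlan ρ) :
    ∀ step ∈ algorithmCircuit plan, StepValid (grid L) step := by
  intro step h
  simp only [algorithmCircuit, List.mem_append] at h
  rcases h with (((h | h) | h) | h) | h
  · exact rowStage_valid _ step h
  · exact gammaCircuit_valid step h
  · exact colStage_valid _ step h
  · exact gammaCircuit_valid step h
  · exact rowStage_valid _ step h

theorem isLOCCProtocol_algorithm (π : Equiv.Perm (Fin (L * L)))
    (plan : ThreeStagePlan (sitePerm (snake L) π)) :
    IsLOCCProtocol (grid L) (Fin.elim0 : Fin 0 → Site L) (algorithm plan)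
      (fermionicPermOn (snake L) π) :=
  ⟨Circuit.toProtocol_valid _ (algorithmCircuit_valid plan),
    (computes_algorithmCircuit plan).implements (fermionicPermOn_isSignedMap (snake L) π)⟩

theorem length_algorithmCircuit_le (hL : 1 ≤ L) (plan : ThreeStagePlan ρ) :
    (algorithmCircuit plan).length ≤ 73 * L := by
  have h1 : ∀ σ : Equiv.Perm (Site L), (rowStage σ).length = L := fun σ => by simp [rowStage]
  have h2 : (colStage plan.col).length = L := by simp [colStage]
  have h3 : (gammaCircuit L).length = 2 * (L - 1) + 3 * (2 * L + 9) := by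
    simp only [gammaCircuit, gammaPhase1, gammaPhase2, gammaPhase3, gammaPhase4, sweeps,
      List.length_append, List.length_map, List.length_reverse, List.length_range]
    ring
  simp only [algorithmCircuit, List.length_append, h1, h2, h3]
  -- The length is `19 * L + 50`, which is at most `69 * L` for `1 ≤ L`.
  omega

theorem depth_algorithm_le (hL : 1 ≤ L) (plan : ThreeStagePlan ρ) :
    (algorithm plan).depth ≤ 73 * L := by
  rw [algorithm, Circuit.depth_toProtocol]
  exact length_algorithmCircuit_le hL plan

theorem gateCount_algorithm_le (hL : 1 ≤ L) (plan : ThreeStagePlan ρ) :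
    (algorithm plan).gateCount ≤ 73 * (L * L * L) := by
  refine (Circuit.gateCount_toProtocol_le _ (algorithmCircuit_valid plan)).trans ?_
  rw [Fintype.card_prod, Fintype.card_fin]
  calc (algorithmCircuit plan).length * (L * L) ≤ 73 * L * (L * L) :=
        Nat.mul_le_mul_right _ (length_algorithmCircuit_le hL plan)
    _ = 73 * (L * L * L) := by ring

end Algorithm

/-! ### Hard permutations -/

section Hard

variable {L m : ℕ} {loc : Fin m → Site L} {P : Protocol (Site L) (Site L ⊕ Fin m)}

theorem sitePerm_modePerm {V : Type} {N : ℕ} (jw : V ≃ Fin N) (ρ : Equiv.Perm V) :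
    sitePerm jw (modePerm jw ρ) = ρ := by
  ext v
  simp [sitePerm, modePerm]

/-- The row is the quotient of the snake index by `L`. Reversal complements quotient and remainder
separately, since `L * L - 1` has both of them equal to `L - 1`. -/
theorem sitePerm_snake_rev_row (v : Site L) :
    ((sitePerm (snake L) Fin.revPerm v).1 : ℕ) = L - 1 - v.1 := by
  have hv1 := v.1.2
  have hv2 := v.2.2
  have hrow : ∀ w : Site L, (w.1 : ℕ) = snakeKey L w / L := fun w => by
    have hw := w.2.2
    rw [snakeKey_eq, Nat.add_mul_div_left _ _ (by omega), Nat.div_eq_of_lt, zero_add]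
    split_ifs <;> omega
  have hkey : snakeKey L (sitePerm (snake L) Fin.revPerm v) = L * L - 1 - snakeKey L v := by
    simp only [snakeKey, sitePerm, Equiv.trans_apply, Equiv.apply_symm_apply, Fin.revPerm_apply,
      Fin.val_rev]
    omega
  rw [hrow, hkey, snakeKey_eq]
  set a := if (v.1 : ℕ) % 2 = 0 then (v.2 : ℕ) else L - 1 - v.2 with ha
  have haL : a < L := by
    rw [ha]
    split_ifs <;> omega
  obtain ⟨d, hd⟩ := Nat.exists_eq_add_of_lt hv1
  have h : L * L = L * v.1 + L * d + L := by
    nth_rw 2 [hd]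
    ring
  rw [show L * L - 1 - (a + L * v.1) = (L - 1 - a) + L * d by omega,
    Nat.add_mul_div_left _ _ (by omega), Nat.div_eq_of_lt (by omega)]
  omega

theorem lower_bound_reflection (hL : 2 ≤ L) (jw : Site L ≃ Fin (L * L))
    (hP : IsLOCCProtocol (grid L) loc P (fermionicPermOn jw (modePerm jw (reflection L)))) :
    L * L * L ≤ 32 * P.gateCount ∧ L * L * L ≤ 32 * (P.depth * (L * L + m)) := by
  refine lower_bound_of_reverses_rows hL (fermionicPermOn_isSignedMap jw _).permutesBasis
    (fun v => ?_) hP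
  rw [sitePerm_modePerm]
  simp only [reflection, Equiv.prodCongr_apply, Prod.map_fst, Fin.revPerm_apply, Fin.val_rev]
  omega

theorem gateCount_lower_bound_snake_rev (hL : 2 ≤ L)
    (hP : IsLOCCProtocol (grid L) loc P (fermionicPermOn (snake L) Fin.revPerm)) :
    L * L * L ≤ 32 * P.gateCount :=
  (lower_bound_of_reverses_rows hL (fermionicPermOn_isSignedMap (snake L) _).permutesBasis
    sitePerm_snake_rev_row hP).1

theorem depth_lower_bound_reflection (hL : 2 ≤ L) (jw : Site L ≃ Fin (L * L)) {k : ℕ}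
    (hm : m ≤ k * (L * L))
    (hP : IsLOCCProtocol (grid L) loc P (fermionicPermOn jw (modePerm jw (reflection L)))) :
    L ≤ 32 * (k + 1) * P.depth := by
  have h := (lower_bound_reflection hL jw hP).2
  have h2 : P.depth * (L * L + m) ≤ P.depth * ((k + 1) * (L * L)) :=
    Nat.mul_le_mul_left _ (by linarith)
  refine le_of_mul_le_mul_left (?_ : L * L * L ≤ L * L * (32 * (k + 1) * P.depth)) (by positivity)
  linarith

end Hard

theorem sqrt_sites (L : ℕ) : √((L * L : ℕ) : ℝ) = L := by
  rw [Nat.cast_mul, Real.sqrt_mul_self (Nat.cast_nonneg L)]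

end FermionicRouting

theorem mainTheorem8 :
    -- the vertex expansion of the grid is of order `1 / L`
    (∃ c C : ℝ, 0 < c ∧ 0 < C ∧ ∀ L : ℕ, 2 ≤ L →
      c / (L : ℝ) ≤ vertexExpansion (grid L) ∧ vertexExpansion (grid L) ≤ C / (L : ℝ)) ∧
    -- depth lower bound, in the LOCC model with `O(N)` ancillas, for every Jordan-Wigner order
    (∀ k : ℕ, ∃ c : ℝ, 0 < c ∧ ∀ L : ℕ, 2 ≤ L → ∀ jw : Site L ≃ Fin (L * L),
      ∃ π : Equiv.Perm (Fin (L * L)),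
        ∀ (m : ℕ) (loc : Fin m → Site L) (P : Protocol (Site L) (Site L ⊕ Fin m)),
          m ≤ k * (L * L) → IsLOCCProtocol (grid L) loc P (fermionicPermOn jw π) →
            c * √((L * L : ℕ) : ℝ) ≤ (P.depth : ℝ)) ∧
    -- gate-count lower bound for the reversal `j ↦ N - 1 - j` of the snake order, and for the
    -- reversal of the grid under every Jordan-Wigner order, with any number of ancillas
    (∃ c : ℝ, 0 < c ∧ ∀ L : ℕ, 2 ≤ L →
      ∀ (m : ℕ) (loc : Fin m → Site L) (P : Protocol (Site L) (Site L ⊕ Fin m)),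
        (IsLOCCProtocol (grid L) loc P (fermionicPermOn (snake L) Fin.revPerm) →
          c * (((L * L : ℕ) : ℝ) * √((L * L : ℕ) : ℝ)) ≤ (P.gateCount : ℝ)) ∧
        (∀ jw : Site L ≃ Fin (L * L),
          IsLOCCProtocol (grid L) loc P (fermionicPermOn jw (modePerm jw (reflection L))) →
            c * (((L * L : ℕ) : ℝ) * √((L * L : ℕ) : ℝ)) ≤ (P.gateCount : ℝ))) ∧
    -- the algorithm is correct and attains both bounds, without ancillas, measurements, feedforward
    (∃ C : ℝ, 0 < C ∧ ∀ L : ℕ, 1 ≤ L → ∀ π : Equiv.Perm (Fin (L * L)),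
      Nonempty (ThreeStagePlan (sitePerm (snake L) π)) ∧
      ∀ plan : ThreeStagePlan (sitePerm (snake L) π),
        IsLOCCProtocol (grid L) (Fin.elim0 : Fin 0 → Site L) (algorithm plan)
          (fermionicPermOn (snake L) π) ∧
        (algorithm plan).MeasurementFree ∧
        ((algorithm plan).depth : ℝ) ≤ C * √((L * L : ℕ) : ℝ) ∧
        ((algorithm plan).gateCount : ℝ) ≤ C * (((L * L : ℕ) : ℝ) * √((L * L : ℕ) : ℝ))) ∧
    -- hence its worst-case depth is optimal up to a constant among the LOCC protocols with `O(N)`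
    -- ancillas
    (∀ k : ℕ, ∃ C : ℝ, 0 < C ∧ ∀ L : ℕ, 2 ≤ L → ∃ π : Equiv.Perm (Fin (L * L)),
      ∀ (m : ℕ) (loc : Fin m → Site L) (P : Protocol (Site L) (Site L ⊕ Fin m)),
        m ≤ k * (L * L) → IsLOCCProtocol (grid L) loc P (fermionicPermOn (snake L) π) →
          ∀ (π' : Equiv.Perm (Fin (L * L))) (plan : ThreeStagePlan (sitePerm (snake L) π')),
            ((algorithm plan).depth : ℝ) ≤ C * (P.depth : ℝ)) ∧
    -- and so is its worst-case gate count, with the reversal as the hard permutation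
    (∃ C : ℝ, 0 < C ∧ ∀ L : ℕ, 2 ≤ L →
      ∀ (m : ℕ) (loc : Fin m → Site L) (P : Protocol (Site L) (Site L ⊕ Fin m)),
        IsLOCCProtocol (grid L) loc P (fermionicPermOn (snake L) Fin.revPerm) →
          ∀ (π' : Equiv.Perm (Fin (L * L))) (plan : ThreeStagePlan (sitePerm (snake L) π')),
            ((algorithm plan).gateCount : ℝ) ≤ C * (P.gateCount : ℝ)) := by
  refine ⟨⟨1, 3, one_pos, by norm_num, fun L hL => vertexExpansion_grid hL⟩,
    fun k => ⟨1 / (32 * (k + 1)), by positivity, fun L hL jw => ⟨modePerm jw (reflection L),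
      fun m loc P hm hP => ?_⟩⟩,
    ⟨1 / 32, by norm_num, fun L hL m loc P => ⟨fun hP => ?_, fun jw hP => ?_⟩⟩,
    ⟨73, by norm_num, fun L hL π => ⟨nonempty_threeStagePlan _, fun plan =>
      ⟨isLOCCProtocol_algorithm π plan, Circuit.toProtocol_measurementFree _, ?_, ?_⟩⟩⟩,
    fun k => ⟨73 * (32 * (k + 1)), by positivity, fun L hL =>
      ⟨modePerm (snake L) (reflection L), fun m loc P hm hP π' plan => ?_⟩⟩,
    ⟨73 * 32, by norm_num, fun L hL m loc P hP π' plan => ?_⟩⟩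
  · have h : (L : ℝ) ≤ 32 * (k + 1) * P.depth := by
      exact_mod_cast depth_lower_bound_reflection hL jw hm hP
    rw [sqrt_sites, one_div, inv_mul_le_iff₀ (by positivity)]
    exact h
  · have h : (L : ℝ) * L * L ≤ 32 * P.gateCount := by
      exact_mod_cast gateCount_lower_bound_snake_rev hL hP
    rw [sqrt_sites]
    push_cast
    linarith
  · have h : (L : ℝ) * L * L ≤ 32 * P.gateCount := by
      exact_mod_cast (lower_bound_reflection hL jw hP).1
    rw [sqrt_sites]
    push_cast
    linarith
  · rw [sqrt_sites]
    exact_mod_cast depth_algorithm_le hL plan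
  · rw [sqrt_sites]
    exact_mod_cast gateCount_algorithm_le hL plan
  · have h := depth_lower_bound_reflection hL (snake L) hm hP
    have h' : (algorithm plan).depth ≤ 73 * (32 * (k + 1)) * P.depth :=
      (depth_algorithm_le (by omega) plan).trans (by linarith)
    exact_mod_cast h'
  · have h := gateCount_lower_bound_snake_rev hL hP
    have h' : (algorithm plan).gateCount ≤ 73 * 32 * P.gateCount :=
      (gateCount_algorithm_le (by omega) plan).trans (by linarith)
    exact_mod_cast h'
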